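/- **Theorem 5.1 (Weak Minami Estimate).** Let $d,r\ge 1$ be integers. Let $(\omega_k)_{k\in r\mathbb Z^d}$ be independent random variables with a common density $\rho$ that vanishes outside $[0,1]$ and satisfies, for some constants $\mathcal K,\rho_-,\rho_+\in(0,\infty)$ and all $x,y\in[0,1]$, $|\rho(x)-\rho(y)|\le\mathcal K|x-y|$ and $\rho_-<\rho(x)<\rho_+$. For $n\in\mathbb Z^d$ and $s\in\mathbb N$ let $\Lambda_s(n)=\prod_{j=1}^d\{n_j,\dots,n_j+s-1\}$. Let $H_0$ be the discrete Laplacian on $\ell^2(\mathbb Z^d)$, $(H_0f)(n)=2d\,f(n)-\sum_{|k-n|=1}f(k)$. For $L\in r\mathbb N$ and a cube $\Lambda_L=\Lambda_L(c)$ of side length $L$ with vertex $c\in r\mathbb Z^d$, let $$H_\omega^L:=\chi_{\Lambda_L}H_0\chi_{\Lambda_L}+\sum_{k\in r\mathbb Z^d\cap\Lambda_L}\omega_k\,\chi_{\Lambda_r(k)}\qquad\text{on }\ell^2(\Lambda_L).$$ Put $\gamma_{\infty,r}:=1-\cos(\pi/r)$ and $I_{\mathrm{sp}}:=[0,\gamma_{\infty,r}]\cup[4d+1-\gamma_{\infty,r},\,4d+1]$.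 Then for every $p>0$ there are constants $C>0$ and $\mathcal L_{\mathrm{sp}}>0$ such that $$\mathbb P\{\operatorname{tr}\chi_I(H_\omega^L)\ge 2\}\le C\,L^{4d}\,\delta\,|\log\delta|^{-p}$$ for all $L\in r\mathbb N$ with $L\ge\mathcal L_{\mathrm{sp}}$, all such cubes $\Lambda_L$, all $0<\delta\le\exp(-(\log L)^5)$, and all intervals $I\subset I_{\mathrm{sp}}$ of length $|I|=\delta$. Here $\operatorname{tr}\chi_I(H_\omega^L)$ is the number of eigenvalues of $H_\omega^L$ in $I$, counted with multiplicity. -/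

import Mathlib

open MeasureTheory ProbabilityTheory

noncomputable section

namespace HigherRankAnderson

/-- The sites of the lattice `ℤ^d`. -/
abbrev Site (d : ℕ) : Type := Fin d → ℤ

/-- The sublattice `r ℤ^d`, which indexes the random variables. -/
abbrev BlockSite (d r : ℕ) : Type := {k : Site d // ∀ i, (r : ℤ) ∣ k i}

/-- The discrete cube `∏ j, {n j, …, n j + s - 1}` of side length `s` with vertex `n`. -/
def cube {d : ℕ} (s : ℕ) (n : Site d) : Finset (Site d) :=
  Fintype.piFinset fun i => Finset.Ico (n i) (n i + s)

/-- The kernel of the positive discrete Laplacian on `ℤ^d`,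
`(H₀ f)(n) = 2 d f(n) - ∑_{|k - n| = 1} f(k)`. -/
def latticeLaplacian (d : ℕ) : Matrix (Site d) (Site d) ℂ := fun n k =>
  if n = k then 2 * (d : ℂ) else if ∑ i, |k i - n i| = 1 then -1 else 0

/-- The restriction of the discrete Laplacian to `Λ_L` with simple boundary conditions, i.e.
the compression `χ_Λ H₀ χ_Λ` acting on `ℓ²(Λ_L)`, where `Λ_L = cube L c`. -/
def localLaplacian {d : ℕ} (L : ℕ) (c : Site d) : Matrix (cube L c) (cube L c) ℂ :=
  (latticeLaplacian d).submatrix Subtype.val Subtype.val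

/-- The indices `k ∈ r ℤ^d` that lie in `Λ_L = cube L c`. -/
def boxIndex {d : ℕ} (r L : ℕ) (c : Site d) : Finset (BlockSite d r) :=
  (cube L c).subtype fun k => ∀ i, (r : ℤ) ∣ k i

/-- The local potential `∑ k ω_k χ_{Λ_r(k)}`, the sum running over the indices `k ∈ r ℤ^d` in
`Λ_L = cube L c`; it acts on `ℓ²(Λ_L)` by multiplication. -/
def localPotential {d : ℕ} (r L : ℕ) (c : Site d) (ω : BlockSite d r → ℝ) :
    Matrix (cube L c) (cube L c) ℂ :=
  Matrix.diagonal fun n =>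
    ((∑ k ∈ boxIndex r L c, if n.1 ∈ cube r k.1 then ω k else 0 : ℝ) : ℂ)

/-- The local random Schrödinger operator `H_ω^L = H₀^L + V_ω^L` on `ℓ²(Λ_L)`. -/
def localHamiltonian {d : ℕ} (r L : ℕ) (c : Site d) (ω : BlockSite d r → ℝ) :
    Matrix (cube L c) (cube L c) ℂ :=
  localLaplacian L c + localPotential r L c ω

/-- `tr χ_I(H)`, where `χ_I(H)` is the indicator function of `I` applied to the Hermitian matrix
`H` by the functional calculus (the spectral projection of `H` for `I`). It is the number of
eigenvalues of `H` in `I`, counted with multiplicity. -/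
def traceSpectralProjection {n : Type*} [Fintype n] [DecidableEq n]
    (I : Set ℝ) (H : Matrix n n ℂ) : ℝ :=
  (Matrix.trace (cfc (I.indicator fun _ => (1 : ℝ)) H)).re

/-- The constant `γ_{∞,r} = 1 - cos(π / r)`. -/
def gammaInfty (r : ℕ) : ℝ := 1 - Real.cos (Real.pi / r)

/-- The set `I_sp` of energies near the two band edges of `[0, 4d + 1]`. -/
def bandEdgeSet (d r : ℕ) : Set ℝ :=
  Set.Icc 0 (gammaInfty r) ∪ Set.Icc (4 * d + 1 - gammaInfty r) (4 * d + 1)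

/-- The assumptions on the single-site density: it vanishes off `[0,1]`, and on `[0,1]` it is
Lipschitz continuous and bounded above and below by positive constants. -/
structure IsAdmissibleDensity (ρ : ℝ → ℝ) : Prop where
  eq_zero : ∀ x, x ∉ Set.Icc (0 : ℝ) 1 → ρ x = 0
  lipschitz : ∃ K : ℝ, 0 < K ∧ ∀ x ∈ Set.Icc (0 : ℝ) 1, ∀ y ∈ Set.Icc (0 : ℝ) 1,
    |ρ x - ρ y| ≤ K * |x - y|
  bounded : ∃ ρ₁ ρ₂ : ℝ, 0 < ρ₁ ∧ ∀ x ∈ Set.Icc (0 : ℝ) 1, ρ₁ < ρ x ∧ ρ x < ρ₂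

/-- The random variables `ω k`, `k ∈ ι`, are independent, and all have the density `ρ`. -/
structure IsIIDWithDensity {ι Ω : Type*} [MeasurableSpace Ω] (μ : Measure Ω)
    (ω : ι → Ω → ℝ) (ρ : ℝ → ℝ) : Prop where
  measurable : ∀ k, Measurable (ω k)
  indep : iIndepFun ω μ
  law : ∀ k, μ.map (ω k) = volume.withDensity fun x => ENNReal.ofReal (ρ x)

end HigherRankAnderson

end

/-! Let N be the number of blocks in Λ_L and R = r^d, which bounds the rank of a block indicator.
Two levels E_i, E_j in an interval of length δ form a near-degeneracy, and the events describing it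
are invariant under adding one constant to all couplings. As the block indicators sum to the
identity, such a shift moves every level rigidly; averaging over shifts (`pi_inter_preimage_le`)
gives a Wegner factor Nδ for E_i ∈ I and keeps the probability of the degeneracy, under a slightly
larger product measure, as a second factor. It suffices to bound that factor by a power of L times
δ^(1/(2R)), which for δ ≤ exp(-(log L)^5) beats every power of L and of |log δ|.

The degeneracy is examined on the scales ε_q = δ^(1-q/(2R)), q = 0, …, R. By pigeonhole
(`exists_isolated_or_close`), the cluster of levels within ε_q of E_i either stops growing at some q
< R, so that it has spread at most 2ε_q and is isolated by gaps ε_(q+1), or it ends up containing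
two levels with indices at least R apart and at distance at most 2ε_R.

In the latter case, changing one coupling is a perturbation of rank at most R, so the lower of the
two levels cannot pass the old position of the upper one: along coordinate lines inside the event it
oscillates by at most 2ε_R. The partial derivatives of a level sum to 1, so integrating them bounds
the measure of the event (`pi_le_of_oscillation`). In the isolated case some block indicator is not
nearly scalar on the cluster: its form differs by κ = 1/(2L^(d+2)) on two unit vectors. By second
order perturbation theory (`lt_spread_of_cluster`), raising that coupling by any amount from 10ε_q/κ
to κε_(q+1)/8 spreads the cluster beyond 2ε_q. A line in that direction thus contains no two points
of the event at such a distance (`pi_le_of_separated`).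

The band edge is needed only to find this block (`exists_rate_gap`). On Λ_L one has H₀ ≥ λ + 2γ ∑_k
(χ_k - |φ_k⟩⟨φ_k|), with λ > 0 the Dirichlet ground state energy, γ = γ_(∞,r), and φ_k a unit vector
living on block k. If every χ_k were scalar up to κ on the span of two eigenvectors, the rank one
part, which annihilates a vector of that plane, could carry only about half the trace of χ_k there.
The kinetic energies would then add up to more than 2γ, although each is at most γ at the lower
edge. A staggered sign reduces the upper edge to the lower one.

The operator inequality is one-dimensional at heart. The ground state transform writes the Dirichlet
form on a path, minus its lowest energy, as a weighted sum over bonds. Dropping the bonds between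
blocks leaves log-concave weights on each block, whose spectral gap is at least the Neumann gap 2γ
(`weighted_poincare`). The directions are then combined through products of coordinate projections.
-/

namespace HigherRankAnderson

/-! ### Min-max and perturbation of eigenvalue clusters -/

section LinearAlgebra

variable {E : Type*} [NormedAddCommGroup E] [InnerProductSpace ℂ E] {m : ℕ}

/-- The real quadratic form of a linear operator. -/
noncomputable def quadForm (T : E →ₗ[ℂ] E) (v : E) : ℝ := (inner ℂ v (T v)).re

theorem quadForm_add (T K : E →ₗ[ℂ] E) (v : E) :
    quadForm (T + K) v = quadForm T v + quadForm K v := by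
  simp [quadForm]

theorem quadForm_smul (t : ℝ) (K : E →ₗ[ℂ] E) (v : E) :
    quadForm ((t : ℂ) • K) v = t * quadForm K v := by
  simp [quadForm]

theorem quadForm_neg (T : E →ₗ[ℂ] E) (v : E) : quadForm (-T) v = -quadForm T v := by
  simp [quadForm]

theorem quadForm_one (v : E) : quadForm (1 : E →ₗ[ℂ] E) v = ‖v‖ ^ 2 := by
  have := inner_self_eq_norm_sq (𝕜 := ℂ) v
  simpa [quadForm] using this

theorem quadForm_smul_right (T : E →ₗ[ℂ] E) (c : ℂ) (v : E) :
    quadForm T (c • v) = ‖c‖ ^ 2 * quadForm T v := by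
  simp only [quadForm, map_smul, inner_smul_left, inner_smul_right]
  rw [← mul_assoc, Complex.mul_conj, Complex.normSq_eq_norm_sq,
    Complex.re_ofReal_mul]

theorem abs_quadForm_le {K : E →ₗ[ℂ] E} (hK : ∀ v, ‖K v‖ ≤ ‖v‖) (v : E) :
    |quadForm K v| ≤ ‖v‖ ^ 2 := by
  calc |quadForm K v| ≤ ‖inner ℂ v (K v)‖ := Complex.abs_re_le_norm _
    _ ≤ ‖v‖ * ‖K v‖ := norm_inner_le_norm _ _
    _ ≤ ‖v‖ * ‖v‖ := by gcongr; exact hK v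
    _ = ‖v‖ ^ 2 := by ring

theorem quadForm_add_right {T : E →ₗ[ℂ] E} (hT : T.IsSymmetric) (u v : E) :
    quadForm T (u + v) = quadForm T u + quadForm T v + 2 * (inner ℂ u (T v)).re := by
  have h : (inner ℂ v (T u)).re = (inner ℂ u (T v)).re := by
    rw [← hT v u, ← inner_conj_symm, Complex.conj_re]
  simp only [quadForm, map_add, inner_add_left, inner_add_right, Complex.add_re, h]
  ring

/-- Second order perturbation theory, on the level of quadratic forms: a vector `ψ` and a vector
`η` of energy larger by `g`. -/
theorem le_quadForm_perturbation {T K : E →ₗ[ℂ] E} (hT : T.IsSymmetric) (hK : K.IsSymmetric)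
    (hK1 : ∀ v, ‖K v‖ ≤ ‖v‖) {ψ η : E} {e g τ : ℝ} (hψ : ‖ψ‖ = 1)
    (hψη : inner ℂ ψ η = 0) (hψTη : inner ℂ ψ (T η) = 0) (h1 : e ≤ quadForm T ψ)
    (h2 : (e + g) * ‖η‖ ^ 2 ≤ quadForm T η) (hg : 0 < g) (hτ : 0 ≤ τ) (hτg : τ ≤ g / 4) (α : ℂ) :
    (e + τ * quadForm K ψ - 2 * τ ^ 2 / g) * ‖α • ψ + η‖ ^ 2 ≤
      quadForm (T + (τ : ℂ) • K) (α • ψ + η) := by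
  have hn : ‖α • ψ + η‖ ^ 2 = ‖α‖ ^ 2 + ‖η‖ ^ 2 := by
    have := norm_add_sq_eq_norm_sq_add_norm_sq_of_inner_eq_zero (𝕜 := ℂ) (α • ψ) η
      (by rw [inner_smul_left, hψη, mul_zero])
    rw [norm_smul, hψ, mul_one] at this
    nlinarith [this]
  have hx := abs_le.1 (abs_quadForm_le hK1 ψ)
  have hy := abs_le.1 (abs_quadForm_le hK1 η)
  rw [hψ] at hx
  rw [quadForm_add, quadForm_smul, quadForm_add_right hT, quadForm_add_right hK,
    quadForm_smul_right, quadForm_smul_right, inner_smul_left, inner_smul_left, hψTη, mul_zero, hn]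
  have hc : -(‖α‖ * ‖η‖) ≤ (starRingEnd ℂ α * inner ℂ ψ (K η)).re := by
    have : |(starRingEnd ℂ α * inner ℂ ψ (K η)).re| ≤ ‖α‖ * ‖η‖ := by
      calc _ ≤ ‖starRingEnd ℂ α * inner ℂ ψ (K η)‖ := Complex.abs_re_le_norm _
        _ = ‖α‖ * ‖inner ℂ ψ (K η)‖ := by rw [norm_mul, RCLike.norm_conj]
        _ ≤ ‖α‖ * (‖ψ‖ * ‖K η‖) := by gcongr; exact norm_inner_le_norm _ _
        _ ≤ ‖α‖ * ‖η‖ := by rw [hψ, one_mul]; gcongr; exact hK1 η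
    exact (abs_le.1 this).1
  set x := quadForm K ψ
  set y := quadForm K η
  set c := (starRingEnd ℂ α * inner ℂ ψ (K η)).re
  set A := ‖α‖
  set B := ‖η‖
  -- With `τ = s * g`, the gap energy `g * B ^ 2` is spent as follows: a quarter on each of the
  -- diagonal terms `τ * y` and `τ * x * B ^ 2`, as `τ ≤ g / 4`, and a half on the square that
  -- absorbs the cross term together with `2 * s ^ 2 * g * A ^ 2`.
  obtain ⟨s, hs⟩ : ∃ s, s = τ / g := ⟨_, rfl⟩
  have hs' : τ = s * g := by rw [hs]; field_simp
  have h3 : 2 * τ ^ 2 / g = 2 * s ^ 2 * g := by rw [hs']; field_simp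
  have h4 : τ * -(A * B) ≤ τ * c := mul_le_mul_of_nonneg_left hc hτ
  have h5 : τ * -(B ^ 2) ≤ τ * y := mul_le_mul_of_nonneg_left hy.1 hτ
  have h6 : τ * x * B ^ 2 ≤ τ * B ^ 2 := by
    have := mul_le_mul_of_nonneg_left hx.2 hτ
    nlinarith [sq_nonneg B]
  have h7 : A ^ 2 * e ≤ A ^ 2 * quadForm T ψ := mul_le_mul_of_nonneg_left h1 (sq_nonneg _)
  have h8 : τ * B ^ 2 ≤ g / 4 * B ^ 2 := mul_le_mul_of_nonneg_right hτg (sq_nonneg _)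
  have h9 : 0 ≤ g * (2 * (s * A) ^ 2 - 2 * (s * A) * B + B ^ 2 / 2) := by
    apply mul_nonneg hg.le
    nlinarith [sq_nonneg (2 * (s * A) - B)]
  have h10 : 0 ≤ 2 * s ^ 2 * g * B ^ 2 := by positivity
  simp only [Complex.zero_re, mul_zero, add_zero]
  rw [h3]
  have h11 : τ * (A * B) = g * (s * A * B) := by rw [hs']; ring
  have : τ * (A ^ 2 * x + y + 2 * c) = τ * A ^ 2 * x + τ * y + 2 * (τ * c) := by ring
  rw [this]
  nlinarith

theorem norm_sq_eq_sum (b : OrthonormalBasis (Fin m) ℂ E) (v : E) :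
    ‖v‖ ^ 2 = ∑ i, ‖b.repr v i‖ ^ 2 := by
  rw [← b.repr.norm_map, EuclideanSpace.norm_sq_eq]

theorem repr_eq_zero_of_mem_span (b : OrthonormalBasis (Fin m) ℂ E) {J : Finset (Fin m)} {v : E}
    (hv : v ∈ Submodule.span ℂ (b '' J)) {i : Fin m} (hi : i ∉ J) : b.repr v i = 0 := by
  rw [b.repr_apply_apply]
  induction hv using Submodule.span_induction with
  | mem x hx =>
    obtain ⟨j, hj, rfl⟩ := hx
    rw [orthonormal_iff_ite.1 b.orthonormal, if_neg]
    rintro rfl; exact hi hj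
  | zero => simp
  | add x y _ _ hx hy => rw [inner_add_right, hx, hy, add_zero]
  | smul a x _ hx => rw [inner_smul_right, hx, mul_zero]

theorem finrank_span_image (b : OrthonormalBasis (Fin m) ℂ E) (J : Finset (Fin m)) :
    Module.finrank ℂ (Submodule.span ℂ (b '' J)) = J.card := by
  have h := b.orthonormal.linearIndependent.comp (fun j : J => (j : Fin m)) Subtype.val_injective
  have h2 := finrank_span_eq_card h
  rw [Fintype.card_coe] at h2
  rw [← h2]
  rw [Set.image_eq_range]
  rfl

theorem inner_eq_zero_of_mem_span (b : OrthonormalBasis (Fin m) ℂ E) {J J' : Finset (Fin m)}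
    (h : Disjoint J J') {u v : E} (hu : u ∈ Submodule.span ℂ (b '' J))
    (hv : v ∈ Submodule.span ℂ (b '' J')) : inner ℂ u v = 0 := by
  rw [← b.repr.inner_map_map, PiLp.inner_apply]
  refine Finset.sum_eq_zero fun i _ => ?_
  by_cases hi : i ∈ J
  · rw [repr_eq_zero_of_mem_span b hv (Finset.disjoint_left.1 h hi)]; simp
  · rw [repr_eq_zero_of_mem_span b hu hi]; simp

variable [FiniteDimensional ℂ E]

theorem quadForm_eq_sum {T : E →ₗ[ℂ] E} (hT : T.IsSymmetric) (hn : Module.finrank ℂ E = m)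
    (v : E) : quadForm T v =
      ∑ i, hT.eigenvalues hn i * ‖(hT.eigenvectorBasis hn).repr v i‖ ^ 2 := by
  rw [quadForm, ← (hT.eigenvectorBasis hn).repr.inner_map_map, PiLp.inner_apply, Complex.re_sum]
  refine Finset.sum_congr rfl fun i _ => ?_
  rw [hT.eigenvectorBasis_apply_self_apply hn v i, RCLike.inner_apply, mul_assoc,
    Complex.mul_conj, Complex.normSq_eq_norm_sq]
  exact Complex.re_ofReal_mul _ _

theorem le_quadForm_of_mem_span {T : E →ₗ[ℂ] E} (hT : T.IsSymmetric)
    (hn : Module.finrank ℂ E = m) {J : Finset (Fin m)} {c : ℝ}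
    (hc : ∀ i ∈ J, c ≤ hT.eigenvalues hn i) {v : E}
    (hv : v ∈ Submodule.span ℂ (hT.eigenvectorBasis hn '' J)) :
    c * ‖v‖ ^ 2 ≤ quadForm T v := by
  rw [quadForm_eq_sum hT hn, norm_sq_eq_sum (hT.eigenvectorBasis hn), Finset.mul_sum]
  refine Finset.sum_le_sum fun i _ => ?_
  by_cases hi : i ∈ J
  · exact mul_le_mul_of_nonneg_right (hc i hi) (sq_nonneg _)
  · simp [repr_eq_zero_of_mem_span _ hv hi]

theorem quadForm_le_of_mem_span {T : E →ₗ[ℂ] E} (hT : T.IsSymmetric)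
    (hn : Module.finrank ℂ E = m) {J : Finset (Fin m)} {c : ℝ}
    (hc : ∀ i ∈ J, hT.eigenvalues hn i ≤ c) {v : E}
    (hv : v ∈ Submodule.span ℂ (hT.eigenvectorBasis hn '' J)) :
    quadForm T v ≤ c * ‖v‖ ^ 2 := by
  rw [quadForm_eq_sum hT hn, norm_sq_eq_sum (hT.eigenvectorBasis hn), Finset.mul_sum]
  refine Finset.sum_le_sum fun i _ => ?_
  by_cases hi : i ∈ J
  · exact mul_le_mul_of_nonneg_right (hc i hi) (sq_nonneg _)
  · simp [repr_eq_zero_of_mem_span _ hv hi]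

theorem apply_mem_span {T : E →ₗ[ℂ] E} (hT : T.IsSymmetric)
    (hn : Module.finrank ℂ E = m) {J : Finset (Fin m)} {v : E}
    (hv : v ∈ Submodule.span ℂ (hT.eigenvectorBasis hn '' J)) :
    T v ∈ Submodule.span ℂ (hT.eigenvectorBasis hn '' J) := by
  induction hv using Submodule.span_induction with
  | mem x hx =>
    obtain ⟨j, hj, rfl⟩ := hx
    rw [hT.apply_eigenvectorBasis]
    exact Submodule.smul_mem _ _ (Submodule.subset_span ⟨j, hj, rfl⟩)
  | zero => simp
  | add x y _ _ hx hy => rw [map_add]; exact add_mem hx hy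
  | smul a x _ hx => rw [map_smul]; exact Submodule.smul_mem _ _ hx

theorem exists_ne_zero_mem_inf {U W : Submodule ℂ E}
    (h : Module.finrank ℂ E < Module.finrank ℂ U + Module.finrank ℂ W) :
    ∃ v, v ≠ 0 ∧ v ∈ U ∧ v ∈ W := by
  have h1 := Submodule.finrank_sup_add_finrank_inf_eq U W
  have h2 := Submodule.finrank_le (U ⊔ W)
  have h3 : 0 < Module.finrank ℂ ↥(U ⊓ W) := by omega
  obtain ⟨⟨v, hv⟩, hv0⟩ := Module.finrank_pos_iff_exists_ne_zero.1 h3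
  exact ⟨v, fun h => hv0 (Subtype.ext h), hv.1, hv.2⟩

/-- Lower half of the min-max principle. -/
theorem le_eigenvalues_of_subspace {T : E →ₗ[ℂ] E} (hT : T.IsSymmetric)
    (hn : Module.finrank ℂ E = m) (j : Fin m) (W : Submodule ℂ E)
    (hW : (j : ℕ) + 1 ≤ Module.finrank ℂ W) {c : ℝ} (hc : ∀ v ∈ W, c * ‖v‖ ^ 2 ≤ quadForm T v) :
    c ≤ hT.eigenvalues hn j := by
  have hU := finrank_span_image (hT.eigenvectorBasis hn) (Finset.Ici j)
  rw [Fin.card_Ici] at hU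
  obtain ⟨v, hv0, hvU, hvW⟩ := exists_ne_zero_mem_inf (U := Submodule.span ℂ
    (hT.eigenvectorBasis hn '' (Finset.Ici j : Finset (Fin m)))) (W := W)
    (by rw [hU, hn]; have := j.2; omega)
  have h1 := quadForm_le_of_mem_span hT hn (c := hT.eigenvalues hn j)
    (fun i hi => hT.eigenvalues_antitone hn (Finset.mem_Ici.1 hi)) hvU
  exact le_of_mul_le_mul_right ((hc v hvW).trans h1) (by positivity)

/-- Upper half of the min-max principle. -/
theorem eigenvalues_le_of_subspace {T : E →ₗ[ℂ] E} (hT : T.IsSymmetric)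
    (hn : Module.finrank ℂ E = m) (j : Fin m) (W : Submodule ℂ E)
    (hW : m ≤ Module.finrank ℂ W + j) {c : ℝ} (hc : ∀ v ∈ W, quadForm T v ≤ c * ‖v‖ ^ 2) :
    hT.eigenvalues hn j ≤ c := by
  have hU := finrank_span_image (hT.eigenvectorBasis hn) (Finset.Iic j)
  rw [Fin.card_Iic] at hU
  obtain ⟨v, hv0, hvU, hvW⟩ := exists_ne_zero_mem_inf (U := Submodule.span ℂ
    (hT.eigenvectorBasis hn '' (Finset.Iic j : Finset (Fin m)))) (W := W)
    (by rw [hU, hn]; omega)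
  have h1 := le_quadForm_of_mem_span hT hn (c := hT.eigenvalues hn j)
    (fun i hi => hT.eigenvalues_antitone hn (Finset.mem_Iic.1 hi)) hvU
  exact le_of_mul_le_mul_right (h1.trans (hc v hvW)) (by positivity)

theorem eigenvalues_le_add {T S : E →ₗ[ℂ] E} (hT : T.IsSymmetric) (hS : S.IsSymmetric)
    (hn : Module.finrank ℂ E = m) {u : ℝ}
    (h : ∀ v, quadForm T v ≤ quadForm S v + u * ‖v‖ ^ 2) (j : Fin m) :
    hT.eigenvalues hn j ≤ hS.eigenvalues hn j + u := by
  refine eigenvalues_le_of_subspace hT hn j (Submodule.span ℂ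
    (hS.eigenvectorBasis hn '' (Finset.Ici j : Finset (Fin m)))) ?_ fun v hv => ?_
  · rw [finrank_span_image, Fin.card_Ici]; omega
  · have h1 := quadForm_le_of_mem_span hS hn (c := hS.eigenvalues hn j)
      (fun i hi => hS.eigenvalues_antitone hn (Finset.mem_Ici.1 hi)) hv
    linarith [h v]

/-- A perturbation of rank at most `R` moves no eigenvalue past its `R`-th neighbour. -/
theorem eigenvalues_le_of_rank {T S K : E →ₗ[ℂ] E} (hT : T.IsSymmetric) (hS : S.IsSymmetric)
    (hn : Module.finrank ℂ E = m) {R : ℕ} (hR : Module.finrank ℂ (LinearMap.range K) ≤ R)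
    (h : ∀ v, K v = 0 → quadForm T v ≤ quadForm S v) {i j : Fin m} (hij : (i : ℕ) + R ≤ j) :
    hT.eigenvalues hn j ≤ hS.eigenvalues hn i := by
  set U := Submodule.span ℂ (hS.eigenvectorBasis hn '' (Finset.Ici i : Finset (Fin m)))
  have hU : Module.finrank ℂ U = m - i := by rw [finrank_span_image, Fin.card_Ici]
  have hk := LinearMap.finrank_range_add_finrank_ker K
  have h1 := Submodule.finrank_sup_add_finrank_inf_eq U (LinearMap.ker K)
  have h2 := Submodule.finrank_le (U ⊔ LinearMap.ker K)
  -- Intersecting with the kernel costs at most `R` dimensions, which leaves at least `m - i - R ≥ m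
  -- - j`.
  refine eigenvalues_le_of_subspace hT hn j (U ⊓ LinearMap.ker K) (by omega) fun v hv => ?_
  have h1 := quadForm_le_of_mem_span hS hn (c := hS.eigenvalues hn i)
      (fun i hi => hS.eigenvalues_antitone hn (Finset.mem_Ici.1 hi)) hv.1
  exact (h v hv.2).trans h1

/-- If an isolated cluster of eigenvalues carries a state `ψ`, then under the perturbation `τ K`
the top of the cluster moves up with at least the speed given by `ψ`. -/
theorem le_eigenvalues_cluster {T K S : E →ₗ[ℂ] E} (hT : T.IsSymmetric) (hK : K.IsSymmetric)
    (hS : S.IsSymmetric) (hn : Module.finrank ℂ E = m)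
    (hK1 : ∀ v, ‖K v‖ ≤ ‖v‖) {a b : Fin m} {g τ : ℝ} (hSe : S = T + (τ : ℂ) • K) (hg : 0 < g)
    (hgap : ∀ i < a, hT.eigenvalues hn b + g ≤ hT.eigenvalues hn i) {ψ : E} (hψ : ‖ψ‖ = 1)
    (hψm : ψ ∈ Submodule.span ℂ
      (hT.eigenvectorBasis hn '' (Finset.Icc a b : Finset (Fin m))))
    (hτ : 0 ≤ τ) (hτg : τ ≤ g / 4) :
    hT.eigenvalues hn b + τ * quadForm K ψ - 2 * τ ^ 2 / g ≤ hS.eigenvalues hn a := by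
  set U := Submodule.span ℂ (hT.eigenvectorBasis hn '' (Finset.Iio a : Finset (Fin m)))
  have hdis : Disjoint (Finset.Icc a b) (Finset.Iio a) := by
    rw [Finset.disjoint_left]; intro i hi; simp only [Finset.mem_Icc, Finset.mem_Iio] at *
    exact not_lt.2 hi.1
  have hψ0 : ψ ≠ 0 := by rintro rfl; simp at hψ
  have hinf : Submodule.span ℂ {ψ} ⊓ U = ⊥ := by
    rw [Submodule.eq_bot_iff]
    rintro x ⟨hx, hxU⟩
    obtain ⟨c, rfl⟩ := Submodule.mem_span_singleton.1 hx
    have h1 := inner_eq_zero_of_mem_span (hT.eigenvectorBasis hn) hdis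
      (Submodule.smul_mem _ c hψm) hxU
    exact inner_self_eq_zero.1 h1
  -- Eigenvalues decrease with the index, so `U` is spanned by the `a` eigenvectors above the
  -- cluster; together with `ψ` the test space has dimension `a + 1`.
  refine le_eigenvalues_of_subspace hS hn a (Submodule.span ℂ {ψ} ⊔ U) ?_ fun v hv => ?_
  · have h1 := Submodule.finrank_sup_add_finrank_inf_eq (Submodule.span ℂ {ψ}) U
    rw [hinf, finrank_bot, finrank_span_singleton hψ0, finrank_span_image, Fin.card_Iio] at h1
    omega
  · obtain ⟨x, hx, η, hη, rfl⟩ := Submodule.mem_sup.1 hv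
    obtain ⟨α, rfl⟩ := Submodule.mem_span_singleton.1 hx
    rw [hSe]
    refine le_quadForm_perturbation hT hK hK1 hψ
      (inner_eq_zero_of_mem_span _ hdis hψm hη)
      (inner_eq_zero_of_mem_span _ hdis hψm (apply_mem_span hT hn hη)) ?_ ?_ hg hτ hτg α
    · have := le_quadForm_of_mem_span hT hn (c := hT.eigenvalues hn b)
        (fun i hi => hT.eigenvalues_antitone hn (Finset.mem_Icc.1 hi).2) hψm
      simpa [hψ] using this
    · exact le_quadForm_of_mem_span hT hn (fun i hi => hgap i (Finset.mem_Iio.1 hi)) hη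

/-- If an isolated cluster of eigenvalues carries a state `ψ`, then under the perturbation `τ K`
the bottom of the cluster moves up with at most the speed given by `ψ`. -/
theorem eigenvalues_cluster_le {T K S : E →ₗ[ℂ] E} (hT : T.IsSymmetric) (hK : K.IsSymmetric)
    (hS : S.IsSymmetric) (hn : Module.finrank ℂ E = m)
    (hK1 : ∀ v, ‖K v‖ ≤ ‖v‖) {a b : Fin m} {g τ : ℝ} (hSe : S = T + (τ : ℂ) • K) (hg : 0 < g)
    (hgap : ∀ i > b, hT.eigenvalues hn i ≤ hT.eigenvalues hn a - g) {ψ : E} (hψ : ‖ψ‖ = 1)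
    (hψm : ψ ∈ Submodule.span ℂ
      (hT.eigenvectorBasis hn '' (Finset.Icc a b : Finset (Fin m))))
    (hτ : 0 ≤ τ) (hτg : τ ≤ g / 4) :
    hS.eigenvalues hn b ≤ hT.eigenvalues hn a + τ * quadForm K ψ + 2 * τ ^ 2 / g := by
  set U := Submodule.span ℂ (hT.eigenvectorBasis hn '' (Finset.Ioi b : Finset (Fin m)))
  have hdis : Disjoint (Finset.Icc a b) (Finset.Ioi b) := by
    rw [Finset.disjoint_left]; intro i hi; simp only [Finset.mem_Icc, Finset.mem_Ioi] at *
    exact not_lt.2 hi.2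
  have hψ0 : ψ ≠ 0 := by rintro rfl; simp at hψ
  have hinf : Submodule.span ℂ {ψ} ⊓ U = ⊥ := by
    rw [Submodule.eq_bot_iff]
    rintro x ⟨hx, hxU⟩
    obtain ⟨c, rfl⟩ := Submodule.mem_span_singleton.1 hx
    have h1 := inner_eq_zero_of_mem_span (hT.eigenvectorBasis hn) hdis
      (Submodule.smul_mem _ c hψm) hxU
    exact inner_self_eq_zero.1 h1
  refine eigenvalues_le_of_subspace hS hn b (Submodule.span ℂ {ψ} ⊔ U) ?_ fun v hv => ?_
  · have h1 := Submodule.finrank_sup_add_finrank_inf_eq (Submodule.span ℂ {ψ}) U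
    rw [hinf, finrank_bot, finrank_span_singleton hψ0, finrank_span_image, Fin.card_Ioi] at h1
    have := b.2
    omega
  · obtain ⟨x, hx, η, hη, rfl⟩ := Submodule.mem_sup.1 hv
    obtain ⟨α, rfl⟩ := Submodule.mem_span_singleton.1 hx
    have hψη := inner_eq_zero_of_mem_span _ hdis hψm (apply_mem_span hT hn hη)
    have hTψ := quadForm_le_of_mem_span hT hn (c := hT.eigenvalues hn a)
        (fun i hi => hT.eigenvalues_antitone hn (Finset.mem_Icc.1 hi).1) hψm
    have hTη := quadForm_le_of_mem_span hT hn (fun i hi => hgap i (Finset.mem_Ioi.1 hi)) hη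
    -- For `-T` and `-K` the states below the cluster become those of higher energy, so the same
    -- lower bound applies.
    have key := le_quadForm_perturbation (T := -T) (K := -K) (e := -hT.eigenvalues hn a) (g := g)
      (by intro u v; simp [hT u v]) (by intro u v; simp [hK u v]) (by simpa using hK1) hψ
      (inner_eq_zero_of_mem_span _ hdis hψm hη)
      (by simpa using hψη) (by rw [quadForm_neg]; rw [hψ] at hTψ; linarith)
      (by rw [quadForm_neg]; linarith) hg hτ hτg α
    have h2 : -T + (τ : ℂ) • -K = -S := by rw [hSe, smul_neg, neg_add]
    rw [h2, quadForm_neg, quadForm_neg] at key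
    linarith

/-- Splitting of an isolated cluster: if `K` does not act on it as a multiple of the identity, then
a perturbation `τ K` spreads the cluster out. -/
theorem lt_spread_of_cluster {T K S : E →ₗ[ℂ] E} (hT : T.IsSymmetric) (hK : K.IsSymmetric)
    (hS : S.IsSymmetric) (hn : Module.finrank ℂ E = m)
    (hK1 : ∀ v, ‖K v‖ ≤ ‖v‖) {a b : Fin m} {ε κ g τ : ℝ} (hSe : S = T + (τ : ℂ) • K)
    (hε : 0 < ε) (hκ : 0 < κ) (hκ1 : κ ≤ 1) (hg : 0 < g)
    (hspread : hT.eigenvalues hn a - hT.eigenvalues hn b ≤ ε)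
    (hgap1 : ∀ i < a, hT.eigenvalues hn b + g ≤ hT.eigenvalues hn i)
    (hgap2 : ∀ i > b, hT.eigenvalues hn i ≤ hT.eigenvalues hn a - g) {ψ ψ' : E}
    (hψ : ‖ψ‖ = 1) (hψ' : ‖ψ'‖ = 1)
    (hψm : ψ ∈ Submodule.span ℂ
      (hT.eigenvectorBasis hn '' (Finset.Icc a b : Finset (Fin m))))
    (hψm' : ψ' ∈ Submodule.span ℂ
      (hT.eigenvectorBasis hn '' (Finset.Icc a b : Finset (Fin m))))
    (hsep : κ ≤ quadForm K ψ - quadForm K ψ')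
    (hτ : 5 * ε / κ ≤ τ) (hτg : τ ≤ κ * g / 8) :
    ε < hS.eigenvalues hn a - hS.eigenvalues hn b := by
  have hτ0 : 0 < τ := lt_of_lt_of_le (by positivity) hτ
  have hτ4 : τ ≤ g / 4 := by nlinarith
  have h1 := le_eigenvalues_cluster hT hK hS hn hK1 hSe hg hgap1 hψ hψm hτ0.le hτ4
  have h2 := eigenvalues_cluster_le hT hK hS hn hK1 hSe hg hgap2 hψ' hψm' hτ0.le hτ4
  -- The new spread is at least `-ε + τ * κ - 4 * τ ^ 2 / g`. The upper bound on `τ` makes the last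
  -- term at most half of `τ * κ`, and the lower bound then leaves at least `3 * ε / 2`.
  have h3 : 2 * τ ^ 2 / g ≤ τ * κ / 4 := by
    rw [div_le_iff₀ hg]; nlinarith
  have h4 : 5 * ε ≤ τ * κ := by rwa [div_le_iff₀ hκ] at hτ
  have h5 := mul_le_mul_of_nonneg_left hsep hτ0.le
  linarith

end LinearAlgebra

/-! ### Covering families and their levels -/

theorem quadForm_sum {E ι : Type*} [NormedAddCommGroup E] [InnerProductSpace ℂ E]
    (T : ι → E →ₗ[ℂ] E) (s : Finset ι) (v : E) :
    quadForm (∑ k ∈ s, T k) v = ∑ k ∈ s, quadForm (T k) v := by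
  simp only [quadForm, LinearMap.sum_apply, inner_sum, Complex.re_sum]

/-- A linear family `T₀ + ∑ k, ω k • K k` of symmetric operators, the `K k` being nonnegative
contractions that sum up to the identity. -/
structure CoveringFamily (E ι : Type*) [NormedAddCommGroup E] [InnerProductSpace ℂ E]
    [Fintype ι] where
  T₀ : E →ₗ[ℂ] E
  K : ι → E →ₗ[ℂ] E
  symm₀ : T₀.IsSymmetric
  symm : ∀ k, (K k).IsSymmetric
  nonneg : ∀ k v, 0 ≤ quadForm (K k) v
  contr : ∀ k v, ‖K k v‖ ≤ ‖v‖
  sum_eq_one : ∑ k, K k = 1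

namespace CoveringFamily

variable {E ι : Type*} [NormedAddCommGroup E] [InnerProductSpace ℂ E] [Fintype ι]
  (F : CoveringFamily E ι) {m : ℕ}

/-- The member of the family with parameters `ω`. -/
def op (ω : ι → ℝ) : E →ₗ[ℂ] E := F.T₀ + ∑ k, (ω k : ℂ) • F.K k

theorem quadForm_op (ω : ι → ℝ) (v : E) :
    quadForm (F.op ω) v = quadForm F.T₀ v + ∑ k, ω k * quadForm (F.K k) v := by
  rw [op, quadForm_add, quadForm_sum]
  simp only [quadForm_smul]

theorem sum_quadForm (v : E) : ∑ k, quadForm (F.K k) v = ‖v‖ ^ 2 := by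
  rw [← quadForm_sum, F.sum_eq_one, quadForm_one]

theorem op_isSymmetric (ω : ι → ℝ) : (F.op ω).IsSymmetric := by
  intro u v
  simp only [op, LinearMap.add_apply, LinearMap.sum_apply, LinearMap.smul_apply, inner_add_left,
    inner_add_right, sum_inner, inner_sum, inner_smul_left, inner_smul_right, F.symm₀ u v,
    F.symm _ u v, Complex.conj_ofReal]

variable [FiniteDimensional ℂ E]

/-- The eigenvalues of the members of the family, in decreasing order. -/
noncomputable def level (hn : Module.finrank ℂ E = m) (ω : ι → ℝ) (j : Fin m) : ℝ :=
  (F.op_isSymmetric ω).eigenvalues hn j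

/-- A corresponding orthonormal basis of eigenvectors. -/
noncomputable def eigvec (hn : Module.finrank ℂ E = m) (ω : ι → ℝ) :
    OrthonormalBasis (Fin m) ℂ E :=
  (F.op_isSymmetric ω).eigenvectorBasis hn

variable (hn : Module.finrank ℂ E = m)

theorem level_antitone (ω : ι → ℝ) : Antitone (F.level hn ω) :=
  (F.op_isSymmetric ω).eigenvalues_antitone hn

theorem level_mono (j : Fin m) : Monotone fun ω => F.level hn ω j := by
  intro ω ω' h
  have := eigenvalues_le_add (F.op_isSymmetric ω) (F.op_isSymmetric ω') hn (u := 0)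
    (fun v => by
      rw [F.quadForm_op, F.quadForm_op, zero_mul, add_zero]
      gcongr with k
      · exact F.nonneg k v
      · exact h k) j
  rw [add_zero] at this
  exact this

/-- The `K k` sum to the identity, so a common shift of the couplings adds a multiple of the
identity. Both the Wegner averaging and the identity for the partial derivatives of a level rest on
this. -/
theorem level_add_const (ω : ι → ℝ) (u : ℝ) (j : Fin m) :
    F.level hn (fun k => ω k + u) j = F.level hn ω j + u := by
  have h : ∀ v, quadForm (F.op fun k => ω k + u) v = quadForm (F.op ω) v + u * ‖v‖ ^ 2 := by
    intro v
    simp only [F.quadForm_op, add_mul, Finset.sum_add_distrib, ← Finset.mul_sum, F.sum_quadForm]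
    ring
  apply le_antisymm
  · exact eigenvalues_le_add _ _ hn (fun v => (h v).le) j
  · have := eigenvalues_le_add (F.op_isSymmetric ω) (F.op_isSymmetric fun k => ω k + u) hn
      (u := -u) (fun v => by rw [h v]; linarith) j
    unfold level
    linarith

/-- On the kernel of `K k` the quadratic form does not see the coupling `k`, whatever the size of
the change; only the rank of `K k` enters. -/
theorem level_update_le [DecidableEq ι] {R : ℕ} {k : ι}
    (hR : Module.finrank ℂ (LinearMap.range (F.K k)) ≤ R) (ω : ι → ℝ) (s : ℝ) {i j : Fin m}
    (hij : (i : ℕ) + R ≤ j) : F.level hn (Function.update ω k s) j ≤ F.level hn ω i := by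
  refine eigenvalues_le_of_rank _ _ hn hR (fun v hv => ?_) hij
  rw [F.quadForm_op, F.quadForm_op]
  refine le_of_eq ?_
  congr 1
  refine Finset.sum_congr rfl fun l _ => ?_
  by_cases hl : l = k
  · subst hl; simp [quadForm, hv]
  · rw [Function.update_of_ne hl]

theorem lt_spread [DecidableEq ι] {a b : Fin m} {ε κ g τ : ℝ} {ω : ι → ℝ} {k : ι}
    (hε : 0 < ε) (hκ : 0 < κ) (hκ1 : κ ≤ 1) (hg : 0 < g)
    (hspread : F.level hn ω a - F.level hn ω b ≤ ε)
    (hgap1 : ∀ i < a, F.level hn ω b + g ≤ F.level hn ω i)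
    (hgap2 : ∀ i > b, F.level hn ω i ≤ F.level hn ω a - g) {ψ ψ' : E}
    (hψ : ‖ψ‖ = 1) (hψ' : ‖ψ'‖ = 1)
    (hψm : ψ ∈ Submodule.span ℂ (F.eigvec hn ω '' (Finset.Icc a b : Finset (Fin m))))
    (hψm' : ψ' ∈ Submodule.span ℂ (F.eigvec hn ω '' (Finset.Icc a b : Finset (Fin m))))
    (hsep : κ ≤ quadForm (F.K k) ψ - quadForm (F.K k) ψ')
    (hτ : 5 * ε / κ ≤ τ) (hτg : τ ≤ κ * g / 8) :
    ε < F.level hn (Function.update ω k (ω k + τ)) a -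
      F.level hn (Function.update ω k (ω k + τ)) b := by
  refine lt_spread_of_cluster (F.op_isSymmetric ω) (F.symm k) (F.op_isSymmetric _) hn (F.contr k)
    ?_ hε hκ hκ1 hg hspread hgap1 hgap2 hψ hψ' hψm hψm' hsep hτ hτg
  rw [op, op, add_assoc]
  congr 1
  rw [← Finset.sum_erase_add _ _ (Finset.mem_univ k),
    ← Finset.sum_erase_add _ _ (Finset.mem_univ k),
    add_assoc, Function.update_self]
  congr 1
  · refine Finset.sum_congr rfl fun l hl => ?_
    rw [Function.update_of_ne (Finset.ne_of_mem_erase hl)]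
  · rw [← add_smul]; push_cast; rfl

end CoveringFamily

/-- Functions of the couplings that behave like an eigenvalue: they are monotone and follow a
simultaneous shift of all couplings. -/
structure IsLevel {ι : Type*} (f : (ι → ℝ) → ℝ) : Prop where
  mono : Monotone f
  shift : ∀ ω u, f (fun k => ω k + u) = f ω + u

theorem CoveringFamily.isLevel {E ι : Type*} [NormedAddCommGroup E] [InnerProductSpace ℂ E]
    [Fintype ι] (F : CoveringFamily E ι) [FiniteDimensional ℂ E] {m : ℕ}
    (hn : Module.finrank ℂ E = m) (j : Fin m) : IsLevel fun ω => F.level hn ω j :=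
  ⟨F.level_mono hn j, fun ω u => F.level_add_const hn ω u j⟩

/-- Pointwise `ω` is at most `ω'` shifted by their sup distance; monotonicity and the shift rule do
the rest. -/
theorem IsLevel.lipschitz {ι : Type*} [Fintype ι] {f : (ι → ℝ) → ℝ} (hf : IsLevel f) :
    LipschitzWith 1 f := by
  refine LipschitzWith.of_le_add fun ω ω' => ?_
  rw [← hf.shift]
  refine hf.mono fun k => ?_
  have h1 := dist_le_pi_dist ω ω' k
  rw [Real.dist_eq] at h1
  linarith [le_abs_self (ω k - ω' k)]

open scoped ENNReal

/-! ### Comparison of product measures and the Wegner average -/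

section ProductMeasure

/-- Formulated for partial integrals so that the factors can be exchanged one coordinate at a time.
-/
theorem lmarginal_le_pow_mul {ι : Type*} [DecidableEq ι] {μ μ' : ι → Measure ℝ}
    [∀ i, SigmaFinite (μ i)]
    [∀ i, SigmaFinite (μ' i)] {c : ℝ≥0∞} (h : ∀ i, μ i ≤ c • μ' i) {f : (ι → ℝ) → ℝ≥0∞}
    (hf : Measurable f) (s : Finset ι) (x : ι → ℝ) :
    (∫⋯∫⁻_s, f ∂μ) x ≤ c ^ s.card * (∫⋯∫⁻_s, f ∂μ') x := by
  induction s using Finset.induction_on generalizing x with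
  | empty => simp
  | insert i s hi ih =>
    rw [lmarginal_insert f hf hi, lmarginal_insert f hf hi, Finset.card_insert_of_notMem hi]
    have hm : Measurable fun y => (∫⋯∫⁻_s, f ∂μ') (Function.update x i y) :=
      (hf.lmarginal μ').comp (measurable_update x)
    calc ∫⁻ y, (∫⋯∫⁻_s, f ∂μ) (Function.update x i y) ∂μ i
        ≤ ∫⁻ y, c ^ s.card * (∫⋯∫⁻_s, f ∂μ') (Function.update x i y) ∂μ i :=
          lintegral_mono fun y => ih _
      _ ≤ ∫⁻ y, c ^ s.card * (∫⋯∫⁻_s, f ∂μ') (Function.update x i y) ∂(c • μ' i) :=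
          lintegral_mono' (h i) le_rfl
      _ = _ := by
          rw [lintegral_smul_measure, lintegral_const_mul _ hm, smul_eq_mul, pow_succ]
          ring

variable {ι : Type*} [Fintype ι]

theorem pi_le_pow_smul_pi {μ μ' : ι → Measure ℝ} [∀ i, SigmaFinite (μ i)]
    [∀ i, SigmaFinite (μ' i)] {c : ℝ≥0∞} (h : ∀ i, μ i ≤ c • μ' i) :
    Measure.pi μ ≤ c ^ Fintype.card ι • Measure.pi μ' := by
  classical
  refine Measure.le_intro fun s hs _ => ?_
  have h1 := lmarginal_le_pow_mul h (f := s.indicator 1) (measurable_one.indicator hs)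
    Finset.univ 0
  rw [lmarginal_univ, lmarginal_univ, lintegral_indicator_one hs, lintegral_indicator_one hs] at h1
  simpa using h1

theorem pi_le_pi {μ μ' : ι → Measure ℝ} [∀ i, SigmaFinite (μ i)]
    [∀ i, SigmaFinite (μ' i)] (h : ∀ i, μ i ≤ μ' i) : Measure.pi μ ≤ Measure.pi μ' := by
  have := pi_le_pow_smul_pi (μ := μ) (μ' := μ') (c := 1) (by simpa using h)
  simpa using this

/-- A bound that is uniform along the lines in one coordinate direction integrates up. -/
theorem lintegral_pi_le_of_line [DecidableEq ι] {ν : Measure ℝ} [IsFiniteMeasure ν]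
    (hν : 1 ≤ ν Set.univ)
    (k : ι) {f : (ι → ℝ) → ℝ≥0∞} (hf : Measurable f) {c : ℝ≥0∞}
    (h : ∀ x, ∫⁻ s, f (Function.update x k s) ∂ν ≤ c) :
    ∫⁻ ω, f ω ∂Measure.pi (fun _ : ι => ν) ≤ c * ν Set.univ ^ Fintype.card ι := by
  calc ∫⁻ ω, f ω ∂Measure.pi (fun _ : ι => ν)
      ≤ ∫⁻ ω, c ∂Measure.pi (fun _ : ι => ν) := by
        -- It is enough to compare the marginals in coordinate `k`. As `ν` has mass at least 1, the
        -- constant `c` is at most its own marginal.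
        refine lintegral_le_of_lmarginal_le (μ := fun _ : ι => ν) {k} hf measurable_const ?_
        rw [lmarginal_singleton, lmarginal_singleton]
        intro x
        calc _ ≤ c := h x
          _ = c * 1 := (mul_one c).symm
          _ ≤ c * ν Set.univ := by gcongr
          _ = _ := by simp
    _ = _ := by simp [Measure.pi_univ]

/-- Wegner estimate: averaging over a simultaneous shift of the couplings. -/
theorem pi_inter_preimage_le {ν ν' : Measure ℝ} [IsFiniteMeasure ν] [IsFiniteMeasure ν'] {h : ℝ}
    (hνν' : ∀ u ∈ Set.Icc 0 h, ν ≤ ν'.map fun x => x - u)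
    {f : (ι → ℝ) → ℝ} (hf : IsLevel f) {S : Set (ι → ℝ)} (hS : MeasurableSet S)
    (hSshift : ∀ ω ∈ S, ∀ u : ℝ, (fun k => ω k + u) ∈ S) {I : Set ℝ} (hI : MeasurableSet I) :
    ENNReal.ofReal h * Measure.pi (fun _ : ι => ν) (S ∩ f ⁻¹' I) ≤
      volume I * Measure.pi (fun _ : ι => ν') S := by
  have hfm : Measurable f := hf.lipschitz.continuous.measurable
  have hA : MeasurableSet (S ∩ f ⁻¹' I) := hS.inter (hfm hI)
  set P := Measure.pi (fun _ : ι => ν')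
  -- For a fixed `u`, the law with factors `ν` is dominated by that of `ω - u` under `P`. Shift
  -- invariance of `S` and the shift rule for `f` turn the event into `ω ∈ S` and `f ω - u ∈ I`;
  -- integrating over `u` then replaces the second condition by at most `volume I`.
  have h1 : ∀ u ∈ Set.Icc 0 h, Measure.pi (fun _ : ι => ν) (S ∩ f ⁻¹' I) ≤
      ∫⁻ ω, (S.indicator 1 ω) * (I.indicator 1 (f ω - u)) ∂P := by
    intro u hu
    have hmeas : Measurable fun x : ℝ => x - u := measurable_id.sub_const u
    have h2 : Measure.pi (fun _ : ι => ν) ≤ P.map (fun ω i => ω i - u) := by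
      rw [Measure.pi_map_pi (fun _ => hmeas.aemeasurable)]
      exact pi_le_pi fun _ => hνν' u hu
    refine (h2 _).trans ?_
    have hm2 : Measurable fun (ω : ι → ℝ) i => ω i - u := by fun_prop
    rw [Measure.map_apply hm2 hA, ← lintegral_indicator_one (hm2 hA)]
    refine lintegral_mono fun ω => ?_
    by_cases hω : ω ∈ (fun (ω : ι → ℝ) i => ω i - u) ⁻¹' (S ∩ f ⁻¹' I)
    · have hS' := hSshift _ hω.1 u
      have hfu : f ω = f (fun i => ω i - u) + u := by
        rw [← hf.shift]; congr 1; ext i; ring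
      have hI' : f ω - u ∈ I := by rw [hfu, add_sub_cancel_right]; exact hω.2
      have hS'' : ω ∈ S := by simpa using hS'
      rw [Set.indicator_of_mem hω, Set.indicator_of_mem hS'', Set.indicator_of_mem hI']; simp
    · rw [Set.indicator_of_notMem hω]; exact zero_le
  calc ENNReal.ofReal h * Measure.pi (fun _ : ι => ν) (S ∩ f ⁻¹' I)
      = ∫⁻ _ in Set.Icc (0 : ℝ) h, Measure.pi (fun _ : ι => ν) (S ∩ f ⁻¹' I) := by
        rw [setLIntegral_const, Real.volume_Icc, sub_zero, mul_comm]
    _ ≤ ∫⁻ u in Set.Icc (0 : ℝ) h, (∫⁻ ω, (S.indicator 1 ω) * (I.indicator 1 (f ω - u)) ∂P) :=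
        setLIntegral_mono' measurableSet_Icc h1
    _ = ∫⁻ ω, (∫⁻ u in Set.Icc (0 : ℝ) h, (S.indicator 1 ω) * (I.indicator 1 (f ω - u))) ∂P := by
        refine lintegral_lintegral_swap (Measurable.aemeasurable ?_)
        refine Measurable.mul ((measurable_one.indicator hS).comp measurable_snd) ?_
        exact (measurable_one.indicator hI).comp ((hfm.comp measurable_snd).sub measurable_fst)
    _ ≤ ∫⁻ ω, volume I * S.indicator 1 ω ∂P := by
        refine lintegral_mono fun ω => ?_
        have hmu : Measurable fun u : ℝ => f ω - u := measurable_const.sub measurable_id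
        have hmI : Measurable fun u : ℝ => (I.indicator 1 (f ω - u) : ℝ≥0∞) :=
          (measurable_one.indicator hI).comp hmu
        rw [lintegral_const_mul _ hmI, mul_comm]
        gcongr
        calc ∫⁻ u in Set.Icc 0 h, I.indicator 1 (f ω - u)
            ≤ ∫⁻ u, I.indicator 1 (f ω - u) := setLIntegral_le_lintegral _ _
          _ = ∫⁻ u, I.indicator 1 u := lintegral_sub_left_eq_self (I.indicator 1) (f ω)
          _ = volume I := lintegral_indicator_one hI
    _ = _ := by
        rw [lintegral_const_mul _ (measurable_one.indicator hS), lintegral_indicator_one hS]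

end ProductMeasure

/-! ### Sets and monotone functions on a line -/

section Lines

/-- A set in which no two points have a distance between `τ₀` and `t` is small. -/
theorem volume_inter_Icc_le {A : Set ℝ} {τ₀ t : ℝ} (hτ : 0 < τ₀) (ht : 0 < t)
    (hA : ∀ s ∈ A, ∀ τ ∈ Set.Icc τ₀ t, s + τ ∉ A) :
    volume (A ∩ Set.Icc 0 2) ≤ ENNReal.ofReal ((2 / t + 1) * τ₀) := by
  set M := ⌊2 / t⌋₊ + 1
  have hcov : A ∩ Set.Icc 0 2 ⊆ ⋃ i ∈ Finset.range M, A ∩ Set.Ico (i * t) ((i + 1) * t) := by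
    rintro s ⟨hs, hs0, hs2⟩
    have h1 : 0 ≤ s / t := by positivity
    simp only [Set.mem_iUnion]
    refine ⟨⌊s / t⌋₊, ?_, hs, ?_, ?_⟩
    · rw [Finset.mem_range, Nat.lt_succ_iff]
      exact Nat.floor_le_floor (by gcongr)
    · rw [← le_div_iff₀ ht]; exact Nat.floor_le h1
    · rw [← div_lt_iff₀ ht]; exact Nat.lt_floor_add_one _
  -- Two points of `A` in one piece are less than `t` apart, which the hypothesis improves to less
  -- than `τ₀`.
  have hpiece : ∀ i : ℕ, volume (A ∩ Set.Ico (i * t) ((i + 1) * t)) ≤ ENNReal.ofReal τ₀ := by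
    intro i
    refine (Real.volume_le_diam _).trans (Metric.ediam_le fun x hx y hy => ?_)
    wlog hxy : x ≤ y generalizing x y
    · rw [edist_comm]; exact this y hy x hx (le_of_not_ge hxy)
    rw [edist_comm, edist_dist, Real.dist_eq, abs_of_nonneg (by linarith)]
    refine ENNReal.ofReal_le_ofReal ?_
    by_contra! hlt
    refine hA x hx.1 (y - x) ⟨hlt.le, ?_⟩ (by simpa using hy.1)
    have := hx.2.1; have := hy.2.2; linarith
  calc volume (A ∩ Set.Icc 0 2) ≤ _ := measure_mono hcov
    _ ≤ ∑ i ∈ Finset.range M, volume (A ∩ Set.Ico (i * t) ((i + 1) * t)) :=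
        measure_biUnion_finset_le _ _
    _ ≤ ∑ i ∈ Finset.range M, ENNReal.ofReal τ₀ := Finset.sum_le_sum fun i _ => hpiece i
    _ = ENNReal.ofReal (M * τ₀) := by
        rw [Finset.sum_const, Finset.card_range, nsmul_eq_mul, ENNReal.ofReal_mul (by positivity),
          ENNReal.ofReal_natCast]
    _ ≤ _ := by
        refine ENNReal.ofReal_le_ofReal ?_
        gcongr
        simp only [M]; push_cast
        have := Nat.floor_le (a := 2 / t) (by positivity)
        linarith

/-- The derivative of a monotone function has a small integral over a set on which the function
varies little. -/
theorem setLIntegral_deriv_le {φ : ℝ → ℝ} (hφ : Monotone φ) (hc : Continuous φ) {A : Set ℝ}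
    (hA : A ⊆ Set.Icc 0 2) {ε : ℝ} (h : ∀ s ∈ A, ∀ s' ∈ A, φ s' - φ s ≤ ε) :
    ∫⁻ s in A, ENNReal.ofReal (deriv φ s) ≤ ENNReal.ofReal ε := by
  rcases A.eq_empty_or_nonempty with rfl | hne
  · simp
  have hbb : BddBelow A := ⟨0, fun s hs => (hA hs).1⟩
  have hba : BddAbove A := ⟨2, fun s hs => (hA hs).2⟩
  set a := sInf A
  set b := sSup A
  have hab : a ≤ b := csInf_le_csSup hne hbb hba
  -- The infimum and supremum of `A` lie only in its closure, so the oscillation bound is extended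
  -- there first.
  have hcl : ∀ s ∈ closure A, ∀ s' ∈ closure A, φ s' - φ s ≤ ε := by
    have h2 : closure A ×ˢ closure A ⊆ {p : ℝ × ℝ | φ p.2 - φ p.1 ≤ ε} := by
      rw [← closure_prod_eq]
      exact closure_minimal (fun p hp => h _ hp.1 _ hp.2)
        (isClosed_le ((hc.comp continuous_snd).sub (hc.comp continuous_fst)) continuous_const)
    exact fun s hs s' hs' => h2 (Set.mk_mem_prod hs hs')
  have hba' := hcl a (csInf_mem_closure hne hbb) b (csSup_mem_closure hne hba)
  have hint := (hφ.monotoneOn (Set.uIcc a b)).intervalIntegrable_deriv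
  have hmem := (hφ.monotoneOn (Set.uIcc a b)).intervalIntegral_deriv_mem_uIcc
  rw [Set.uIcc_of_le (sub_nonneg.2 (hφ hab))] at hmem
  calc ∫⁻ s in A, ENNReal.ofReal (deriv φ s)
      ≤ ∫⁻ s in Set.Icc a b, ENNReal.ofReal (deriv φ s) :=
        lintegral_mono_set fun s hs => ⟨csInf_le hbb hs, le_csSup hba hs⟩
    _ = ∫⁻ s in Set.Ioc a b, ENNReal.ofReal (deriv φ s) := by
        rw [restrict_Ioc_eq_restrict_Icc]
    _ = ENNReal.ofReal (∫ s in Set.Ioc a b, deriv φ s) :=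
        (ofReal_integral_eq_lintegral_ofReal ((intervalIntegrable_iff_integrableOn_Ioc_of_le hab).1
          hint) (Filter.Eventually.of_forall fun s => hφ.deriv_nonneg)).symm
    _ ≤ ENNReal.ofReal ε := by
        rw [← intervalIntegral.integral_of_le hab]
        exact ENNReal.ofReal_le_ofReal (hmem.2.trans hba')

end Lines

/-! ### Measure of sets with controlled sections -/

section LevelSets

variable {ι : Type*} [Fintype ι] [DecidableEq ι] {ν : Measure ℝ} [IsFiniteMeasure ν] {B : ℝ≥0∞}

theorem setLIntegral_le_mul {ν : Measure ℝ} (hνB : ν ≤ B • volume)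
    (hν2 : ν (Set.Icc 0 2)ᶜ = 0) {A : Set ℝ}
    (hA : MeasurableSet A) (f : ℝ → ℝ≥0∞) :
    ∫⁻ s in A, f s ∂ν ≤ B * ∫⁻ s in A ∩ Set.Icc 0 2, f s := by
  have h1 : ν.restrict (Set.Icc 0 2) = ν :=
    Measure.restrict_eq_self_of_ae_mem (mem_ae_iff.2 hν2)
  calc ∫⁻ s in A, f s ∂ν = ∫⁻ s in A ∩ Set.Icc 0 2, f s ∂ν := by
        conv_lhs => rw [← h1]
        rw [Measure.restrict_restrict hA]
    _ ≤ ∫⁻ s in A ∩ Set.Icc 0 2, f s ∂(B • volume) :=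
        lintegral_mono' (Measure.restrict_mono_measure hνB _) le_rfl
    _ = _ := by rw [Measure.restrict_smul, lintegral_smul_measure, smul_eq_mul]

/-- A set that meets no line in direction `k` in two points with a distance between `τ₀` and `t`
has small measure. -/
theorem pi_le_of_separated (hν1 : 1 ≤ ν Set.univ) (hνB : ν ≤ B • volume)
    (hν2 : ν (Set.Icc 0 2)ᶜ = 0) {T : Set (ι → ℝ)} (hT : MeasurableSet T) (k : ι) {τ₀ t : ℝ}
    (hτ : 0 < τ₀) (ht : 0 < t)
    (hsep : ∀ ω ∈ T, ∀ τ ∈ Set.Icc τ₀ t, Function.update ω k (ω k + τ) ∉ T) :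
    Measure.pi (fun _ : ι => ν) T ≤
      B * ENNReal.ofReal ((2 / t + 1) * τ₀) * ν Set.univ ^ Fintype.card ι := by
  rw [← lintegral_indicator_one hT]
  refine lintegral_pi_le_of_line hν1 k (measurable_one.indicator hT) fun x => ?_
  have hm : MeasurableSet (Function.update x k ⁻¹' T) := measurable_update x hT
  calc ∫⁻ s, T.indicator 1 (Function.update x k s) ∂ν
      = ∫⁻ s in Function.update x k ⁻¹' T, 1 ∂ν := by
        rw [← lintegral_indicator hm]; rfl
    _ ≤ B * ∫⁻ s in Function.update x k ⁻¹' T ∩ Set.Icc 0 2, 1 :=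
        setLIntegral_le_mul hνB hν2 hm _
    _ ≤ _ := by
        rw [setLIntegral_one]
        gcongr
        refine volume_inter_Icc_le hτ ht fun s hs τ hτ h => ?_
        refine hsep _ hs τ hτ ?_
        simpa using h

/-- A set on whose sections in the coordinate directions a level varies by at most `ε` has small
measure. -/
theorem pi_le_of_oscillation (hν1 : 1 ≤ ν Set.univ) (hνB : ν ≤ B • volume)
    (hν2 : ν (Set.Icc 0 2)ᶜ = 0) {T : Set (ι → ℝ)} (hT : MeasurableSet T)
    {f : (ι → ℝ) → ℝ} (hf : IsLevel f) {ε : ℝ}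
    (hosc : ∀ ω ∈ T, ∀ k s, Function.update ω k s ∈ T → f (Function.update ω k s) - f ω ≤ ε) :
    Measure.pi (fun _ : ι => ν) T ≤
      Fintype.card ι * (B * ENNReal.ofReal ε * ν Set.univ ^ Fintype.card ι) := by
  set P := Measure.pi (fun _ : ι => ν)
  have hac : P ≪ volume := by
    have h1 : P ≤ B ^ Fintype.card ι • (volume : Measure (ι → ℝ)) := by
      rw [volume_pi]
      exact pi_le_pow_smul_pi fun _ => hνB
    exact Measure.absolutelyContinuous_of_le_smul h1
  -- Almost everywhere the derivative in direction (1, …, 1) is the sum of the partial derivatives,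
  -- by Lipschitz continuity; the shift rule says that it equals 1. The null set is Lebesgue null
  -- and hence also `P`-null.
  have hae : ∀ᵐ ω ∂P, (1 : ℝ≥0∞) ≤ ∑ k, ENNReal.ofReal (lineDeriv ℝ f ω (Pi.single k 1)) := by
    have h1 := hf.lipschitz.ae_lineDeriv_sum_eq (μ := (volume : Measure (ι → ℝ))) Finset.univ
      (fun _ => 1) (fun k => Pi.single k (1 : ℝ))
    refine hac.ae_le ?_
    filter_upwards [h1] with ω hω
    have h2 : (∑ k : ι, (1 : ℝ) • (Pi.single k 1 : ι → ℝ)) = fun _ => 1 := by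
      ext k; simp [Finset.sum_apply, Pi.single_apply]
    have h3 : lineDeriv ℝ f ω (fun _ => 1) = 1 := by
      have : (fun t : ℝ => f (ω + t • fun _ => 1)) = fun t => f ω + t := by
        ext t; rw [← hf.shift]; congr 1; ext k; simp
      rw [lineDeriv, this]
      simp
    rw [h2, h3] at hω
    calc (1 : ℝ≥0∞) = ENNReal.ofReal 1 := ENNReal.ofReal_one.symm
      _ = ENNReal.ofReal (∑ k, lineDeriv ℝ f ω (Pi.single k 1)) := by
          simpa using congrArg ENNReal.ofReal hω
      _ ≤ _ := Finset.le_sum_of_subadditive _ ENNReal.ofReal_zero.le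
        (fun _ _ => ENNReal.ofReal_add_le) _ _
  have hdm : ∀ k : ι, Measurable fun ω => ENNReal.ofReal (lineDeriv ℝ f ω (Pi.single k 1)) :=
    fun k => (measurable_lineDeriv hf.lipschitz.continuous).ennreal_ofReal
  calc P T = ∫⁻ ω in T, 1 ∂P := setLIntegral_one T |>.symm
    _ ≤ ∫⁻ ω in T, ∑ k, ENNReal.ofReal (lineDeriv ℝ f ω (Pi.single k 1)) ∂P :=
        lintegral_mono_ae (ae_restrict_of_ae hae)
    _ = ∑ k, ∫⁻ ω in T, ENNReal.ofReal (lineDeriv ℝ f ω (Pi.single k 1)) ∂P :=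
        lintegral_finsetSum _ fun k _ => hdm k
    _ ≤ ∑ k : ι, B * ENNReal.ofReal ε * ν Set.univ ^ Fintype.card ι := by
        refine Finset.sum_le_sum fun k _ => ?_
        rw [← lintegral_indicator hT]
        refine lintegral_pi_le_of_line hν1 k ((hdm k).indicator hT) fun x => ?_
        have hm : MeasurableSet (Function.update x k ⁻¹' T) := measurable_update x hT
        set φ : ℝ → ℝ := fun s => f (Function.update x k s)
        have hd : ∀ s, lineDeriv ℝ f (Function.update x k s) (Pi.single k 1) = deriv φ s := by
          intro s
          have : (fun t : ℝ => f (Function.update x k s + t • Pi.single k 1)) =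
              fun t => φ (s + t) := by
            ext t
            simp only [φ]
            congr 1
            ext l
            by_cases hl : l = k
            · subst hl; simp
            · simp [hl]
          rw [lineDeriv, this, deriv_comp_const_add, add_zero]
        have hupd : Continuous (Function.update x k) := by fun_prop
        calc ∫⁻ s, T.indicator (fun ω => ENNReal.ofReal (lineDeriv ℝ f ω (Pi.single k 1)))
              (Function.update x k s) ∂ν
            = ∫⁻ s in Function.update x k ⁻¹' T, ENNReal.ofReal (deriv φ s) ∂ν := by
              rw [← lintegral_indicator hm]
              refine lintegral_congr fun s => ?_
              by_cases hs : Function.update x k s ∈ T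
              · simp [hs, hd]
              · simp [hs]
          _ ≤ B * ∫⁻ s in Function.update x k ⁻¹' T ∩ Set.Icc 0 2, ENNReal.ofReal (deriv φ s) :=
              setLIntegral_le_mul hνB hν2 hm _
          _ ≤ B * ENNReal.ofReal ε := by
              gcongr
              refine setLIntegral_deriv_le (fun s s' h => hf.mono ?_)
                (hf.lipschitz.continuous.comp hupd) Set.inter_subset_right
                fun s hs s' hs' => ?_
              · exact update_le_update_iff.2 ⟨h, fun _ _ => le_rfl⟩
              · have := hosc _ hs.1 k s' (by simpa using hs'.1)
                simpa [φ] using this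
    _ = _ := by simp

end LevelSets

/-! ### A dominating single-site measure -/

/-- The single-site law is dominated by small shifts of a measure of slightly larger mass. -/
theorem IsAdmissibleDensity.exists_dominating {ρ : ℝ → ℝ} (hρ : IsAdmissibleDensity ρ)
    (hprob : (volume.withDensity fun x => ENNReal.ofReal (ρ x)) Set.univ = 1) :
    ∃ B D : ℝ, 0 < B ∧ 0 < D ∧ ∀ N : ℕ, 1 ≤ N → ∃ ν' : Measure ℝ, IsFiniteMeasure ν' ∧
      1 ≤ ν' Set.univ ∧ ν' ≤ ENNReal.ofReal B • volume ∧ ν' (Set.Icc 0 2)ᶜ = 0 ∧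
      ν' Set.univ ^ N ≤ ENNReal.ofReal D ∧
      ∀ u ∈ Set.Icc (0 : ℝ) (1 / N),
        (volume.withDensity fun x => ENNReal.ofReal (ρ x)) ≤ ν'.map fun x => x - u := by
  obtain ⟨K, hK, hlip⟩ := hρ.lipschitz
  obtain ⟨ρ₁, ρ₂, hρ1, hb⟩ := hρ.bounded
  have hρ2 : 0 < ρ₂ := by have := hb 0 (by simp); linarith
  set g : ℝ → ℝ := fun x => ρ (max 0 (min x 1)) with hg
  have hproj : ∀ x : ℝ, max 0 (min x 1) ∈ Set.Icc (0 : ℝ) 1 := fun x =>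
    ⟨le_max_left _ _, max_le zero_le_one (min_le_right _ _)⟩
  have hcont : Continuous g := by
    have h1 : ContinuousOn ρ (Set.Icc 0 1) :=
      (LipschitzOnWith.of_dist_le_mul (K := ⟨K, hK.le⟩)
        fun x hx y hy => hlip x hx y hy).continuousOn
    exact h1.comp_continuous (by fun_prop) hproj
  have hgρ : ∀ x ∈ Set.Icc (0 : ℝ) 1, g x = ρ x := by
    intro x hx
    simp only [hg, min_eq_left hx.2, max_eq_right hx.1]
  have hgb : ∀ x, ρ₁ < g x ∧ g x < ρ₂ := fun x => hb _ (hproj x)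
  -- A shift by at most `h` changes `ρ` by at most `K * h = h * K' * ρ₁ ≤ h * K' * g`, so the factor
  -- `1 + h * K'` pays for it. The lower bound on the density is essential here.
  set K' := K / ρ₁
  have hK' : 0 < K' := by positivity
  refine ⟨(1 + K') * ρ₂, Real.exp (K' + ρ₂), by positivity, Real.exp_pos _, fun N hN => ?_⟩
  -- With shifts restricted to length `1 / N` the extra mass is of order `1 / N`, and the total mass
  -- of an `N`-fold product stays bounded uniformly in `N`.
  set h : ℝ := 1 / N
  have hN0 : (0 : ℝ) < N := by exact_mod_cast hN
  have hh : 0 < h := by positivity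
  have hh1 : h ≤ 1 := by
    rw [div_le_one hN0]; exact_mod_cast hN
  set ρ' : ℝ → ℝ≥0∞ :=
    (Set.Icc 0 (1 + h)).indicator fun x => ENNReal.ofReal ((1 + h * K') * g x) with hρ'
  have hρ'm : Measurable ρ' :=
    (ENNReal.measurable_ofReal.comp (by fun_prop)).indicator measurableSet_Icc
  have hmass : (volume.withDensity ρ') Set.univ ≤
      ENNReal.ofReal ((1 + h * K') * (1 + h * ρ₂)) := by
    have h01 : ∫⁻ x in Set.Icc (0 : ℝ) 1, ENNReal.ofReal (g x) = 1 := by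
      rw [← hprob, withDensity_apply _ MeasurableSet.univ, Measure.restrict_univ,
        ← lintegral_indicator measurableSet_Icc]
      refine lintegral_congr fun x => ?_
      by_cases hx : x ∈ Set.Icc (0 : ℝ) 1
      · rw [Set.indicator_of_mem hx, hgρ x hx]
      · rw [Set.indicator_of_notMem hx, hρ.eq_zero x hx, ENNReal.ofReal_zero]
    have h1h : ∫⁻ x in Set.Ioc 1 (1 + h), ENNReal.ofReal (g x) ≤ ENNReal.ofReal (h * ρ₂) := by
      calc _ ≤ ∫⁻ _ in Set.Ioc 1 (1 + h), ENNReal.ofReal ρ₂ :=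
            lintegral_mono fun x => ENNReal.ofReal_le_ofReal (hgb x).2.le
        _ = _ := by
          rw [setLIntegral_const, Real.volume_Ioc, add_sub_cancel_left, mul_comm,
            ENNReal.ofReal_mul hh.le]
    rw [withDensity_apply _ MeasurableSet.univ, Measure.restrict_univ,
      lintegral_indicator measurableSet_Icc]
    calc ∫⁻ x in Set.Icc 0 (1 + h), ENNReal.ofReal ((1 + h * K') * g x)
        = ENNReal.ofReal (1 + h * K') * ∫⁻ x in Set.Icc 0 (1 + h), ENNReal.ofReal (g x) := by
          have hgm : Measurable fun x => ENNReal.ofReal (g x) := hcont.measurable.ennreal_ofReal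
          rw [← lintegral_const_mul _ hgm]
          refine lintegral_congr fun x => ENNReal.ofReal_mul (by positivity)
      _ ≤ ENNReal.ofReal (1 + h * K') * (1 + ENNReal.ofReal (h * ρ₂)) := by
          gcongr
          rw [← Set.Icc_union_Ioc_eq_Icc (zero_le_one' ℝ) (by linarith : 1 ≤ 1 + h)]
          refine (lintegral_union_le _ _ _).trans ?_
          rw [h01]
          gcongr
      _ = _ := by
          rw [ENNReal.ofReal_mul (p := 1 + h * K') (by positivity),
            ENNReal.ofReal_add (q := h * ρ₂) zero_le_one (by positivity), ENNReal.ofReal_one]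
  have hdom : ∀ u ∈ Set.Icc (0 : ℝ) h,
      (volume.withDensity fun x => ENNReal.ofReal (ρ x)) ≤
        (volume.withDensity ρ').map fun x => x - u := by
    intro u hu
    refine Measure.le_intro fun A hA _ => ?_
    have hmu : Measurable fun x : ℝ => x - u := measurable_id.sub_const u
    rw [Measure.map_apply hmu hA, withDensity_apply _ hA, withDensity_apply _ (hmu hA),
      ← lintegral_indicator hA, ← lintegral_indicator (hmu hA), 
      ← lintegral_add_right_eq_self (((fun x => x - u) ⁻¹' A).indicator ρ') u]
    refine lintegral_mono fun y => ?_
    by_cases hy : y ∈ A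
    · have hy' : y + u ∈ (fun x => x - u) ⁻¹' A := by simpa using hy
      rw [Set.indicator_of_mem hy, Set.indicator_of_mem hy']
      by_cases hy1 : y ∈ Set.Icc (0 : ℝ) 1
      · have hyu : y + u ∈ Set.Icc (0 : ℝ) (1 + h) :=
          ⟨by linarith [hy1.1, hu.1], by linarith [hy1.2, hu.2]⟩
        rw [hρ', Set.indicator_of_mem hyu]
        refine ENNReal.ofReal_le_ofReal ?_
        have h1 := hlip y hy1 _ (hproj (y + u))
        have h2 : |y - max 0 (min (y + u) 1)| ≤ h := by
          rw [max_eq_right (le_min (by linarith [hy1.1, hu.1]) zero_le_one), abs_sub_comm,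
            abs_of_nonneg (by rw [sub_nonneg]; exact le_min (by linarith [hu.1]) hy1.2)]
          linarith [min_le_left (y + u) 1, hu.2]
        have h3 := (abs_le.1 h1).2
        have h4 : K * |y - max 0 (min (y + u) 1)| ≤ K * h := by gcongr
        have h5 : K = K' * ρ₁ := by simp only [K']; field_simp
        have h6 : h * K' * ρ₁ ≤ h * K' * g (y + u) := by
          gcongr; exact (hgb _).1.le
        have h7 : K * h = h * K' * ρ₁ := by rw [h5]; ring
        have h8 : g (y + u) = ρ (max 0 (min (y + u) 1)) := rfl
        rw [← h8] at h3
        linarith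
      · rw [hρ.eq_zero y hy1, ENNReal.ofReal_zero]; exact zero_le
    · rw [Set.indicator_of_notMem hy]; exact zero_le
  refine ⟨volume.withDensity ρ', ⟨hmass.trans_lt ENNReal.ofReal_lt_top⟩, ?_, ?_, ?_, ?_, hdom⟩
  · have h1 := hdom 0 ⟨le_rfl, hh.le⟩ Set.univ
    simp only [sub_zero] at h1
    rw [hprob] at h1
    simpa using h1
  · rw [← withDensity_const]
    refine withDensity_mono (Filter.Eventually.of_forall fun x => ?_)
    refine (Set.indicator_le_self' (fun _ _ => zero_le) x).trans (ENNReal.ofReal_le_ofReal ?_)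
    have h1 : h * K' ≤ 1 * K' := by gcongr
    have := hgb x
    gcongr
    · linarith
    · linarith
    · exact this.2.le
  · rw [withDensity_apply _ measurableSet_Icc.compl]
    refine (setLIntegral_congr_fun measurableSet_Icc.compl fun x hx => ?_).trans lintegral_zero
    refine Set.indicator_of_notMem (fun h' => hx ⟨h'.1, h'.2.trans (by linarith)⟩) _
  · calc _ ≤ ENNReal.ofReal ((1 + h * K') * (1 + h * ρ₂)) ^ N := by gcongr
      _ = ENNReal.ofReal (((1 + h * K') * (1 + h * ρ₂)) ^ N) :=
          (ENNReal.ofReal_pow (by positivity) _).symm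
      _ ≤ ENNReal.ofReal (Real.exp (h * K' + h * ρ₂) ^ N) := by
          refine ENNReal.ofReal_le_ofReal ?_
          gcongr
          rw [Real.exp_add]
          gcongr
          · linarith [Real.add_one_le_exp (h * K')]
          · linarith [Real.add_one_le_exp (h * ρ₂)]
      _ = _ := by
          rw [← Real.exp_nat_mul]
          congr 2
          simp only [h]; field_simp

/-! ### Near-degenerate levels: clusters and the two-level estimate -/

namespace CoveringFamily

variable {E ι : Type*} [NormedAddCommGroup E] [InnerProductSpace ℂ E] [FiniteDimensional ℂ E]
  [Fintype ι] (F : CoveringFamily E ι) {m : ℕ} (hn : Module.finrank ℂ E = m)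

/-- The couplings for which the levels `a` and `b` are `ε`-close. -/
def closeSet (a b : Fin m) (ε : ℝ) : Set (ι → ℝ) :=
  {ω | F.level hn ω a - F.level hn ω b ≤ ε}

theorem continuous_level (j : Fin m) : Continuous fun ω => F.level hn ω j :=
  (F.isLevel hn j).lipschitz.continuous

theorem measurableSet_closeSet (a b : Fin m) (ε : ℝ) : MeasurableSet (F.closeSet hn a b ε) :=
  (isClosed_le ((F.continuous_level hn a).sub (F.continuous_level hn b))
    continuous_const).measurableSet

/-- This invariance lets the Wegner average act without destroying the degeneracy. -/
theorem closeSet_shift (a b : Fin m) (ε : ℝ) {ω : ι → ℝ} (h : ω ∈ F.closeSet hn a b ε) (u : ℝ) :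
    (fun k => ω k + u) ∈ F.closeSet hn a b ε := by
  simp only [closeSet, Set.mem_ofPred_eq, F.level_add_const] at *
  linarith

/-- Pigeonhole over the scales: the set `J q` of levels within `ε q` of level `i` starts with at
least two members. If it grows at each of `R` steps, it ends with at least `R + 2`, so its extreme
indices are more than `R` apart. If it stalls at `q`, every level outside is more than `ε (q + 1)`
from level `i`; since level `i` lies inside the cluster, the gap persists when measured from the far
edge, which is the form used in the splitting argument. -/
theorem exists_isolated_or_close {R : ℕ} {ε : ℕ → ℝ} (hε : Monotone ε) {ω : ι → ℝ} {i j : Fin m}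
    (hij : i ≠ j) (hclose : |F.level hn ω j - F.level hn ω i| ≤ ε 0) :
    (∃ a b : Fin m, (a : ℕ) + R ≤ b ∧ ω ∈ F.closeSet hn a b (2 * ε R)) ∨
    ∃ a b : Fin m, ∃ q < R, i ∈ Finset.Icc a b ∧ j ∈ Finset.Icc a b ∧
      F.level hn ω a - F.level hn ω b ≤ 2 * ε q ∧
      (∀ l < a, F.level hn ω b + ε (q + 1) ≤ F.level hn ω l) ∧
      (∀ l > b, F.level hn ω l ≤ F.level hn ω a - ε (q + 1)) := by
  classical
  set J : ℕ → Finset (Fin m) := fun q =>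
    Finset.univ.filter fun l => |F.level hn ω l - F.level hn ω i| ≤ ε q with hJ
  have hJmono : Monotone J := fun q q' h =>
    Finset.monotone_filter_right _ fun l _ hl => hl.trans (hε h)
  have h00 : 0 ≤ ε 0 := (abs_nonneg _).trans hclose
  have hi : ∀ q, i ∈ J q := fun q => by
    simp only [hJ, Finset.mem_filter, Finset.mem_univ, true_and, sub_self, abs_zero]
    exact h00.trans (hε (Nat.zero_le q))
  have hj : ∀ q, j ∈ J q := fun q => by
    simp only [hJ, Finset.mem_filter, Finset.mem_univ, true_and]
    exact hclose.trans (hε (Nat.zero_le q))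
  have hmem : ∀ q l, l ∈ J q → |F.level hn ω l - F.level hn ω i| ≤ ε q := fun q l hl =>
    (Finset.mem_filter.1 hl).2
  have hspread : ∀ q, F.level hn ω ((J q).min' ⟨i, hi q⟩) -
      F.level hn ω ((J q).max' ⟨i, hi q⟩) ≤ 2 * ε q := by
    intro q
    have h1 := abs_le.1 (hmem q _ ((J q).min'_mem ⟨i, hi q⟩))
    have h2 := abs_le.1 (hmem q _ ((J q).max'_mem ⟨i, hi q⟩))
    linarith
  have hanti := F.level_antitone hn ω
  by_cases hq : ∃ q < R, J q = J (q + 1)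
  · right
    obtain ⟨q, hqR, hqJ⟩ := hq
    refine ⟨(J q).min' ⟨i, hi q⟩, (J q).max' ⟨i, hi q⟩, q, hqR,
      Finset.mem_Icc.2 ⟨Finset.min'_le _ _ (hi q), Finset.le_max' _ _ (hi q)⟩,
      Finset.mem_Icc.2 ⟨Finset.min'_le _ _ (hj q), Finset.le_max' _ _ (hj q)⟩, hspread q,
      fun l hl => ?_, fun l hl => ?_⟩
    · have hl1 : l ∉ J (q + 1) := by
        rw [← hqJ]; exact fun h => absurd (Finset.min'_le _ _ h) (not_le.2 hl)
      have hl2 : l ≤ i := hl.le.trans (Finset.min'_le _ _ (hi q))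
      have h1 : F.level hn ω i ≤ F.level hn ω l := hanti hl2
      have h2 : F.level hn ω ((J q).max' ⟨i, hi q⟩) ≤ F.level hn ω i :=
        hanti (Finset.le_max' _ _ (hi q))
      simp only [hJ, Finset.mem_filter, Finset.mem_univ, true_and, not_le] at hl1
      rw [abs_of_nonneg (by linarith)] at hl1
      linarith
    · have hl1 : l ∉ J (q + 1) := by
        rw [← hqJ]; exact fun h => absurd (Finset.le_max' _ _ h) (not_le.2 hl)
      have hl2 : i ≤ l := (Finset.le_max' _ _ (hi q)).trans (le_of_lt hl)
      have h1 : F.level hn ω l ≤ F.level hn ω i := hanti hl2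
      have h2 : F.level hn ω i ≤ F.level hn ω ((J q).min' ⟨i, hi q⟩) :=
        hanti (Finset.min'_le _ _ (hi q))
      simp only [hJ, Finset.mem_filter, Finset.mem_univ, true_and, not_le] at hl1
      rw [abs_of_nonpos (by linarith)] at hl1
      linarith
  · left
    push Not at hq
    have hcard : ∀ q ≤ R, q + 2 ≤ (J q).card := by
      intro q
      induction q with
      | zero =>
        intro _
        have h1 : ({i, j} : Finset (Fin m)) ⊆ J 0 := by
          intro l hl
          rcases Finset.mem_insert.1 hl with rfl | hl
          · exact hi 0
          · rw [Finset.mem_singleton.1 hl]; exact hj 0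
        have := Finset.card_le_card h1
        rwa [Finset.card_pair hij] at this
      | succ q ih =>
        intro h
        have h1 := ih (by omega)
        have h2 : J q ⊂ J (q + 1) := (hJmono (Nat.le_succ q)).lt_of_ne (hq q (by omega))
        have := Finset.card_lt_card h2
        omega
    refine ⟨(J R).min' ⟨i, hi R⟩, (J R).max' ⟨i, hi R⟩, ?_, hspread R⟩
    have h1 : J R ⊆ Finset.Icc ((J R).min' ⟨i, hi R⟩) ((J R).max' ⟨i, hi R⟩) := fun l hl =>
      Finset.mem_Icc.2 ⟨Finset.min'_le _ _ hl, Finset.le_max' _ _ hl⟩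
    have h2 := Finset.card_le_card h1
    rw [Fin.card_Icc] at h2
    have := hcard R le_rfl
    omega

variable [DecidableEq ι]

/-- The couplings for which the levels `a` and `b` are `ε`-close, but are driven apart by
increasing the coupling `k` by any amount in `[τ₀, t]`. -/
def splitSet (a b : Fin m) (k : ι) (ε τ₀ t : ℝ) : Set (ι → ℝ) :=
  {ω | F.level hn ω a - F.level hn ω b ≤ ε ∧ ∀ τ ∈ Set.Icc τ₀ t,
    ε < F.level hn (Function.update ω k (ω k + τ)) a -
      F.level hn (Function.update ω k (ω k + τ)) b}

/-- The condition quantifies over uncountably many `τ`, but its failure set is the projection of a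
closed set along the compact interval `[τ₀, t]`, hence closed. -/
theorem measurableSet_splitSet (a b : Fin m) (k : ι) (ε τ₀ t : ℝ) :
    MeasurableSet (F.splitSet hn a b k ε τ₀ t) := by
  refine (F.measurableSet_closeSet hn a b ε).inter (IsOpen.measurableSet ?_)
  have hcl : IsClosed {p : (ι → ℝ) × Set.Icc τ₀ t |
      F.level hn (Function.update p.1 k (p.1 k + p.2)) a -
        F.level hn (Function.update p.1 k (p.1 k + p.2)) b ≤ ε} := by
    have hu : Continuous fun p : (ι → ℝ) × Set.Icc τ₀ t =>
        Function.update p.1 k (p.1 k + p.2) := by fun_prop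
    exact isClosed_le (((F.continuous_level hn a).comp hu).sub
      ((F.continuous_level hn b).comp hu)) continuous_const
  have h2 := (isClosedMap_fst_of_compactSpace _ hcl).isOpen_compl
  refine (congrArg IsOpen ?_).mp h2
  ext ω
  simp only [Set.mem_compl_iff, Set.mem_image, Set.mem_ofPred_eq, Prod.exists, exists_and_right,
    exists_eq_right, not_exists, not_le, Subtype.forall]
  exact Iff.rfl

theorem splitSet_shift (a b : Fin m) (k : ι) (ε τ₀ t : ℝ) {ω : ι → ℝ}
    (h : ω ∈ F.splitSet hn a b k ε τ₀ t) (u : ℝ) :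
    (fun k => ω k + u) ∈ F.splitSet hn a b k ε τ₀ t := by
  refine ⟨F.closeSet_shift hn a b ε h.1 u, fun τ hτ => ?_⟩
  have h1 : Function.update (fun k => ω k + u) k (ω k + u + τ) =
      fun l => Function.update ω k (ω k + τ) l + u := by
    ext l
    by_cases hl : l = k
    · subst hl; simp; ring
    · simp [hl]
  rw [h1, F.level_add_const, F.level_add_const]
  linarith [h.2 τ hτ]

/-- Two levels in a short interval are improbable, provided the states of such a pair of levels
react differently to the change of a suitable coupling. -/
theorem pi_two_levels_le [Nonempty ι] {R : ℕ}
    (hR : ∀ k, Module.finrank ℂ (LinearMap.range (F.K k)) ≤ R)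
    {ν ν' : Measure ℝ} [IsFiniteMeasure ν] [IsFiniteMeasure ν'] {B D : ℝ} (hB : 0 < B)
    (hν1 : 1 ≤ ν' Set.univ) (hνB : ν' ≤ ENNReal.ofReal B • volume)
    (hν2 : ν' (Set.Icc 0 2)ᶜ = 0) (hνD : ν' Set.univ ^ Fintype.card ι ≤ ENNReal.ofReal D)
    (hνν' : ∀ u ∈ Set.Icc (0 : ℝ) (1 / Fintype.card ι), ν ≤ ν'.map fun x => x - u)
    {I : Set ℝ} (hI : I.OrdConnected) {ε : ℕ → ℝ} (hε : Monotone ε) (hε0 : 0 < ε 0)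
    (hIε : volume I = ENNReal.ofReal (ε 0)) {κ η : ℝ} (hκ : 0 < κ) (hκ1 : κ ≤ 1)
    (hηR : 2 * ε R ≤ η)
    (hη : ∀ q < R, (2 / (κ * ε (q + 1) / 8) + 1) * (5 * (2 * ε q) / κ) ≤ η)
    {G : Set (ι → ℝ)}
    (hrate : ∀ ω ∈ G, ∀ i j, i ≠ j → F.level hn ω i ∈ I → F.level hn ω j ∈ I →
      ∃ k, ∃ ψ ∈ Submodule.span ℂ {F.eigvec hn ω i, F.eigvec hn ω j},
        ∃ ψ' ∈ Submodule.span ℂ {F.eigvec hn ω i, F.eigvec hn ω j},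
          ‖ψ‖ = 1 ∧ ‖ψ'‖ = 1 ∧ κ ≤ quadForm (F.K k) ψ - quadForm (F.K k) ψ') :
    Measure.pi (fun _ : ι => ν)
      {ω | ω ∈ G ∧ ∃ i j, i ≠ j ∧ F.level hn ω i ∈ I ∧ F.level hn ω j ∈ I} ≤
      ENNReal.ofReal (m ^ 3 * (Fintype.card ι) ^ 2 * (R + 1) * (B * η * D) * ε 0) := by
  classical
  set N := Fintype.card ι
  have hN : 0 < N := Fintype.card_pos
  have hNR : (0 : ℝ) < N := by exact_mod_cast hN
  set P := Measure.pi (fun _ : ι => ν)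
  set P' := Measure.pi (fun _ : ι => ν')
  have hεpos : ∀ q, 0 < ε q := fun q => hε0.trans_le (hε (Nat.zero_le q))
  have hη0 : 0 ≤ η := le_trans (by have := hεpos R; positivity) hηR
  set X : ℝ≥0∞ := ENNReal.ofReal B * ENNReal.ofReal η * ENNReal.ofReal D
  -- Averaging over shifts of length `1 / N` costs a factor `N`.
  have hweg : ∀ (T : Set (ι → ℝ)) (i : Fin m), MeasurableSet T →
      (∀ ω ∈ T, ∀ u : ℝ, (fun k => ω k + u) ∈ T) →
      P (T ∩ (fun ω => F.level hn ω i) ⁻¹' I) ≤ N * ENNReal.ofReal (ε 0) * P' T := by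
    intro T i hT hs
    have h1 := pi_inter_preimage_le hνν' (F.isLevel hn i) hT hs hI.measurableSet
    rw [hIε] at h1
    have h2 : (N : ℝ≥0∞) * ENNReal.ofReal (1 / N) = 1 := by
      rw [← ENNReal.ofReal_natCast, ← ENNReal.ofReal_mul hNR.le, mul_one_div_cancel hNR.ne',
        ENNReal.ofReal_one]
    calc P (T ∩ (fun ω => F.level hn ω i) ⁻¹' I)
        = N * (ENNReal.ofReal (1 / N) * P (T ∩ (fun ω => F.level hn ω i) ⁻¹' I)) := by
          rw [← mul_assoc, h2, one_mul]
      _ ≤ N * (ENNReal.ofReal (ε 0) * P' T) := by gcongr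
      _ = _ := by rw [mul_assoc]
  -- Changing one coupling cannot lift level `b` above the old level `a`, which is within `2 * ε R`
  -- of the old level `b`.
  have hclose : ∀ a b : Fin m, (a : ℕ) + R ≤ b →
      P' (F.closeSet hn a b (2 * ε R)) ≤ N * X := by
    intro a b hab
    refine (pi_le_of_oscillation hν1 hνB hν2 (F.measurableSet_closeSet hn a b _)
      (F.isLevel hn b) (ε := 2 * ε R) fun ω hω k s _ => ?_).trans ?_
    · have h1 := F.level_update_le hn (hR k) ω s hab
      have h2 : F.level hn ω a - F.level hn ω b ≤ 2 * ε R := hω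
      linarith
    · simp only [X]
      gcongr
  have hsplit : ∀ (a b : Fin m) (k : ι), ∀ q < R,
      P' (F.splitSet hn a b k (2 * ε q) (5 * (2 * ε q) / κ) (κ * ε (q + 1) / 8)) ≤ X := by
    intro a b k q hq
    have hq0 := hεpos q
    have hq1 := hεpos (q + 1)
    refine (pi_le_of_separated hν1 hνB hν2 (F.measurableSet_splitSet hn a b k _ _ _) k
      (τ₀ := 5 * (2 * ε q) / κ) (t := κ * ε (q + 1) / 8) (by positivity) (by positivity)
      fun ω hω τ hτ h => ?_).trans ?_
    · exact absurd h.1 (not_le.2 (hω.2 τ hτ))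
    · simp only [X]
      gcongr
      exact hη q hq
  have hcover : {ω | ω ∈ G ∧ ∃ i j, i ≠ j ∧ F.level hn ω i ∈ I ∧ F.level hn ω j ∈ I} ⊆
      (⋃ i : Fin m, ⋃ a : Fin m, ⋃ b : Fin m, (⋃ (_ : (a : ℕ) + R ≤ b),
        F.closeSet hn a b (2 * ε R) ∩ (fun ω => F.level hn ω i) ⁻¹' I) ∪
        ⋃ k : ι, ⋃ q ∈ Finset.range R,
          F.splitSet hn a b k (2 * ε q) (5 * (2 * ε q) / κ) (κ * ε (q + 1) / 8) ∩
            (fun ω => F.level hn ω i) ⁻¹' I) := by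
    rintro ω ⟨hωG, i, j, hij, hi, hj⟩
    -- An interval containing both levels contains the segment between them, so their distance is at
    -- most its length.
    have hdist : |F.level hn ω j - F.level hn ω i| ≤ ε 0 := by
      have h1 : Set.uIcc (F.level hn ω i) (F.level hn ω j) ⊆ I := hI.uIcc_subset hi hj
      have h2 := measure_mono (μ := volume) h1
      rw [Real.volume_interval, hIε] at h2
      exact (ENNReal.ofReal_le_ofReal_iff hε0.le).1 h2
    rcases F.exists_isolated_or_close hn (R := R) hε hij hdist with
      ⟨a, b, hab, hc⟩ | ⟨a, b, q, hq, hia, hja, hsp, hg1, hg2⟩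
    · simp only [Set.mem_iUnion, Set.mem_union]
      exact ⟨i, a, b, Or.inl ⟨hab, hc, hi⟩⟩
    · obtain ⟨k, ψ, hψm, ψ', hψm', hψ, hψ', hsep⟩ := hrate ω hωG i j hij hi hj
      have hsub : Submodule.span ℂ {F.eigvec hn ω i, F.eigvec hn ω j} ≤
          Submodule.span ℂ (F.eigvec hn ω '' (Finset.Icc a b : Finset (Fin m))) := by
        refine Submodule.span_mono ?_
        rintro x (rfl | rfl)
        · exact ⟨i, hia, rfl⟩
        · exact ⟨j, hja, rfl⟩
      simp only [Set.mem_iUnion, Set.mem_union]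
      refine ⟨i, a, b, Or.inr ⟨k, q, Finset.mem_range.2 hq, ⟨hsp, fun τ hτ => ?_⟩, hi⟩⟩
      exact F.lt_spread hn (by have := hεpos q; positivity) hκ hκ1 (hεpos (q + 1)) hsp hg1 hg2
        hψ hψ' (hsub hψm) (hsub hψm') hsep hτ.1 hτ.2
  calc P _ ≤ _ := measure_mono hcover
    _ ≤ ∑ i : Fin m, ∑ a : Fin m, ∑ b : Fin m, (N * ENNReal.ofReal (ε 0) * (N * X) +
        ∑ k : ι, ∑ q ∈ Finset.range R, N * ENNReal.ofReal (ε 0) * X) := by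
      refine (measure_iUnion_fintype_le _ _).trans (Finset.sum_le_sum fun i _ => ?_)
      refine (measure_iUnion_fintype_le _ _).trans (Finset.sum_le_sum fun a _ => ?_)
      refine (measure_iUnion_fintype_le _ _).trans (Finset.sum_le_sum fun b _ => ?_)
      refine (measure_union_le _ _).trans (add_le_add ?_ ?_)
      · by_cases hab : (a : ℕ) + R ≤ b
        · simp only [hab, Set.iUnion_true]
          refine (hweg _ i (F.measurableSet_closeSet hn a b _)
            fun ω hω u => F.closeSet_shift hn a b _ hω u).trans ?_
          gcongr
          exact hclose a b hab
        · simp [hab]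
      · refine (measure_iUnion_fintype_le _ _).trans (Finset.sum_le_sum fun k _ => ?_)
        refine (measure_biUnion_finset_le _ _).trans (Finset.sum_le_sum fun q hq => ?_)
        refine (hweg _ i (F.measurableSet_splitSet hn a b k _ _ _)
            fun ω hω u => F.splitSet_shift hn a b k _ _ _ hω u).trans ?_
        gcongr
        exact hsplit a b k q (Finset.mem_range.1 hq)
    -- The factor `m ^ 3` counts `i`, `a`, `b`. One `N` is the Wegner factor; the other comes from
    -- the oscillation bound in the close case and from the choice of `k` in the isolated case.
    _ = m ^ 3 * N ^ 2 * (R + 1) * X * ENNReal.ofReal (ε 0) := by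
      simp only [Finset.sum_const, Finset.card_univ, Fintype.card_fin, Finset.card_range,
        nsmul_eq_mul]
      change (m : ℝ≥0∞) * (m * (m * (N * ENNReal.ofReal (ε 0) * (N * X) +
        N * (R * (N * ENNReal.ofReal (ε 0) * X))))) = _
      ring
    _ ≤ _ := by
      have h1 : ENNReal.ofReal (m ^ 3 * N ^ 2 * (R + 1)) = (m : ℝ≥0∞) ^ 3 * N ^ 2 * (R + 1) := by
        have : (m ^ 3 * N ^ 2 * (R + 1) : ℝ) = ((m ^ 3 * N ^ 2 * (R + 1) : ℕ) : ℝ) := by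
          push_cast; rfl
        rw [this, ENNReal.ofReal_natCast]
        push_cast; rfl
      rw [ENNReal.ofReal_mul' hε0.le, ENNReal.ofReal_mul (by positivity), h1,
        ENNReal.ofReal_mul (p := B * η) (by positivity), ENNReal.ofReal_mul hB.le]

end CoveringFamily

/-! ### Ground state transform and weighted Poincaré inequality on a path -/

section OneDimension

theorem re_conj_mul_le (z w : ℂ) : ((starRingEnd ℂ) z * w).re ≤ ‖z‖ * ‖w‖ := by
  calc _ ≤ ‖(starRingEnd ℂ) z * w‖ := Complex.re_le_norm _
    _ = _ := by rw [norm_mul, RCLike.norm_conj]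

theorem norm_sq_sub (z w : ℂ) :
    ‖z - w‖ ^ 2 = ‖z‖ ^ 2 + ‖w‖ ^ 2 - 2 * ((starRingEnd ℂ) z * w).re := by
  rw [← Complex.normSq_eq_norm_sq, ← Complex.normSq_eq_norm_sq, ← Complex.normSq_eq_norm_sq,
    Complex.normSq_sub]
  simp only [Complex.mul_re, Complex.conj_re, Complex.conj_im]
  ring

/-- The ground state transform of a Jacobi matrix on a path, up to a boundary term. -/
theorem groundState_transform {S : ℕ → ℝ} {μ : ℝ} (h0 : S 0 = 0) {n : ℕ}
    (hpos : ∀ j ≤ n, 0 < S (j + 1)) (hS : ∀ j ≤ n, S j + S (j + 2) = μ * S (j + 1)) (f : ℕ → ℂ) :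
    μ * ∑ j ∈ Finset.range (n + 1), ‖f j‖ ^ 2 -
        2 * ∑ j ∈ Finset.range n, ((starRingEnd ℂ) (f j) * f (j + 1)).re =
      ∑ j ∈ Finset.range n, S (j + 1) * S (j + 2) * ‖f j / S (j + 1) - f (j + 1) / S (j + 2)‖ ^ 2 +
        ‖f n‖ ^ 2 * (S (n + 2) / S (n + 1)) := by
  induction n with
  | zero =>
    have h1 := hS 0 le_rfl
    have h2 := hpos 0 le_rfl
    simp only [h0, zero_add] at h1 h2 ⊢
    simp [h1, h2.ne', mul_comm]
  | succ n ih =>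
    rw [Finset.sum_range_succ _ (n + 1), Finset.sum_range_succ _ n, Finset.sum_range_succ _ n,
      Finset.sum_range_succ _ n]
    have h1 := ih (fun j hj => hpos j (by omega)) fun j hj => hS j (by omega)
    have h2 := hpos n (by omega)
    have h3 := hpos (n + 1) le_rfl
    have h4 := hS (n + 1) le_rfl
    -- Of the two diagonal terms of the new bond, the first is the old boundary term; the second
    -- combines with the new boundary term to `μ * ‖f (n + 1)‖ ^ 2` by the recursion for `S`.
    have h5 : S (n + 1) * S (n + 2) * ‖f n / S (n + 1) - f (n + 1) / S (n + 2)‖ ^ 2 =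
        ‖f n‖ ^ 2 * (S (n + 2) / S (n + 1)) + ‖f (n + 1)‖ ^ 2 * (S (n + 1) / S (n + 2)) -
          2 * ((starRingEnd ℂ) (f n) * f (n + 1)).re := by
      rw [norm_sq_sub, norm_div, norm_div, Complex.norm_of_nonneg h2.le,
        Complex.norm_of_nonneg h3.le, map_div₀, Complex.conj_ofReal]
      have : (starRingEnd ℂ) (f n) / (S (n + 1) : ℂ) * (f (n + 1) / (S (n + 1 + 1) : ℂ)) =
          (((S (n + 1) * S (n + 2))⁻¹ : ℝ) : ℂ) * ((starRingEnd ℂ) (f n) * f (n + 1)) := by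
        push_cast; field_simp
      rw [this, Complex.re_ofReal_mul]
      have h3' : S (n + 2) ≠ 0 := h3.ne'
      have h2' := h2.ne'
      field_simp
    have h6 : μ = S (n + 1) / S (n + 2) + S (n + 1 + 2) / S (n + 1 + 1) := by
      rw [← add_div, h4]
      exact (mul_div_cancel_right₀ _ h3.ne').symm
    rw [h5]
    have h7 : μ * ‖f (n + 1)‖ ^ 2 = ‖f (n + 1)‖ ^ 2 * (S (n + 1) / S (n + 2)) +
        ‖f (n + 1)‖ ^ 2 * (S (n + 1 + 2) / S (n + 1 + 1)) := by
      conv_lhs => rw [h6]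
      ring
    rw [Finset.sum_range_succ _ n] at h1
    linarith

/-- The positive ground state of the discrete Dirichlet Laplacian on a path with `L` sites; the
sites are labelled from `1` to `L`. -/
noncomputable def dirichletSine (L : ℕ) (x : ℝ) : ℝ := Real.sin (Real.pi / (L + 1) * x)

theorem dirichletSine_zero (L : ℕ) : dirichletSine L 0 = 0 := by simp [dirichletSine]

theorem dirichletSine_end (L : ℕ) : dirichletSine L (L + 1) = 0 := by
  rw [dirichletSine, div_mul_cancel₀ _ (by positivity), Real.sin_pi]

theorem dirichletSine_pos {L : ℕ} {x : ℝ} (h0 : 0 < x) (h1 : x < L + 1) :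
    0 < dirichletSine L x := by
  have hL : (0 : ℝ) < L + 1 := by positivity
  refine Real.sin_pos_of_pos_of_lt_pi (by have := Real.pi_pos; positivity) ?_
  rw [div_mul_eq_mul_div, div_lt_iff₀ hL]
  exact mul_lt_mul_of_pos_left h1 Real.pi_pos

theorem dirichletSine_add (L : ℕ) (x : ℝ) : dirichletSine L x + dirichletSine L (x + 2) =
    2 * Real.cos (Real.pi / (L + 1)) * dirichletSine L (x + 1) := by
  have h1 : Real.pi / (L + 1) * x = Real.pi / (L + 1) * (x + 1) - Real.pi / (L + 1) := by ring
  have h2 : Real.pi / (L + 1) * (x + 2) = Real.pi / (L + 1) * (x + 1) + Real.pi / (L + 1) := by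
    ring
  rw [dirichletSine, dirichletSine, dirichletSine, h1, h2, Real.sin_add, Real.sin_sub]
  ring

/-- This is sin(y - θ) sin(y + θ) = sin² y - sin² θ. -/
theorem dirichletSine_logConcave (L : ℕ) (x : ℝ) :
    dirichletSine L x * dirichletSine L (x + 2) ≤ dirichletSine L (x + 1) ^ 2 := by
  have h1 : Real.pi / (L + 1) * x = Real.pi / (L + 1) * (x + 1) - Real.pi / (L + 1) := by ring
  have h2 : Real.pi / (L + 1) * (x + 2) = Real.pi / (L + 1) * (x + 1) + Real.pi / (L + 1) := by
    ring
  rw [dirichletSine, dirichletSine, dirichletSine, h1, h2, Real.sin_add, Real.sin_sub]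
  have h3 := Real.sin_sq_add_cos_sq (Real.pi / (L + 1))
  have h4 := Real.sin_sq_add_cos_sq (Real.pi / (L + 1) * (x + 1))
  nlinarith [sq_nonneg (Real.sin (Real.pi / (L + 1)))]

/-- The sine vanishes at sites 0 and `n + 2`, so the boundary term disappears; `f j` sits at site `j
+ 1`. -/
theorem groundState_transform_sine (n : ℕ) (f : ℕ → ℂ) :
    2 * Real.cos (Real.pi / (n + 1 + 1)) * ∑ j ∈ Finset.range (n + 1), ‖f j‖ ^ 2 -
        2 * ∑ j ∈ Finset.range n, ((starRingEnd ℂ) (f j) * f (j + 1)).re =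
      ∑ j ∈ Finset.range n, dirichletSine (n + 1) (j + 1) * dirichletSine (n + 1) (j + 2) *
        ‖f j / dirichletSine (n + 1) (j + 1) - f (j + 1) / dirichletSine (n + 1) (j + 2)‖ ^ 2 := by
  have h := groundState_transform (S := fun j : ℕ => dirichletSine (n + 1) j)
    (μ := 2 * Real.cos (Real.pi / (n + 1 + 1))) (n := n) (by simp [dirichletSine_zero])
    (fun j hj => dirichletSine_pos (by positivity) (by
      have : (j : ℝ) ≤ n := by exact_mod_cast hj
      push_cast; linarith))
    (fun j _ => by
      have := dirichletSine_add (n + 1) j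
      push_cast at this ⊢
      exact this) f
  rw [h]
  have h2 : dirichletSine (n + 1) ((n + 2 : ℕ) : ℝ) = 0 := by
    have := dirichletSine_end (n + 1)
    push_cast at this ⊢
    rwa [add_assoc, one_add_one_eq_two] at this
  simp only [h2, zero_div, mul_zero, add_zero]
  push_cast
  rfl

/-- The lowest eigenvalue of the Dirichlet Laplacian on a path. -/
theorem path_dirichlet_bound (n : ℕ) (b : ℕ → ℝ) :
    (2 - 2 * Real.cos (Real.pi / (n + 1 + 1))) * ∑ j ∈ Finset.range (n + 1), b j ^ 2 ≤
      2 * ∑ j ∈ Finset.range (n + 1), b j ^ 2 - 2 * ∑ j ∈ Finset.range n, b j * b (j + 1) := by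
  have h := groundState_transform_sine n fun j => (b j : ℂ)
  have h2 : 0 ≤ ∑ j ∈ Finset.range n,
      dirichletSine (n + 1) (j + 1) * dirichletSine (n + 1) (j + 2) *
        ‖(b j : ℂ) / dirichletSine (n + 1) (j + 1) -
          (b (j + 1) : ℂ) / dirichletSine (n + 1) (j + 2)‖ ^ 2 := by
    refine Finset.sum_nonneg fun j hj => ?_
    have hj' : (j : ℝ) + 1 ≤ n := by exact_mod_cast Finset.mem_range.1 hj
    have h1 : 0 < dirichletSine (n + 1) (j + 1) :=
      dirichletSine_pos (by positivity) (by push_cast; linarith)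
    have h2 : 0 < dirichletSine (n + 1) (j + 2) :=
      dirichletSine_pos (by positivity) (by push_cast; linarith)
    positivity
  rw [← h] at h2
  simp only [Complex.conj_ofReal, ← Complex.ofReal_mul, Complex.ofReal_re, Complex.norm_real,
    Real.norm_eq_abs, sq_abs] at h2
  linarith

/-- The dual form of the weighted Poincaré inequality. -/
theorem weighted_dual_bound {w : ℕ → ℝ} {n : ℕ} (hw : ∀ j ≤ n + 1, 0 < w j)
    (hlog : ∀ j < n, w j * w (j + 2) ≤ w (j + 1) ^ 2) {τ : ℕ → ℝ} (hτ : ∀ j, 0 ≤ τ j) :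
    (2 - 2 * Real.cos (Real.pi / (n + 1 + 1))) *
        ∑ j ∈ Finset.range (n + 1), τ j ^ 2 / (w j * w (j + 1)) ≤
      τ 0 ^ 2 / w 0 ^ 2 + ∑ j ∈ Finset.range n, (τ (j + 1) - τ j) ^ 2 / w (j + 1) ^ 2 +
        τ n ^ 2 / w (n + 1) ^ 2 := by
  -- This substitution compares the right side with the unweighted Dirichlet form of `b`. Its
  -- diagonal coefficients have the form t + 1/t ≥ 2, and log-concavity bounds the coefficient √(w_j
  -- w_(j+2)) / w_(j+1) of each product b_j b_(j+1) by 1; the products are nonnegative because `τ`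
  -- is.
  set b : ℕ → ℝ := fun j => τ j / √(w j * w (j + 1)) with hb
  have hww : ∀ j ≤ n, 0 < w j * w (j + 1) := fun j hj => mul_pos (hw j (by omega)) (hw _ (by omega))
  have hbsq : ∀ j ≤ n, b j ^ 2 = τ j ^ 2 / (w j * w (j + 1)) := by
    intro j hj
    rw [hb, div_pow, Real.sq_sqrt (hww j hj).le]
  have hτb : ∀ j ≤ n, τ j = b j * √(w j * w (j + 1)) := by
    intro j hj
    have := Real.sqrt_pos.2 (hww j hj)
    simp only [hb]; field_simp
  have hb0 : ∀ j, 0 ≤ b j := fun j => div_nonneg (hτ j) (Real.sqrt_nonneg _)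
  have hend : ∀ j ≤ n, 2 * b j ^ 2 ≤ b j ^ 2 * (w (j + 1) / w j) + τ j ^ 2 / w (j + 1) ^ 2 := by
    intro j hj
    have h1 := hw j (by omega)
    have h2 := hw (j + 1) (by omega)
    have h3 : τ j ^ 2 / w (j + 1) ^ 2 = b j ^ 2 * (w j / w (j + 1)) := by
      rw [hbsq j hj]; field_simp
    have h4 : 2 ≤ w (j + 1) / w j + w j / w (j + 1) := by
      rw [div_add_div _ _ h1.ne' h2.ne', le_div_iff₀ (by positivity)]
      nlinarith [sq_nonneg (w (j + 1) - w j)]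
    rw [h3]
    nlinarith [sq_nonneg (b j)]
  have hstep : ∀ k ≤ n, 2 * ∑ j ∈ Finset.range k, b j ^ 2 -
      2 * ∑ j ∈ Finset.range k, b j * b (j + 1) + b k ^ 2 * (w (k + 1) / w k) ≤
      τ 0 ^ 2 / w 0 ^ 2 + ∑ j ∈ Finset.range k, (τ (j + 1) - τ j) ^ 2 / w (j + 1) ^ 2 := by
    intro k
    induction k with
    | zero =>
      intro _
      have h1 := hw 0 (by omega)
      have h2 := hw 1 (by omega)
      simp only [Finset.range_zero, Finset.sum_empty, mul_zero, sub_zero, zero_add, add_zero]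
      rw [hbsq 0 (by omega)]
      refine le_of_eq ?_
      simp only [zero_add]
      field_simp
    | succ k ih =>
      intro hk
      have h1 := ih (by omega)
      have h2 := hend k (by omega)
      rw [Finset.sum_range_succ, Finset.sum_range_succ, Finset.sum_range_succ]
      have w0 := hw k (by omega)
      have w1 := hw (k + 1) (by omega)
      have w2 := hw (k + 2) (by omega)
      have h3 : τ (k + 1) * τ k ≤ b k * b (k + 1) * w (k + 1) ^ 2 := by
        rw [hτb k (by omega), hτb (k + 1) hk]
        have h4 : √(w (k + 1) * w (k + 1 + 1)) * √(w k * w (k + 1)) ≤ w (k + 1) ^ 2 := by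
          rw [← Real.sqrt_mul (by positivity)]
          refine Real.sqrt_le_iff.2 ⟨by positivity, ?_⟩
          have := hlog k (by omega)
          have := mul_le_mul_of_nonneg_left this (sq_nonneg (w (k + 1)))
          calc w (k + 1) * w (k + 1 + 1) * (w k * w (k + 1))
              = w (k + 1) ^ 2 * (w k * w (k + 2)) := by ring
            _ ≤ _ := this
            _ = _ := by ring
        have := mul_le_mul_of_nonneg_left h4 (mul_nonneg (hb0 k) (hb0 (k + 1)))
        linarith
      have h5 : (τ (k + 1) - τ k) ^ 2 / w (k + 1) ^ 2 ≥
          b (k + 1) ^ 2 * (w (k + 1 + 1) / w (k + 1)) + τ k ^ 2 / w (k + 1) ^ 2 -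
            2 * (b k * b (k + 1)) := by
        have h6 : b (k + 1) ^ 2 * (w (k + 1 + 1) / w (k + 1)) = τ (k + 1) ^ 2 / w (k + 1) ^ 2 := by
          rw [hbsq (k + 1) hk]; field_simp
        rw [h6, ge_iff_le, ← add_div, sub_le_iff_le_add, div_le_iff₀ (by positivity), add_mul,
          div_mul_cancel₀ _ (by positivity)]
        nlinarith
      linarith
  have h1 := hstep n le_rfl
  have h2 := hend n le_rfl
  have h3 := path_dirichlet_bound n b
  have h4 : ∑ j ∈ Finset.range (n + 1), τ j ^ 2 / (w j * w (j + 1)) =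
      ∑ j ∈ Finset.range (n + 1), b j ^ 2 :=
    Finset.sum_congr rfl fun j hj => (hbsq j (by have := Finset.mem_range.1 hj; omega)).symm
  rw [h4]
  rw [Finset.sum_range_succ] at h3 ⊢
  linarith

/-- Weighted Poincaré inequality on a path with log-concave weights: the spectral gap is at least
that of the Neumann Laplacian. -/
theorem weighted_poincare {w : ℕ → ℝ} {n : ℕ} (hw : ∀ j ≤ n + 1, 0 < w j)
    (hlog : ∀ j < n, w j * w (j + 2) ≤ w (j + 1) ^ 2) {u : ℕ → ℂ}
    (hu : ∑ j ∈ Finset.range (n + 2), (w j ^ 2 : ℂ) * u j = 0) :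
    (2 - 2 * Real.cos (Real.pi / (n + 1 + 1))) *
        ∑ j ∈ Finset.range (n + 2), w j ^ 2 * ‖u j‖ ^ 2 ≤
      ∑ j ∈ Finset.range (n + 1), w j * w (j + 1) * ‖u j - u (j + 1)‖ ^ 2 := by
  -- Dual argument: the partial sums `T` of w²u live on the `n + 1` bonds and vanish at the right
  -- end, because u has weighted mean zero. Summation by parts pairs them with the increments of u,
  -- so Cauchy-Schwarz gives Q² ≤ A D. The dual bound for ‖T‖ gives γ A ≤ Q, since the increments of
  -- `T` are w²u. Together γ Q ≤ D. The Dirichlet energy on `n + 1` bonds is exactly the Neumann gap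
  -- on `n + 2` sites.
  set T : ℕ → ℂ := fun k => ∑ j ∈ Finset.range (k + 1), (w j ^ 2 : ℂ) * u j with hT
  have hTs : ∀ k, T (k + 1) = T k + (w (k + 1) ^ 2 : ℂ) * u (k + 1) := fun k =>
    Finset.sum_range_succ _ _
  have hT0 : T 0 = (w 0 ^ 2 : ℂ) * u 0 := by simp [hT]
  have hTn : T (n + 1) = 0 := hu
  have habel : ∀ k, ∑ j ∈ Finset.range (k + 1), w j ^ 2 * ‖u j‖ ^ 2 =
      ∑ j ∈ Finset.range k, ((starRingEnd ℂ) (T j) * (u j - u (j + 1))).re +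
        ((starRingEnd ℂ) (T k) * u k).re := by
    have hre : ∀ j, ((starRingEnd ℂ) ((w j ^ 2 : ℂ) * u j) * u j).re = w j ^ 2 * ‖u j‖ ^ 2 := by
      intro j
      rw [map_mul, mul_assoc, mul_comm _ (u j), Complex.mul_conj, Complex.normSq_eq_norm_sq,
        ← Complex.ofReal_pow, Complex.conj_ofReal, ← Complex.ofReal_mul, Complex.ofReal_re]
    intro k
    induction k with
    | zero => simp only [zero_add, Finset.range_one, Finset.sum_singleton, Finset.range_zero,
        Finset.sum_empty, hT0, hre]
    | succ k ih =>
      rw [Finset.sum_range_succ, ih, Finset.sum_range_succ, hTs, map_add, add_mul, Complex.add_re,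
        hre, mul_sub, Complex.sub_re]
      ring
  set Q := ∑ j ∈ Finset.range (n + 2), w j ^ 2 * ‖u j‖ ^ 2
  set D := ∑ j ∈ Finset.range (n + 1), w j * w (j + 1) * ‖u j - u (j + 1)‖ ^ 2
  set A := ∑ j ∈ Finset.range (n + 1), ‖T j‖ ^ 2 / (w j * w (j + 1))
  set γ := 2 - 2 * Real.cos (Real.pi / (n + 1 + 1))
  have hww : ∀ j ∈ Finset.range (n + 1), 0 < w j * w (j + 1) := fun j hj => by
    have := Finset.mem_range.1 hj
    exact mul_pos (hw j (by omega)) (hw _ (by omega))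
  have hQ0 : 0 ≤ Q := Finset.sum_nonneg fun j _ => by positivity
  have hD0 : 0 ≤ D := Finset.sum_nonneg fun j hj => mul_nonneg (hww j hj).le (sq_nonneg _)
  have hγ0 : 0 ≤ γ := by
    have := Real.cos_le_one (Real.pi / (n + 1 + 1)); simp only [γ]; linarith
  have h1 : Q ≤ ∑ j ∈ Finset.range (n + 1), ‖T j‖ * ‖u j - u (j + 1)‖ := by
    have h2 := habel (n + 1)
    rw [hTn, map_zero, zero_mul, Complex.zero_re, add_zero] at h2
    exact h2.le.trans (Finset.sum_le_sum fun j _ => re_conj_mul_le _ _)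
  have h2 : Q ^ 2 ≤ A * D := by
    calc Q ^ 2 ≤ (∑ j ∈ Finset.range (n + 1), ‖T j‖ * ‖u j - u (j + 1)‖) ^ 2 := by gcongr
      _ ≤ A * D := by
        refine Finset.sum_sq_le_sum_mul_sum_of_sq_le_mul _
          (fun j hj => div_nonneg (sq_nonneg _) (hww j hj).le)
          (fun j hj => mul_nonneg (hww j hj).le (sq_nonneg _)) fun j hj => ?_
        have := hww j hj
        rw [mul_pow]
        refine le_of_eq ?_
        generalize w j * w (j + 1) = c at this ⊢
        field_simp
  have h3 : γ * A ≤ Q := by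
    have h4 := weighted_dual_bound hw hlog (τ := fun j => ‖T j‖) fun j => norm_nonneg _
    refine h4.trans ?_
    have hnorm : ∀ j, ‖(w j ^ 2 : ℂ) * u j‖ ^ 2 = w j ^ 4 * ‖u j‖ ^ 2 := by
      intro j
      rw [norm_mul, norm_pow, Complex.norm_real, mul_pow, Real.norm_eq_abs, sq_abs]
      ring
    have hkey : ∀ j ≤ n + 1, ∀ x : ℝ, x ^ 2 ≤ ‖(w j ^ 2 : ℂ) * u j‖ ^ 2 →
        x ^ 2 / w j ^ 2 ≤ w j ^ 2 * ‖u j‖ ^ 2 := by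
      intro j hj x hx
      have := hw j hj
      rw [div_le_iff₀ (by positivity)]
      refine hx.trans (le_of_eq ?_)
      rw [hnorm]; ring
    simp only [Q]
    rw [Finset.sum_range_succ', Finset.sum_range_succ]
    have e1 : ‖T 0‖ ^ 2 / w 0 ^ 2 ≤ w 0 ^ 2 * ‖u 0‖ ^ 2 := hkey 0 (by omega) _ (by rw [hT0])
    have e2 : ‖T n‖ ^ 2 / w (n + 1) ^ 2 ≤ w (n + 1) ^ 2 * ‖u (n + 1)‖ ^ 2 := by
      refine hkey (n + 1) le_rfl _ ?_
      have : T n = -((w (n + 1) ^ 2 : ℂ) * u (n + 1)) := by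
        have := hTs n
        rw [hTn] at this
        exact eq_neg_of_add_eq_zero_left this.symm
      rw [this, norm_neg]
    have e3 : ∑ j ∈ Finset.range n, (‖T (j + 1)‖ - ‖T j‖) ^ 2 / w (j + 1) ^ 2 ≤
        ∑ j ∈ Finset.range n, w (j + 1) ^ 2 * ‖u (j + 1)‖ ^ 2 := by
      refine Finset.sum_le_sum fun j hj => hkey (j + 1) ?_ _ ?_
      · have := Finset.mem_range.1 hj; omega
      · rw [← sq_abs]
        gcongr
        have := abs_norm_sub_norm_le (T (j + 1)) (T j)
        have e : T (j + 1) - T j = (w (j + 1) ^ 2 : ℂ) * u (j + 1) := by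
          rw [hTs j, add_sub_cancel_left]
        rwa [e] at this
    linarith
  rcases hQ0.eq_or_lt with h | h
  · rw [← h, mul_zero]; exact hD0
  · have h5 : γ * Q ^ 2 ≤ Q * D := by
      calc γ * Q ^ 2 ≤ γ * (A * D) := by gcongr
        _ = γ * A * D := by ring
        _ ≤ Q * D := by gcongr
    nlinarith

end OneDimension

/-! ### From a path to its blocks -/

section Line

/-- Weighted Poincaré inequality on a block, as a bound on the distance to the ground state. -/
theorem block_poincare {r : ℕ} (hr : 1 ≤ r) {w : ℕ → ℝ} (hw : ∀ j < r, 0 < w j)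
    (hlog : ∀ j, j + 2 < r → w j * w (j + 2) ≤ w (j + 1) ^ 2) (f : ℕ → ℂ) :
    2 * gammaInfty r * ∑ j ∈ Finset.range r,
        ‖f j - ((w j / √(∑ y ∈ Finset.range r, w y ^ 2) : ℝ) : ℂ) * ∑ y ∈ Finset.range r,
          ((w y / √(∑ y ∈ Finset.range r, w y ^ 2) : ℝ) : ℂ) * f y‖ ^ 2 ≤
      ∑ j ∈ Finset.range (r - 1),
        w j * w (j + 1) * ‖f j / w j - f (j + 1) / w (j + 1)‖ ^ 2 := by
  set Z := ∑ y ∈ Finset.range r, w y ^ 2 with hZ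
  have hZ0 : 0 < Z := Finset.sum_pos (fun j hj => pow_pos (hw j (Finset.mem_range.1 hj)) 2)
    (Finset.nonempty_range_iff.2 (by omega))
  -- The weighted mean of `f / w`: projecting `f` onto the normalized `w` gives `w * m`, so the
  -- distance to the projection is a weighted variance of `f / w`.
  set m : ℂ := (∑ y ∈ Finset.range r, (w y : ℂ) * f y) / Z with hm
  have hterm : ∀ j, ((w j / √Z : ℝ) : ℂ) * ∑ y ∈ Finset.range r, ((w y / √Z : ℝ) : ℂ) * f y =
      w j * m := by
    intro j
    have h1 : ∀ y, ((w y / √Z : ℝ) : ℂ) * f y = ((√Z)⁻¹ : ℝ) * ((w y : ℂ) * f y) := by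
      intro y; push_cast; ring
    have h2 : ((√Z)⁻¹ : ℝ) * ((√Z)⁻¹ : ℝ) = (Z⁻¹ : ℝ) := by
      rw [← mul_inv, Real.mul_self_sqrt hZ0.le]
    simp only [h1]
    rw [← Finset.mul_sum, hm, div_eq_mul_inv, div_eq_mul_inv, ← Complex.ofReal_inv, ← h2]
    push_cast
    ring
  simp only [hterm]
  obtain rfl | ⟨n, rfl⟩ : r = 1 ∨ ∃ n, r = n + 2 := by
    rcases Nat.lt_or_ge r 2 with h | h
    · left; omega
    · right; exact ⟨r - 2, by omega⟩
  · have h0 := hw 0 (by omega)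
    have : f 0 - w 0 * m = 0 := by
      have hw0 : (w 0 : ℂ) ≠ 0 := by exact_mod_cast h0.ne'
      simp only [hm, hZ, Finset.range_one, Finset.sum_singleton]
      push_cast
      field_simp
      ring
    simp [this]
  · have key := weighted_poincare (w := w) (n := n) (u := fun j => f j / w j - m)
      (fun j hj => hw j (by omega)) (fun j hj => hlog j (by omega)) ?_
    · have hγ : 2 * gammaInfty (n + 2) = 2 - 2 * Real.cos (Real.pi / (n + 1 + 1)) := by
        rw [gammaInfty]; push_cast; rw [add_assoc, one_add_one_eq_two]; ring
      rw [hγ]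
      refine le_trans (le_of_eq ?_) (key.trans (le_of_eq ?_))
      · congr 1
        refine Finset.sum_congr rfl fun j hj => ?_
        have h0 := hw j (Finset.mem_range.1 hj)
        have hw0 : (w j : ℂ) ≠ 0 := by exact_mod_cast h0.ne'
        have : f j - w j * m = w j * (f j / w j - m) := by field_simp
        rw [this, norm_mul, Complex.norm_of_nonneg h0.le, mul_pow]
      · refine Finset.sum_congr rfl fun j hj => ?_
        rw [sub_sub_sub_cancel_right]
    · have h1 : ∀ j ∈ Finset.range (n + 2), (w j ^ 2 : ℂ) * (f j / w j - m) =
          w j * f j - (w j ^ 2 : ℂ) * m := by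
        intro j hj
        have hw0 : (w j : ℂ) ≠ 0 := by exact_mod_cast (hw j (Finset.mem_range.1 hj)).ne'
        field_simp
      have hZc : (Z : ℂ) ≠ 0 := by exact_mod_cast hZ0.ne'
      rw [Finset.sum_congr rfl h1, Finset.sum_sub_distrib, ← Finset.sum_mul]
      have h2 : ∑ j ∈ Finset.range (n + 2), (w j ^ 2 : ℂ) = Z := by rw [hZ]; push_cast; rfl
      rw [h2, hm, mul_div_cancel₀ _ hZc, sub_self]

theorem sum_range_mul_eq {α : Type*} [AddCommMonoid α] (M r : ℕ) (g : ℕ → α) :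
    ∑ j ∈ Finset.range (M * r), g j =
      ∑ b ∈ Finset.range M, ∑ y ∈ Finset.range r, g (b * r + y) := by
  induction M with
  | zero => simp
  | succ M ih => rw [Nat.succ_mul, Finset.sum_range_add, ih, Finset.sum_range_succ]

/-- The ground state of the Dirichlet Laplacian on a path of length `L`, normalized on each of the
blocks of length `r`. -/
noncomputable def blockState (L r : ℕ) (j : ℕ) : ℝ :=
  dirichletSine L (j + 1) /
    √(∑ y ∈ Finset.range r, dirichletSine L ((j / r * r + y : ℕ) + 1) ^ 2)

theorem blockState_eq {L r b y : ℕ} (hy : y < r) : blockState L r (b * r + y) =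
    dirichletSine L ((b * r + y : ℕ) + 1) /
      √(∑ y ∈ Finset.range r, dirichletSine L ((b * r + y : ℕ) + 1) ^ 2) := by
  have : (b * r + y) / r = b := by
    rw [mul_comm, Nat.mul_add_div (by omega), Nat.div_eq_of_lt hy, add_zero]
  rw [blockState, this]

theorem sum_dirichletSine_sq_pos {M r b : ℕ} (hr : 1 ≤ r) (hb : b < M) :
    0 < ∑ y ∈ Finset.range r, dirichletSine (M * r) ((b * r + y : ℕ) + 1) ^ 2 := by
  refine Finset.sum_pos (fun y hy => pow_pos (dirichletSine_pos (by positivity) ?_) 2)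
    (Finset.nonempty_range_iff.2 (by omega))
  have h1 := Finset.mem_range.1 hy
  have : b * r + y < M * r := by nlinarith
  have : ((b * r + y : ℕ) : ℝ) < (M * r : ℕ) := by exact_mod_cast this
  linarith

theorem sum_blockState_sq {M r b : ℕ} (hr : 1 ≤ r) (hb : b < M) :
    ∑ y ∈ Finset.range r, blockState (M * r) r (b * r + y) ^ 2 = 1 := by
  have h1 := sum_dirichletSine_sq_pos hr hb
  have h2 : ∀ y ∈ Finset.range r, blockState (M * r) r (b * r + y) ^ 2 =
      dirichletSine (M * r) ((b * r + y : ℕ) + 1) ^ 2 /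
        ∑ y ∈ Finset.range r, dirichletSine (M * r) ((b * r + y : ℕ) + 1) ^ 2 := by
    intro y hy
    rw [blockState_eq (Finset.mem_range.1 hy), div_pow, Real.sq_sqrt h1.le]
  rw [Finset.sum_congr rfl h2, ← Finset.sum_div, div_self h1.ne']

/-- The Dirichlet Laplacian on a path controls the distance to the ground state on each block, and
in addition its ground state energy. -/
theorem path_bound {M r : ℕ} (hr : 1 ≤ r) (hM : 1 ≤ M) (f : ℕ → ℂ) :
    (2 - 2 * Real.cos (Real.pi / ((M * r : ℕ) + 1))) * ∑ j ∈ Finset.range (M * r), ‖f j‖ ^ 2 +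
      2 * gammaInfty r * ∑ b ∈ Finset.range M, ∑ y ∈ Finset.range r,
        ‖f (b * r + y) - (blockState (M * r) r (b * r + y) : ℂ) * ∑ z ∈ Finset.range r,
          (blockState (M * r) r (b * r + z) : ℂ) * f (b * r + z)‖ ^ 2 ≤
    2 * ∑ j ∈ Finset.range (M * r), ‖f j‖ ^ 2 -
      2 * ∑ j ∈ Finset.range (M * r - 1), ((starRingEnd ℂ) (f j) * f (j + 1)).re := by
  obtain ⟨n, hn⟩ : ∃ n, M * r = n + 1 := ⟨M * r - 1, by have := Nat.mul_le_mul hM hr; omega⟩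
  have h1 := groundState_transform_sine n f
  set bond : ℕ → ℝ := fun j => dirichletSine (n + 1) (j + 1) * dirichletSine (n + 1) (j + 2) *
        ‖f j / dirichletSine (n + 1) (j + 1) - f (j + 1) / dirichletSine (n + 1) (j + 2)‖ ^ 2
    with hbond
  -- The sine vanishes just beyond the path. Adding this fictitious bond makes the number of bonds
  -- equal to `M * r`, so that they can be grouped by blocks.
  have hlast : bond n = 0 := by
    have h2 := dirichletSine_end (n + 1)
    push_cast at h2
    rw [add_assoc, one_add_one_eq_two] at h2
    simp [hbond, h2]
  have hnonneg : ∀ j < n + 1, 0 ≤ bond j := by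
    intro j hj
    rcases Nat.lt_succ_iff_lt_or_eq.1 hj with h | rfl
    · have hj' : (j : ℝ) + 1 ≤ n := by exact_mod_cast h
      have h1 : 0 < dirichletSine (n + 1) (j + 1) :=
        dirichletSine_pos (by positivity) (by push_cast; linarith)
      have h2 : 0 < dirichletSine (n + 1) (j + 2) :=
        dirichletSine_pos (by positivity) (by push_cast; linarith)
      simp only [hbond]; positivity
    · rw [hlast]
  have hblocks : ∑ b ∈ Finset.range M, (2 * gammaInfty r * ∑ y ∈ Finset.range r,
        ‖f (b * r + y) - (blockState (M * r) r (b * r + y) : ℂ) * ∑ z ∈ Finset.range r,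
          (blockState (M * r) r (b * r + z) : ℂ) * f (b * r + z)‖ ^ 2) ≤
      ∑ j ∈ Finset.range n, bond j := by
    have h3 : ∑ j ∈ Finset.range n, bond j = ∑ j ∈ Finset.range (M * r), bond j := by
      rw [hn, Finset.sum_range_succ, hlast, add_zero]
    rw [h3, sum_range_mul_eq]
    refine Finset.sum_le_sum fun b hb => ?_
    have hbM := Finset.mem_range.1 hb
    have hlt : ∀ y < r, b * r + y < n + 1 := fun y hy => by rw [← hn]; nlinarith
    have h4 := block_poincare hr (w := fun y => dirichletSine (n + 1) ((b * r + y : ℕ) + 1))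
      (fun y hy => by
        have h5 : ((b * r + y : ℕ) : ℝ) < (n + 1 : ℕ) := by exact_mod_cast hlt y hy
        exact dirichletSine_pos (by positivity) (by linarith))
      (fun y _ => by
        have := dirichletSine_logConcave (n + 1) ((b * r + y : ℕ) + 1)
        refine le_trans (le_of_eq ?_) (this.trans (le_of_eq ?_)) <;>
        · push_cast; ring_nf) (fun y => f (b * r + y))
    calc _ = 2 * gammaInfty r * ∑ j ∈ Finset.range r,
        ‖f (b * r + j) - ((dirichletSine (n + 1) ((b * r + j : ℕ) + 1) /
          √(∑ y ∈ Finset.range r, dirichletSine (n + 1) ((b * r + y : ℕ) + 1) ^ 2) : ℝ) : ℂ) *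
          ∑ z ∈ Finset.range r, ((dirichletSine (n + 1) ((b * r + z : ℕ) + 1) /
          √(∑ y ∈ Finset.range r, dirichletSine (n + 1) ((b * r + y : ℕ) + 1) ^ 2) : ℝ) : ℂ) *
            f (b * r + z)‖ ^ 2 := by
          congr 1
          refine Finset.sum_congr rfl fun y hy => ?_
          rw [blockState_eq (Finset.mem_range.1 hy), hn]
          congr 4
          refine Finset.sum_congr rfl fun z hz => ?_
          rw [blockState_eq (Finset.mem_range.1 hz)]
      _ ≤ _ := h4
      _ = ∑ y ∈ Finset.range (r - 1), bond (b * r + y) := by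
          refine Finset.sum_congr rfl fun y _ => ?_
          have e1 : (((b * r + (y + 1) : ℕ) : ℝ) + 1) = ((b * r + y : ℕ) : ℝ) + 2 := by
            push_cast; ring
          simp only [hbond, e1]
          rfl
      -- Here the bond leading from the block to the next one is discarded.
      _ ≤ ∑ y ∈ Finset.range r, bond (b * r + y) :=
          Finset.sum_le_sum_of_subset_of_nonneg (Finset.range_mono (by omega))
            fun y hy _ => hnonneg _ (hlt y (Finset.mem_range.1 hy))
  rw [← Finset.mul_sum] at hblocks
  rw [← h1] at hblocks
  rw [hn] at hblocks ⊢
  have h5 : (((n + 1 : ℕ) : ℝ) + 1) = (n : ℝ) + 1 + 1 := by push_cast; rfl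
  rw [h5, Nat.add_sub_cancel]
  linarith

/-- The block of length `r` in `r ℤ + [0, r)` that contains `x`. -/
noncomputable def intBlock (r : ℕ) (x : ℤ) : Finset ℤ := Finset.Ico (r * (x / r)) (r * (x / r) + r)

theorem mem_intBlock {r : ℕ} (hr : 1 ≤ r) {x y : ℤ} : y ∈ intBlock r x ↔ y / r = x / r := by
  have hr' : (0 : ℤ) < r := by exact_mod_cast hr
  rw [intBlock, Finset.mem_Ico]
  constructor
  · rintro ⟨h1, h2⟩
    refine le_antisymm ?_ ?_
    · exact Int.lt_add_one_iff.1 ((Int.ediv_lt_iff_lt_mul hr').2 (by linarith))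
    · exact (Int.le_ediv_iff_mul_le hr').2 (by linarith)
  · intro h
    have h1 := Int.mul_ediv_add_emod y r
    have h2 := Int.emod_nonneg y hr'.ne'
    have h3 := Int.emod_lt_of_pos y hr'
    rw [h] at h1
    constructor <;> linarith

theorem sum_Ico_int {α : Type*} [AddCommMonoid α] (a : ℤ) (L : ℕ) (g : ℤ → α) :
    ∑ x ∈ Finset.Ico a (a + L), g x = ∑ j ∈ Finset.range L, g (a + j) := by
  refine (Finset.sum_nbij' (fun j : ℕ => a + (j : ℤ)) (fun x => (x - a).toNat) ?_ ?_ ?_ ?_ ?_).symm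
  · intro j hj; simp only [Finset.mem_range, Finset.mem_Ico] at *; omega
  · intro x hx; simp only [Finset.mem_range, Finset.mem_Ico] at *; omega
  · intro j hj; simp
  · intro x hx; simp only [Finset.mem_Ico] at hx; omega
  · intro j hj; rfl

theorem sum_neighbours {L : ℕ} (a : ℤ) (h : ℤ → ℤ → ℝ) (hsymm : ∀ x y, h x y = h y x) :
    ∑ x ∈ Finset.Ico a (a + L), ∑ y ∈ Finset.Ico a (a + L), (if |y - x| = 1 then h x y else 0) =
      2 * ∑ j ∈ Finset.range (L - 1), h (a + j) (a + (j + 1 : ℕ)) := by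
  have hsplit : ∀ x y : ℤ, (if |y - x| = 1 then h x y else 0) =
      (if y = x + 1 then h x y else 0) + (if x = y + 1 then h y x else 0) := by
    intro x y
    rcases eq_or_ne y (x + 1) with rfl | h1
    · rw [if_pos (by simp), if_pos rfl, if_neg (by omega), add_zero]
    · rcases eq_or_ne x (y + 1) with rfl | h2
      · rw [if_pos (by simp), if_neg h1, if_pos rfl, zero_add, hsymm]
      · rw [if_neg h1, if_neg h2, if_neg (fun h3 => ?_), add_zero]
        rcases (abs_eq zero_le_one).1 h3 with h4 | h4 <;> omega
  have hone : ∑ x ∈ Finset.Ico a (a + L), ∑ y ∈ Finset.Ico a (a + L),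
      (if y = x + 1 then h x y else 0) =
      ∑ j ∈ Finset.range (L - 1), h (a + j) (a + (j + 1 : ℕ)) := by
    have h1 : ∀ x, ∑ y ∈ Finset.Ico a (a + L), (if y = x + 1 then h x y else 0) =
        if x + 1 ∈ Finset.Ico a (a + L) then h x (x + 1) else 0 := fun x =>
      Finset.sum_ite_eq' _ _ _
    simp only [h1]
    rw [sum_Ico_int]
    rcases L with _ | n
    · simp
    · rw [Finset.sum_range_succ, if_neg (by simp; omega), add_zero, Nat.add_sub_cancel]
      refine Finset.sum_congr rfl fun j hj => ?_
      have := Finset.mem_range.1 hj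
      rw [if_pos (by simp only [Finset.mem_Ico]; push_cast; omega)]
      push_cast
      rw [add_assoc]
  simp only [hsplit, Finset.sum_add_distrib]
  rw [hone, Finset.sum_comm (f := fun x y => if x = y + 1 then h y x else 0), hone]
  ring

/-- The Laplacian on a line, with either sign of the hopping term, controls the distance to a
suitable normalized state on each block. -/
theorem exists_line_bound {r L : ℕ} (hr : 1 ≤ r) (hL : 1 ≤ L) (hrL : r ∣ L) {a : ℤ}
    (ha : (r : ℤ) ∣ a) {σ : ℝ} {e : ℤ → ℝ} (he : ∀ x, e x ^ 2 = 1)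
    (heσ : ∀ x y, |y - x| = 1 → e x * e y = σ) :
    ∃ v : ℤ → ℝ, (∀ x ∈ Finset.Ico a (a + L), ∑ y ∈ intBlock r x, v y ^ 2 = 1) ∧
      ∀ f : ℤ → ℂ, (2 - 2 * Real.cos (Real.pi / (L + 1))) * ∑ x ∈ Finset.Ico a (a + L), ‖f x‖ ^ 2 +
        2 * gammaInfty r * ∑ x ∈ Finset.Ico a (a + L),
          ‖f x - (v x : ℂ) * ∑ y ∈ intBlock r x, (v y : ℂ) * f y‖ ^ 2 ≤
        2 * ∑ x ∈ Finset.Ico a (a + L), ‖f x‖ ^ 2 -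
          σ * ∑ x ∈ Finset.Ico a (a + L), ∑ y ∈ Finset.Ico a (a + L),
            (if |y - x| = 1 then ((starRingEnd ℂ) (f x) * f y).re else 0) := by
  obtain ⟨M, rfl⟩ := hrL
  rw [mul_comm r M] at *
  have hM : 1 ≤ M := by by_contra h; simp only [not_le, Nat.lt_one_iff] at h; simp [h] at hL
  obtain ⟨a', rfl⟩ := ha
  set a := (r : ℤ) * a'
  have hr' : (r : ℤ) ≠ 0 := by exact_mod_cast (by omega : r ≠ 0)
  -- Multiplication by the signs `e` turns the hopping sign `σ` into +1, so the path bound is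
  -- applied to `e * f` and the block states acquire the same signs.
  set v : ℤ → ℝ := fun x => e x * blockState (M * r) r (x - a).toNat with hv
  have hvj : ∀ j : ℕ, v (a + j) = e (a + j) * blockState (M * r) r j := by
    intro j; simp [hv]
  have hblock : ∀ b y : ℕ, y < r →
      intBlock r (a + (b * r + y : ℕ)) = Finset.Ico (a + (b * r : ℕ)) (a + (b * r : ℕ) + r) := by
    intro b y hy
    have : (a + (b * r + y : ℕ)) / (r : ℤ) = a' + b := by
      have h1 : a + (b * r + y : ℕ) = (y : ℤ) + r * (a' + b) := by simp only [a]; push_cast; ring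
      rw [h1, Int.add_mul_ediv_left _ _ hr', Int.ediv_eq_zero_of_lt (by positivity)
        (by exact_mod_cast hy), zero_add]
    rw [intBlock, this]
    have h2 : (r : ℤ) * (a' + b) = a + (b * r : ℕ) := by simp only [a]; push_cast; ring
    rw [h2]
  have hsumblock : ∀ {β : Type} [AddCommMonoid β] (b y : ℕ) (_ : y < r) (g : ℤ → β),
      ∑ x ∈ intBlock r (a + (b * r + y : ℕ)), g x =
        ∑ z ∈ Finset.range r, g (a + (b * r + z : ℕ)) := by
    intro β _ b y hy g
    rw [hblock b y hy, sum_Ico_int]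
    refine Finset.sum_congr rfl fun z _ => ?_
    push_cast; rw [add_assoc]
  refine ⟨v, fun x hx => ?_, fun f => ?_⟩
  · obtain ⟨j, hj, rfl⟩ : ∃ j : ℕ, j < M * r ∧ x = a + j := by
      rw [Finset.mem_Ico] at hx
      exact ⟨(x - a).toNat, by omega, by omega⟩
    have hjr := Nat.div_add_mod' j r
    have hmod := Nat.mod_lt j (by omega : r > 0)
    have hb : j / r < M := Nat.div_lt_of_lt_mul (by rwa [mul_comm])
    rw [← hjr, hsumblock _ _ hmod]
    rw [← sum_blockState_sq hr hb]
    refine Finset.sum_congr rfl fun z _ => ?_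
    rw [hvj, mul_pow, he, one_mul]
  · have key := path_bound hr hM fun j => (e (a + j) : ℂ) * f (a + j)
    have hnorm : ∀ x (z : ℂ), ‖(e x : ℂ) * z‖ ^ 2 = ‖z‖ ^ 2 := by
      intro x z
      rw [norm_mul, mul_pow, Complex.norm_real, Real.norm_eq_abs, sq_abs, he, one_mul]
    rw [sum_neighbours a (fun x y => ((starRingEnd ℂ) (f x) * f y).re) (fun x y => by
      simp only [Complex.mul_re, Complex.conj_re, Complex.conj_im]; ring)]
    simp only [sum_Ico_int]
    simp only [hnorm] at key
    have hhop : ∀ j : ℕ, ((starRingEnd ℂ) ((e (a + j) : ℂ) * f (a + j)) *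
        ((e (a + (j + 1 : ℕ)) : ℂ) * f (a + (j + 1 : ℕ)))).re =
        σ * ((starRingEnd ℂ) (f (a + j)) * f (a + (j + 1 : ℕ))).re := by
      intro j
      rw [← heσ (a + j) (a + (j + 1 : ℕ)) (by push_cast; simp), map_mul, Complex.conj_ofReal,
        mul_mul_mul_comm, ← Complex.ofReal_mul, Complex.re_ofReal_mul]
    simp only [hhop, ← Finset.mul_sum] at key
    have hproj : ∑ j ∈ Finset.range (M * r), ‖f (a + j) - (v (a + j) : ℂ) *
          ∑ y ∈ intBlock r (a + j), (v y : ℂ) * f y‖ ^ 2 =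
        ∑ b ∈ Finset.range M, ∑ y ∈ Finset.range r,
          ‖(e (a + (b * r + y : ℕ)) : ℂ) * f (a + (b * r + y : ℕ)) -
            (blockState (M * r) r (b * r + y) : ℂ) * ∑ z ∈ Finset.range r,
            (blockState (M * r) r (b * r + z) : ℂ) *
              ((e (a + (b * r + z : ℕ)) : ℂ) * f (a + (b * r + z : ℕ)))‖ ^ 2 := by
      rw [sum_range_mul_eq]
      refine Finset.sum_congr rfl fun b _ => Finset.sum_congr rfl fun y hy => ?_
      rw [hsumblock b y (Finset.mem_range.1 hy), ← hnorm (a + (b * r + y : ℕ)) (_ - _), mul_sub]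
      congr 3
      rw [hvj, ← mul_assoc, Complex.ofReal_mul, ← mul_assoc, ← Complex.ofReal_mul, ← sq, he,
        Complex.ofReal_one, one_mul]
      congr 1
      refine Finset.sum_congr rfl fun z _ => ?_
      rw [hvj]; push_cast; ring
    rw [hproj]
    push_cast at key ⊢
    linarith

end Line

/-! ### Products of coordinate projections -/

section Tensor

variable {d : ℕ}

/-- Averaging over one coordinate within classes of an equivalence relation. -/
theorem sum_sum_update {α : Type*} [AddCommMonoid α] {S : Fin d → Finset ℤ} (i : Fin d)
    {bl : ℤ → Finset ℤ} {N : ℕ} (hsub : ∀ x ∈ S i, bl x ⊆ S i)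
    (hsymm : ∀ x ∈ S i, ∀ y ∈ bl x, x ∈ bl y) (hcard : ∀ x ∈ S i, (bl x).card = N)
    (g : Site d → α) :
    ∑ n ∈ Fintype.piFinset S, ∑ y ∈ bl (n i), g (Function.update n i y) =
      N • ∑ n ∈ Fintype.piFinset S, g n := by
  have h1 : ∑ n ∈ Fintype.piFinset S, ∑ y ∈ bl (n i), g (Function.update n i y) =
      ∑ n ∈ Fintype.piFinset S, ∑ _y ∈ bl (n i), g n := by
    rw [Finset.sum_sigma', Finset.sum_sigma']
    have hmem : ∀ p : (_ : Site d) × ℤ, p ∈ (Fintype.piFinset S).sigma (fun n => bl (n i)) →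
        (⟨Function.update p.1 i p.2, p.1 i⟩ : (_ : Site d) × ℤ) ∈
          (Fintype.piFinset S).sigma (fun n => bl (n i)) := by
      rintro ⟨n, y⟩ h
      simp only [Finset.mem_sigma, Fintype.mem_piFinset, Function.update_self] at h ⊢
      refine ⟨fun j => ?_, hsymm _ (h.1 i) _ h.2⟩
      by_cases hj : j = i
      · subst hj; rw [Function.update_self]; exact hsub _ (h.1 _) h.2
      · rw [Function.update_of_ne hj]; exact h.1 j
    -- Exchanging `n i` and `y` is an involution of the index set.
    refine Finset.sum_nbij' (fun p => ⟨Function.update p.1 i p.2, p.1 i⟩)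
      (fun p => ⟨Function.update p.1 i p.2, p.1 i⟩) hmem hmem ?_ ?_ ?_
    · rintro ⟨n, y⟩ _; simp
    · rintro ⟨n, y⟩ _; simp
    · rintro ⟨n, y⟩ _; rfl
  rw [h1, Finset.smul_sum]
  refine Finset.sum_congr rfl fun n hn => ?_
  rw [Finset.sum_const, hcard _ (Fintype.mem_piFinset.1 hn i)]

/-- A rank one projection on each block, applied in the `i`-th coordinate. -/
noncomputable def coordProj (r : ℕ) (v : ℤ → ℝ) (i : Fin d) (ψ : Site d → ℂ) (n : Site d) : ℂ :=
  (v (n i) : ℂ) * ∑ y ∈ intBlock r (n i), (v y : ℂ) * ψ (Function.update n i y)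

/-- With P the projection onto `v`, the vectors f - Pf and P(f - g) are orthogonal and sum to f -
Pg; moreover P is a contraction. -/
theorem sum_norm_sub_proj_le {B : Finset ℤ} {v : ℤ → ℝ} (hv : ∑ y ∈ B, v y ^ 2 = 1)
    (f g : ℤ → ℂ) : ∑ x ∈ B, ‖f x - (v x : ℂ) * ∑ y ∈ B, (v y : ℂ) * g y‖ ^ 2 ≤
      ∑ x ∈ B, ‖f x - (v x : ℂ) * ∑ y ∈ B, (v y : ℂ) * f y‖ ^ 2 + ∑ x ∈ B, ‖f x - g x‖ ^ 2 := by
  have expand : ∀ c : ℂ, ∑ x ∈ B, ‖f x - (v x : ℂ) * c‖ ^ 2 = ∑ x ∈ B, ‖f x‖ ^ 2 + ‖c‖ ^ 2 -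
      2 * ((starRingEnd ℂ) (∑ y ∈ B, (v y : ℂ) * f y) * c).re := by
    intro c
    have h1 : ∀ x, ‖f x - (v x : ℂ) * c‖ ^ 2 = ‖f x‖ ^ 2 + v x ^ 2 * ‖c‖ ^ 2 -
        2 * ((starRingEnd ℂ) ((v x : ℂ) * f x) * c).re := by
      intro x
      rw [norm_sq_sub, norm_mul, mul_pow, Complex.norm_real, Real.norm_eq_abs, sq_abs, map_mul,
        Complex.conj_ofReal]
      congr 3; ring
    simp only [h1, Finset.sum_sub_distrib, Finset.sum_add_distrib, ← Finset.sum_mul, hv, one_mul,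
      ← Finset.mul_sum, ← Complex.re_sum, ← map_sum]
  set F := ∑ y ∈ B, (v y : ℂ) * f y
  set G := ∑ y ∈ B, (v y : ℂ) * g y
  have hFG : ‖F - G‖ ^ 2 ≤ ∑ x ∈ B, ‖f x - g x‖ ^ 2 := by
    have h1 : F - G = ∑ y ∈ B, (v y : ℂ) * (f y - g y) := by
      simp only [F, G, mul_sub, Finset.sum_sub_distrib]
    calc ‖F - G‖ ^ 2 ≤ (∑ y ∈ B, |v y| * ‖f y - g y‖) ^ 2 := by
          rw [h1]; gcongr
          refine (norm_sum_le _ _).trans (le_of_eq (Finset.sum_congr rfl fun y _ => ?_))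
          rw [norm_mul, Complex.norm_real, Real.norm_eq_abs]
      _ ≤ (∑ y ∈ B, |v y| ^ 2) * ∑ y ∈ B, ‖f y - g y‖ ^ 2 := Finset.sum_mul_sq_le_sq_mul_sq _ _ _
      _ = _ := by simp only [sq_abs, hv, one_mul]
  have hFF : ((starRingEnd ℂ) F * F).re = ‖F‖ ^ 2 := by
    rw [mul_comm, Complex.mul_conj, Complex.normSq_eq_norm_sq, Complex.ofReal_re]
  rw [expand, expand, hFF]
  rw [norm_sq_sub] at hFG
  linarith

variable {S : Fin d → Finset ℤ} {r : ℕ}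

theorem card_intBlock (r : ℕ) (x : ℤ) : (intBlock r x).card = r := by
  simp [intBlock]

/-- Averaging over block segments in direction `i` counts every site `r` times and reduces the claim
to a single segment. -/
theorem sum_norm_sub_coordProj_le (hr : 1 ≤ r) (i : Fin d) (hS : ∀ x ∈ S i, intBlock r x ⊆ S i)
    {v : ℤ → ℝ} (hv : ∀ x ∈ S i, ∑ y ∈ intBlock r x, v y ^ 2 = 1) (ψ φ : Site d → ℂ) :
    ∑ n ∈ Fintype.piFinset S, ‖ψ n - coordProj r v i φ n‖ ^ 2 ≤
      ∑ n ∈ Fintype.piFinset S, ‖ψ n - coordProj r v i ψ n‖ ^ 2 +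
        ∑ n ∈ Fintype.piFinset S, ‖ψ n - φ n‖ ^ 2 := by
  have hr' : (0 : ℝ) < r := by exact_mod_cast hr
  have hbl : ∀ x y, y ∈ intBlock r x → intBlock r y = intBlock r x := by
    intro x y hy
    rw [intBlock, (mem_intBlock hr).1 hy, intBlock]
  have havg := fun g : Site d → ℝ => sum_sum_update i hS
    (fun x _ y hy => by rw [hbl x y hy]; exact (mem_intBlock hr).2 rfl)
    (fun x _ => card_intBlock r x) g
  rw [← mul_le_mul_iff_right₀ hr', mul_add, ← nsmul_eq_mul, ← nsmul_eq_mul, ← nsmul_eq_mul, ← havg,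
    ← havg, ← havg, ← Finset.sum_add_distrib]
  refine Finset.sum_le_sum fun n hn => ?_
  have hni := Fintype.mem_piFinset.1 hn i
  have hproj : ∀ (φ : Site d → ℂ), ∀ y ∈ intBlock r (n i),
      coordProj r v i φ (Function.update n i y) =
        (v y : ℂ) * ∑ z ∈ intBlock r (n i), (v z : ℂ) * φ (Function.update n i z) := by
    intro φ y hy
    simp only [coordProj, Function.update_self, Function.update_idem, hbl _ _ hy]
  refine le_trans (le_of_eq ?_) ((sum_norm_sub_proj_le (hv _ hni)
    (fun y => ψ (Function.update n i y)) (fun y => φ (Function.update n i y))).trans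
    (le_of_eq ?_))
  · exact Finset.sum_congr rfl fun y hy => by rw [hproj φ y hy]
  · congr 1
    exact Finset.sum_congr rfl fun y hy => by rw [hproj ψ y hy]

/-- The product of the coordinate projections for the directions in a list. -/
noncomputable def listProj (r : ℕ) (v : Fin d → ℤ → ℝ) (l : List (Fin d)) (ψ : Site d → ℂ) :
    Site d → ℂ :=
  l.foldr (fun i φ => coordProj r (v i) i φ) ψ

/-- By the one-step inequality each further projection adds only its own defect on `ψ`, so the
defects accumulate linearly in squared norm. -/
theorem sum_norm_sub_listProj_le (hr : 1 ≤ r) (hS : ∀ i, ∀ x ∈ S i, intBlock r x ⊆ S i)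
    {v : Fin d → ℤ → ℝ} (hv : ∀ i, ∀ x ∈ S i, ∑ y ∈ intBlock r x, v i y ^ 2 = 1)
    (ψ : Site d → ℂ) (l : List (Fin d)) :
    ∑ n ∈ Fintype.piFinset S, ‖ψ n - listProj r v l ψ n‖ ^ 2 ≤
      (l.map fun i => ∑ n ∈ Fintype.piFinset S, ‖ψ n - coordProj r (v i) i ψ n‖ ^ 2).sum := by
  induction l with
  | nil => simp [listProj]
  | cons i l ih =>
    rw [List.map_cons, List.sum_cons]
    exact (sum_norm_sub_coordProj_le hr i (hS i) (hv i) ψ (listProj r v l ψ)).trans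
      (by gcongr)

/-- Each projection replaces the dependence on one coordinate within a block by the factor `v i`.
For the induction, the remaining coefficient `C` is constant on blocks only in the directions
already treated. -/
theorem exists_listProj_eq (v : Fin d → ℤ → ℝ) (ψ : Site d → ℂ) (l : List (Fin d))
    (hl : l.Nodup) : ∃ C : Site d → ℂ,
      (∀ n, listProj r v l ψ n = (l.map fun i => (v i (n i) : ℂ)).prod * C n) ∧
      ∀ n n', (∀ i ∈ l, intBlock r (n' i) = intBlock r (n i)) → (∀ i, i ∉ l → n' i = n i) →
        C n' = C n := by
  induction l with
  | nil =>
    refine ⟨ψ, fun n => by simp [listProj], fun n n' _ h => ?_⟩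
    rw [funext fun i => h i (by simp)]
  | cons i l ih =>
    obtain ⟨C, hC, hinv⟩ := ih hl.of_cons
    have hil : i ∉ l := (List.nodup_cons.1 hl).1
    refine ⟨fun n => ∑ y ∈ intBlock r (n i), (v i y : ℂ) * C (Function.update n i y),
      fun n => ?_, fun n n' h1 h2 => ?_⟩
    · have h3 : listProj r v (i :: l) ψ n = coordProj r (v i) i (listProj r v l ψ) n := rfl
      rw [h3, coordProj, List.map_cons, List.prod_cons, mul_assoc]
      congr 1
      rw [Finset.mul_sum]
      refine Finset.sum_congr rfl fun y _ => ?_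
      rw [hC]
      have h4 : (l.map fun j => (v j (Function.update n i y j) : ℂ)) =
          l.map fun j => (v j (n j) : ℂ) := by
        refine List.map_congr_left fun j hj => ?_
        rw [Function.update_of_ne (by rintro rfl; exact hil hj)]
      rw [h4]; ring
    · simp only
      rw [h1 i (by simp)]
      refine Finset.sum_congr rfl fun y _ => ?_
      congr 1
      refine hinv _ _ (fun j hj => ?_) fun j hj => ?_
      · have hji : j ≠ i := by rintro rfl; exact hil hj
        rw [Function.update_of_ne hji, Function.update_of_ne hji]
        exact h1 j (List.mem_cons_of_mem _ hj)
      · by_cases hji : j = i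
        · subst hji; simp
        · rw [Function.update_of_ne hji, Function.update_of_ne hji]
          exact h2 j (by simp [hji, hj])

/-- The projections in the coordinate directions control, on each block, the distance to the
product state. -/
theorem sum_norm_sub_product_le (hr : 1 ≤ r) (hS : ∀ i, ∀ x ∈ S i, intBlock r x ⊆ S i)
    {v : Fin d → ℤ → ℝ} (hv : ∀ i, ∀ x ∈ S i, ∑ y ∈ intBlock r x, v i y ^ 2 = 1)
    (ψ : Site d → ℂ) : ∃ C : Site d → ℂ,
      (∀ n n', (∀ i, intBlock r (n' i) = intBlock r (n i)) → C n' = C n) ∧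
      ∑ n ∈ Fintype.piFinset S, ‖ψ n - ((∏ i, v i (n i) : ℝ) : ℂ) * C n‖ ^ 2 ≤
        ∑ i, ∑ n ∈ Fintype.piFinset S, ‖ψ n - coordProj r (v i) i ψ n‖ ^ 2 := by
  obtain ⟨C, hC, hinv⟩ := exists_listProj_eq (r := r) v ψ (List.finRange d) (List.nodup_finRange d)
  refine ⟨C, fun n n' h => hinv n n' (fun i _ => h i) fun i hi => absurd (List.mem_finRange i) hi,
    ?_⟩
  have h1 := sum_norm_sub_listProj_le hr hS hv ψ (List.finRange d)
  rw [← Fin.sum_univ_def] at h1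
  refine le_trans (le_of_eq (Finset.sum_congr rfl fun n _ => ?_)) h1
  rw [hC, ← Fin.prod_univ_def, Complex.ofReal_prod]

end Tensor

/-! ### Blocks of a cube and the lower bound for the Laplacian -/

section Lattice

variable {d : ℕ}

theorem sum_abs_update_sub (n : Site d) (i : Fin d) (y : ℤ) :
    ∑ j, |Function.update n i y j - n j| = |y - n i| := by
  rw [Finset.sum_eq_single i (fun j _ hj => by rw [Function.update_of_ne hj]; simp) (by simp),
    Function.update_self]

theorem exists_eq_update_of_sum_abs_eq_one {n k : Site d} (h : ∑ i, |k i - n i| = 1) :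
    ∃ i, |k i - n i| = 1 ∧ Function.update n i (k i) = k := by
  obtain ⟨i, hi⟩ : ∃ i, |k i - n i| ≠ 0 := by
    by_contra! h0
    simp [h0] at h
  have hsum := Finset.add_sum_erase Finset.univ (fun i => |k i - n i|) (Finset.mem_univ i)
  rw [h] at hsum
  have hpos : 0 < |k i - n i| := lt_of_le_of_ne (abs_nonneg _) (Ne.symm hi)
  have hnn : 0 ≤ ∑ j ∈ Finset.univ.erase i, |k j - n j| :=
    Finset.sum_nonneg fun j _ => abs_nonneg _
  have h1 : |k i - n i| = 1 := by omega
  have h2 : ∑ j ∈ Finset.univ.erase i, |k j - n j| = 0 := by omega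
  rw [Finset.sum_eq_zero_iff_of_nonneg fun j _ => abs_nonneg _] at h2
  refine ⟨i, h1, funext fun j => ?_⟩
  by_cases hj : j = i
  · subst hj; simp
  · rw [Function.update_of_ne hj]
    have := h2 j (by simp [hj])
    rw [abs_eq_zero] at this
    omega

/-- The neighbours of a site are reached by moving along one coordinate. -/
theorem sum_site_neighbours {α : Type*} [AddCommMonoid α] {S : Fin d → Finset ℤ} {n : Site d}
    (hn : n ∈ Fintype.piFinset S) (h : Site d → α) :
    ∑ k ∈ Fintype.piFinset S, (if ∑ i, |k i - n i| = 1 then h k else 0) =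
      ∑ i, ∑ y ∈ S i, if |y - n i| = 1 then h (Function.update n i y) else 0 := by
  simp only [← Finset.sum_filter]
  rw [Finset.sum_sigma']
  symm
  refine Finset.sum_bij (fun p _ => Function.update n p.1 p.2) ?_ ?_ ?_ ?_
  · rintro ⟨i, y⟩ hp
    simp only [Finset.mem_sigma, Finset.mem_univ, true_and, Finset.mem_filter] at hp
    refine Finset.mem_filter.2 ⟨Fintype.mem_piFinset.2 fun j => ?_, ?_⟩
    · by_cases hj : j = i
      · subst hj; rw [Function.update_self]; exact hp.1
      · rw [Function.update_of_ne hj]; exact Fintype.mem_piFinset.1 hn j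
    · rw [sum_abs_update_sub]; exact hp.2
  · rintro ⟨i, y⟩ hp ⟨i', y'⟩ hp' heq
    simp only [Finset.mem_sigma, Finset.mem_univ, true_and, Finset.mem_filter] at hp hp' heq
    have hii : i = i' := by
      by_contra hne
      have h1 := congr_fun heq i
      rw [Function.update_self, Function.update_of_ne hne] at h1
      rw [h1] at hp
      simp at hp
    subst hii
    have h1 := congr_fun heq i
    rw [Function.update_self, Function.update_self] at h1
    rw [h1]
  · intro k hk
    rw [Finset.mem_filter] at hk
    obtain ⟨i, h1, h2⟩ := exists_eq_update_of_sum_abs_eq_one hk.2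
    exact ⟨⟨i, k i⟩, by simp [h1, Fintype.mem_piFinset.1 hk.1 i], h2⟩
  · rintro ⟨i, y⟩ _; rfl

/-- The vertex of the block containing a site. -/
def blockVertex (r : ℕ) (n : Site d) : BlockSite d r :=
  ⟨fun i => r * (n i / r), fun _ => dvd_mul_right _ _⟩

variable {r L : ℕ} {c : Site d}

theorem mem_cube {s : ℕ} {n k : Site d} : n ∈ cube s k ↔ ∀ i, k i ≤ n i ∧ n i < k i + s := by
  simp [cube, Fintype.mem_piFinset]

theorem mem_boxIndex {k : BlockSite d r} : k ∈ boxIndex r L c ↔ k.1 ∈ cube L c := by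
  simp [boxIndex]

theorem blockVertex_eq_iff (hr : 1 ≤ r) {n : Site d} {k : BlockSite d r} :
    blockVertex r n = k ↔ n ∈ cube r k.1 := by
  have hr' : (0 : ℤ) < r := by exact_mod_cast hr
  rw [mem_cube, Subtype.ext_iff, funext_iff]
  refine forall_congr' fun i => ?_
  obtain ⟨q, hq⟩ := k.2 i
  have hdiv : n i / (r : ℤ) = q ↔ q ≤ n i / (r : ℤ) ∧ n i / (r : ℤ) < q + 1 := by omega
  rw [Int.le_ediv_iff_mul_le hr', Int.ediv_lt_iff_lt_mul hr'] at hdiv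
  simp only [blockVertex, hq]
  rw [mul_right_inj' hr'.ne', hdiv]
  constructor <;> rintro ⟨h1, h2⟩ <;> constructor <;> linarith

theorem mem_cube_of_mem_block (hr : 1 ≤ r) (hrL : r ∣ L) (hc : ∀ i, (r : ℤ) ∣ c i)
    {k : BlockSite d r} (hk : k ∈ boxIndex r L c) {n : Site d} (hn : n ∈ cube r k.1) :
    n ∈ cube L c := by
  have hr' : (0 : ℤ) < r := by exact_mod_cast hr
  rw [mem_boxIndex, mem_cube] at hk
  rw [mem_cube] at hn ⊢
  intro i
  obtain ⟨q, hq⟩ := k.2 i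
  obtain ⟨a, ha⟩ := hc i
  obtain ⟨M, rfl⟩ := hrL
  have h1 := hk i
  have h2 := hn i
  refine ⟨h1.1.trans h2.1, h2.2.trans_le ?_⟩
  rw [hq, ha] at h1 ⊢
  push_cast at h1 ⊢
  have h3 : q < a + M := by
    have := h1.2
    rw [← mul_add] at this
    exact lt_of_mul_lt_mul_left this hr'.le
  have h4 : (r : ℤ) * (q + 1) ≤ r * (a + M) := mul_le_mul_of_nonneg_left (by omega) hr'.le
  linarith

theorem blockVertex_mem_boxIndex (hr : 1 ≤ r) (hc : ∀ i, (r : ℤ) ∣ c i)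
    {n : Site d} (hn : n ∈ cube L c) : blockVertex r n ∈ boxIndex r L c := by
  have hr' : (0 : ℤ) < r := by exact_mod_cast hr
  rw [mem_boxIndex, mem_cube]
  rw [mem_cube] at hn
  intro i
  obtain ⟨a, ha⟩ := hc i
  have h1 := hn i
  have h2 := Int.mul_ediv_add_emod (n i) r
  have h3 := Int.emod_nonneg (n i) hr'.ne'
  rw [ha] at h1 ⊢
  simp only [blockVertex]
  refine ⟨mul_le_mul_of_nonneg_left ?_ hr'.le, by linarith⟩
  rw [Int.le_ediv_iff_mul_le hr']
  linarith

/-- A cube is the disjoint union of its blocks. -/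
theorem sum_cube_eq_sum_blocks {α : Type*} [AddCommMonoid α] (hr : 1 ≤ r) (hrL : r ∣ L)
    (hc : ∀ i, (r : ℤ) ∣ c i) (g : Site d → α) :
    ∑ n ∈ cube L c, g n = ∑ k ∈ boxIndex r L c, ∑ n ∈ cube r k.1, g n := by
  rw [← Finset.sum_fiberwise_of_maps_to (g := blockVertex r) (t := boxIndex r L c)
    fun n hn => blockVertex_mem_boxIndex hr hc hn]
  refine Finset.sum_congr rfl fun k hk => Finset.sum_congr ?_ fun _ _ => rfl
  ext n
  rw [Finset.mem_filter, blockVertex_eq_iff hr]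
  exact ⟨fun h => h.2, fun h => ⟨mem_cube_of_mem_block hr hrL hc hk h, h⟩⟩

/-- The two sides differ by ‖⟨v, f⟩ - c‖². The coefficient delivered by the product of projections
may thus be replaced by the optimal one. -/
theorem sum_norm_sq_sub_le {α : Type*} {B : Finset α} {v : α → ℝ} (hv : ∑ y ∈ B, v y ^ 2 = 1)
    (f : α → ℂ) (c : ℂ) : ∑ x ∈ B, ‖f x‖ ^ 2 - ‖∑ y ∈ B, (v y : ℂ) * f y‖ ^ 2 ≤
      ∑ x ∈ B, ‖f x - (v x : ℂ) * c‖ ^ 2 := by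
  have h1 : ∀ x, ‖f x - (v x : ℂ) * c‖ ^ 2 = ‖f x‖ ^ 2 + v x ^ 2 * ‖c‖ ^ 2 -
      2 * ((starRingEnd ℂ) ((v x : ℂ) * f x) * c).re := by
    intro x
    rw [norm_sq_sub, norm_mul, mul_pow, Complex.norm_real, Real.norm_eq_abs, sq_abs, map_mul,
      Complex.conj_ofReal]
    congr 3; ring
  simp only [h1, Finset.sum_sub_distrib, Finset.sum_add_distrib, ← Finset.sum_mul, hv, one_mul,
    ← Finset.mul_sum, ← Complex.re_sum, ← map_sum]
  have h2 := norm_sq_sub (∑ y ∈ B, (v y : ℂ) * f y) c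
  have h3 := sq_nonneg ‖∑ y ∈ B, (v y : ℂ) * f y - c‖
  linarith

theorem gammaInfty_nonneg (r : ℕ) : 0 ≤ gammaInfty r := by
  rw [gammaInfty]; linarith [Real.cos_le_one (Real.pi / r)]

/-- The one-dimensional bound, summed over the lines in one coordinate direction. -/
theorem exists_direction_bound (hr : 1 ≤ r) (hL : 1 ≤ L) (hrL : r ∣ L)
    (hc : ∀ i, (r : ℤ) ∣ c i) {σ : ℝ} {e : ℤ → ℝ} (he : ∀ x, e x ^ 2 = 1)
    (heσ : ∀ x y, |y - x| = 1 → e x * e y = σ) (i : Fin d) :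
    ∃ v : ℤ → ℝ, (∀ x ∈ Finset.Ico (c i) (c i + L), ∑ y ∈ intBlock r x, v y ^ 2 = 1) ∧
      ∀ ψ : Site d → ℂ, (2 - 2 * Real.cos (Real.pi / (L + 1))) * ∑ n ∈ cube L c, ‖ψ n‖ ^ 2 +
        2 * gammaInfty r * ∑ n ∈ cube L c, ‖ψ n - coordProj r v i ψ n‖ ^ 2 ≤
        2 * ∑ n ∈ cube L c, ‖ψ n‖ ^ 2 -
          σ * ∑ n ∈ cube L c, ∑ y ∈ Finset.Ico (c i) (c i + L),
            (if |y - n i| = 1 then ((starRingEnd ℂ) (ψ n) * ψ (Function.update n i y)).re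
              else 0) := by
  obtain ⟨v, hv, hline⟩ := exists_line_bound hr hL hrL (hc i) he heσ
  refine ⟨v, hv, fun ψ => ?_⟩
  have hL' : (0 : ℝ) < L := by exact_mod_cast hL
  -- Summing the line bound over all sites of the cube counts each line `L` times; the factor is
  -- divided out at the end.
  have havg := fun g : Site d → ℝ => sum_sum_update (S := fun i => Finset.Ico (c i) (c i + L)) i
    (bl := fun _ => Finset.Ico (c i) (c i + L)) (N := L) (fun x _ => subset_rfl)
    (fun x hx y _ => hx) (fun x _ => by simp) g
  have h1 := Finset.sum_le_sum fun n (_ : n ∈ cube L c) =>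
    hline fun x => ψ (Function.update n i x)
  simp only [Finset.sum_add_distrib, Finset.sum_sub_distrib, ← Finset.mul_sum] at h1
  have e1 := havg fun n => ‖ψ n‖ ^ 2
  have e2 := havg fun n => ‖ψ n - coordProj r v i ψ n‖ ^ 2
  have e3 := havg fun n => ∑ y ∈ Finset.Ico (c i) (c i + L),
    (if |y - n i| = 1 then ((starRingEnd ℂ) (ψ n) * ψ (Function.update n i y)).re else 0)
  simp only [coordProj, Function.update_self, Function.update_idem, nsmul_eq_mul] at e1 e2 e3
  rw [← mul_le_mul_iff_right₀ hL']
  simp only [cube, coordProj] at h1 ⊢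
  rw [e1, e2, e3] at h1
  linarith

/-- Adding the `d` directional bounds assembles all lattice bonds and gives `d` times the ground
state energy. The defects of the coordinate projections together dominate the distance to the
product states on the blocks. -/
theorem exists_cube_bound (hr : 1 ≤ r) (hL : 1 ≤ L) (hrL : r ∣ L)
    (hc : ∀ i, (r : ℤ) ∣ c i) {σ : ℝ} {e : ℤ → ℝ} (he : ∀ x, e x ^ 2 = 1)
    (heσ : ∀ x y, |y - x| = 1 → e x * e y = σ) :
    ∃ φ : Site d → ℝ, (∀ k ∈ boxIndex r L c, ∑ n ∈ cube r k.1, φ n ^ 2 = 1) ∧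
      ∀ ψ : Site d → ℂ,
        d * (2 - 2 * Real.cos (Real.pi / (L + 1))) * ∑ n ∈ cube L c, ‖ψ n‖ ^ 2 +
        2 * gammaInfty r * ∑ k ∈ boxIndex r L c, (∑ n ∈ cube r k.1, ‖ψ n‖ ^ 2 -
          ‖∑ n ∈ cube r k.1, (φ n : ℂ) * ψ n‖ ^ 2) ≤
        2 * d * ∑ n ∈ cube L c, ‖ψ n‖ ^ 2 -
          σ * ∑ n ∈ cube L c, ∑ k ∈ cube L c,
            (if ∑ i, |k i - n i| = 1 then ((starRingEnd ℂ) (ψ n) * ψ k).re else 0) := by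
  choose v hv hbound using exists_direction_bound (c := c) hr hL hrL hc he heσ
  have hr' : (0 : ℤ) < r := by exact_mod_cast hr
  have hφ : ∀ k ∈ boxIndex r L c, ∑ n ∈ cube r k.1, (∏ i, v i (n i)) ^ 2 = 1 := by
    intro k hk
    simp only [← Finset.prod_pow]
    rw [cube, ← Finset.prod_univ_sum (fun i => Finset.Ico (k.1 i) (k.1 i + r))
      (fun i x => v i x ^ 2)]
    refine Finset.prod_eq_one fun i _ => ?_
    rw [mem_boxIndex, cube, Fintype.mem_piFinset] at hk
    have h1 := hv i (k.1 i) (hk i)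
    rwa [intBlock, Int.mul_ediv_cancel' (k.2 i)] at h1
  have hS : ∀ i, ∀ x ∈ Finset.Ico (c i) (c i + L), intBlock r x ⊆ Finset.Ico (c i) (c i + L) := by
    intro i x hx y hy
    obtain ⟨a, ha⟩ := hc i
    obtain ⟨M, rfl⟩ := hrL
    rw [mem_intBlock hr] at hy
    rw [Finset.mem_Ico, ha] at hx ⊢
    push_cast at hx ⊢
    have h1 : a ≤ x / r := (Int.le_ediv_iff_mul_le hr').2 (by linarith)
    have h2 : x / r < a + M := (Int.ediv_lt_iff_lt_mul hr').2 (by linarith)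
    rw [← hy] at h1 h2
    rw [Int.le_ediv_iff_mul_le hr'] at h1
    rw [Int.ediv_lt_iff_lt_mul hr'] at h2
    constructor <;> linarith
  refine ⟨fun n => ∏ i, v i (n i), hφ, fun ψ => ?_⟩
  have hsum := Finset.sum_le_sum fun i (_ : i ∈ Finset.univ) => hbound i ψ
  simp only [Finset.sum_add_distrib, Finset.sum_sub_distrib, Finset.sum_const, Finset.card_univ,
    Fintype.card_fin, nsmul_eq_mul, ← Finset.mul_sum] at hsum
  have hneigh : ∑ n ∈ cube L c, ∑ k ∈ cube L c,
      (if ∑ i, |k i - n i| = 1 then ((starRingEnd ℂ) (ψ n) * ψ k).re else 0) =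
      ∑ i, ∑ n ∈ cube L c, ∑ y ∈ Finset.Ico (c i) (c i + L),
        (if |y - n i| = 1 then ((starRingEnd ℂ) (ψ n) * ψ (Function.update n i y)).re else 0) := by
    rw [Finset.sum_comm (s := Finset.univ)]
    refine Finset.sum_congr rfl fun n hn => ?_
    exact sum_site_neighbours (S := fun i => Finset.Ico (c i) (c i + L)) hn
      fun k => ((starRingEnd ℂ) (ψ n) * ψ k).re
  rw [hneigh]
  obtain ⟨C, hC, hCle⟩ := sum_norm_sub_product_le hr hS hv ψ
  have hblocks : ∑ k ∈ boxIndex r L c, (∑ n ∈ cube r k.1, ‖ψ n‖ ^ 2 -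
      ‖∑ n ∈ cube r k.1, ((∏ i, v i (n i) : ℝ) : ℂ) * ψ n‖ ^ 2) ≤
      ∑ i, ∑ n ∈ cube L c, ‖ψ n - coordProj r (v i) i ψ n‖ ^ 2 := by
    refine le_trans ?_ hCle
    rw [← cube]
    rw [sum_cube_eq_sum_blocks hr hrL hc]
    refine Finset.sum_le_sum fun k hk => ?_
    refine (sum_norm_sq_sub_le (hφ k hk) ψ (C k.1)).trans (le_of_eq ?_)
    refine Finset.sum_congr rfl fun n hn => ?_
    rw [hC k.1 n fun i => ?_]
    have h1 := mem_cube.1 hn i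
    obtain ⟨q, hq⟩ := k.2 i
    rw [intBlock, intBlock]
    have h2 : n i / (r : ℤ) = k.1 i / r := by
      rw [hq, Int.mul_ediv_cancel_left _ hr'.ne']
      rw [hq] at h1
      have h3 : q ≤ n i / (r : ℤ) := (Int.le_ediv_iff_mul_le hr').2 (by linarith)
      have h4 : n i / (r : ℤ) < q + 1 := (Int.ediv_lt_iff_lt_mul hr').2 (by linarith)
      omega
    rw [h2]
  have h2 := mul_le_mul_of_nonneg_left hblocks (mul_nonneg zero_le_two (gammaInfty_nonneg r))
  linarith

end Lattice

/-! ### A block that separates two low-energy states -/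

section RateGap

variable {E : Type*} [NormedAddCommGroup E] [InnerProductSpace ℂ E]

theorem quadForm_smul_add_smul {T : E →ₗ[ℂ] E} (hT : T.IsSymmetric) (u v : E) (x y : ℂ) :
    quadForm T (x • u + y • v) = ‖x‖ ^ 2 * quadForm T u + ‖y‖ ^ 2 * quadForm T v +
      2 * ((starRingEnd ℂ) x * y * inner ℂ u (T v)).re := by
  rw [quadForm_add_right hT, quadForm_smul_right, quadForm_smul_right, map_smul, inner_smul_left,
    inner_smul_right, mul_assoc]

theorem norm_sq_smul_add_smul {u v : E} (hu : ‖u‖ = 1) (hv : ‖v‖ = 1) (huv : inner ℂ u v = 0)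
    (x y : ℂ) : ‖x • u + y • v‖ ^ 2 = ‖x‖ ^ 2 + ‖y‖ ^ 2 := by
  have h := norm_add_sq (𝕜 := ℂ) (x • u) (y • v)
  rw [inner_smul_left, inner_smul_right, huv] at h
  rw [h, norm_smul, norm_smul, hu, hv]
  simp

/-- In a two-dimensional subspace, either a rank one lower bound for a nonnegative form is small,
or the form separates two unit vectors. -/
theorem rank_one_le_of_no_gap {T : E →ₗ[ℂ] E} (hT : T.IsSymmetric) (hT0 : ∀ v, 0 ≤ quadForm T v)
    {φ : E} (hφ : ∀ v, ‖(inner ℂ φ v : ℂ)‖ ^ 2 ≤ quadForm T v) {u v : E} (hu : ‖u‖ = 1)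
    (hv : ‖v‖ = 1) (huv : inner ℂ u v = 0) {κ : ℝ} (hκ : 0 < κ)
    (hgap : ∀ ψ ∈ Submodule.span ℂ {u, v}, ∀ ψ' ∈ Submodule.span ℂ {u, v}, ‖ψ‖ = 1 → ‖ψ'‖ = 1 →
      quadForm T ψ - quadForm T ψ' < κ) :
    ‖(inner ℂ φ u : ℂ)‖ ^ 2 + ‖(inner ℂ φ v : ℂ)‖ ^ 2 ≤ (quadForm T u + quadForm T v + κ) / 2 := by
  set a : ℂ := inner ℂ φ u with ha
  set b : ℂ := inner ℂ φ v with hb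
  set A : ℝ := ‖a‖ ^ 2 + ‖b‖ ^ 2 with hA
  rcases (show 0 ≤ A by positivity).eq_or_lt with h0 | h0
  · rw [← h0]; linarith [hT0 u, hT0 v]
  -- `w` is parallel to the projection of `φ` onto the plane and `w'` is orthogonal to both `w` and
  -- `φ`; each has squared norm `A`. Invariance of the trace gives the sum of the two forms, the
  -- absence of a gap bounds their difference by `κ * A`, and the rank one bound gives at least `A ^
  -- 2` on `w`.
  set w : E := (starRingEnd ℂ) a • u + (starRingEnd ℂ) b • v with hw
  set w' : E := b • u + (-a) • v with hw'
  have hmem : ∀ x y : ℂ, x • u + y • v ∈ Submodule.span ℂ {u, v} := fun x y =>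
    Submodule.mem_span_pair.2 ⟨x, y, rfl⟩
  have hwn : ‖w‖ ^ 2 = A := by
    rw [hw, norm_sq_smul_add_smul hu hv huv, RCLike.norm_conj, RCLike.norm_conj]
  have hwn' : ‖w'‖ ^ 2 = A := by
    rw [hw', norm_sq_smul_add_smul hu hv huv, norm_neg, hA, add_comm]
  have hsum : quadForm T w + quadForm T w' = A * (quadForm T u + quadForm T v) := by
    rw [hw, hw', quadForm_smul_add_smul hT, quadForm_smul_add_smul hT, RCLike.norm_conj,
      RCLike.norm_conj, norm_neg, Complex.conj_conj]
    have : (starRingEnd ℂ) b * -a * inner ℂ u (T v) =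
        -(a * (starRingEnd ℂ) b * inner ℂ u (T v)) := by
      ring
    rw [this, Complex.neg_re, hA]
    ring
  have hinner : (inner ℂ φ w : ℂ) = A := by
    rw [hw, inner_add_right, inner_smul_right, inner_smul_right, ← ha, ← hb,
      mul_comm _ a, mul_comm _ b, Complex.mul_conj, Complex.mul_conj, Complex.normSq_eq_norm_sq,
      Complex.normSq_eq_norm_sq, hA]
    push_cast; rfl
  have hlow : A ^ 2 ≤ quadForm T w := by
    have := hφ w
    rwa [hinner, Complex.norm_of_nonneg h0.le] at this
  have hs : 0 < √A := Real.sqrt_pos.2 h0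
  have hnorm : ∀ z : E, ‖z‖ ^ 2 = A → ‖(((√A)⁻¹ : ℝ) : ℂ) • z‖ = 1 := by
    intro z hz
    have : ‖z‖ = √A := by rw [← hz, Real.sqrt_sq (norm_nonneg z)]
    rw [norm_smul, Complex.norm_of_nonneg (inv_nonneg.2 hs.le), this, inv_mul_cancel₀ hs.ne']
  have hq : ∀ z : E, quadForm T ((((√A)⁻¹ : ℝ) : ℂ) • z) = A⁻¹ * quadForm T z := by
    intro z
    rw [quadForm_smul_right, Complex.norm_of_nonneg (inv_nonneg.2 hs.le), inv_pow,
      Real.sq_sqrt h0.le]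
  have h1 := hgap _ (Submodule.smul_mem _ (((√A)⁻¹ : ℝ) : ℂ) (hmem _ _)) _
    (Submodule.smul_mem _ (((√A)⁻¹ : ℝ) : ℂ) (hmem _ _)) (hnorm w hwn) (hnorm w' hwn')
  rw [hq, hq, ← mul_sub, inv_mul_lt_iff₀ h0] at h1
  have h2 : A * (2 * A) ≤ A * (quadForm T u + quadForm T v + κ) := by nlinarith
  have h3 := le_of_mul_le_mul_left h2 h0
  linarith

/-- If the energy of two orthonormal vectors is small, then some block separates unit vectors in
their span. -/
theorem exists_rate_gap {ι : Type*} [Fintype ι] {K : ι → E →ₗ[ℂ] E}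
    (hK : ∀ k, (K k).IsSymmetric) (hK0 : ∀ k v, 0 ≤ quadForm (K k) v)
    (hsum : ∀ v, ∑ k, quadForm (K k) v = ‖v‖ ^ 2) {φ : ι → E}
    (hφ : ∀ k v, ‖(inner ℂ (φ k) v : ℂ)‖ ^ 2 ≤ quadForm (K k) v) {q : E → ℝ} {lam Γ : ℝ}
    (hΓ : 0 ≤ Γ)
    (hq : ∀ v, lam * ‖v‖ ^ 2 +
      Γ * ∑ k, (quadForm (K k) v - ‖(inner ℂ (φ k) v : ℂ)‖ ^ 2) ≤ q v)
    {u v : E} (hu : ‖u‖ = 1) (hv : ‖v‖ = 1) (huv : inner ℂ u v = 0) (hle : q u + q v ≤ Γ)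
    {κ : ℝ} (hκ : 0 < κ) (hκlam : κ * Γ * Fintype.card ι < 4 * lam) :
    ∃ k, ∃ ψ ∈ Submodule.span ℂ {u, v}, ∃ ψ' ∈ Submodule.span ℂ {u, v}, ‖ψ‖ = 1 ∧ ‖ψ'‖ = 1 ∧
      κ ≤ quadForm (K k) ψ - quadForm (K k) ψ' := by
  -- Without a separating block, the rank one terms of `u` and `v` sum to at most 1 + κN/2 with N
  -- the number of blocks. Hence `q u + q v` is at least 2 lam + Γ - κΓN/2, which exceeds Γ.
  by_contra! hno
  have hk := fun k => rank_one_le_of_no_gap (hK k) (hK0 k) (hφ k) hu hv huv hκ (hno k)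
  have h1 := Finset.sum_le_sum fun k (_ : k ∈ Finset.univ) => hk k
  simp only [← Finset.sum_div, Finset.sum_add_distrib, hsum, hu, hv, Finset.sum_const,
    Finset.card_univ, nsmul_eq_mul] at h1
  have hqu := hq u
  have hqv := hq v
  rw [Finset.sum_sub_distrib, hsum] at hqu hqv
  rw [hu] at hqu
  rw [hv] at hqv
  have h2 := mul_le_mul_of_nonneg_left h1 hΓ
  linarith

end RateGap

/-! ### Matrices as operators on Euclidean space -/

section Matrices

theorem isHermitian_diagonal_indicator {n : Type*} [DecidableEq n] (p : n → Prop)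
    [DecidablePred p] : (Matrix.diagonal fun i => if p i then (1 : ℂ) else 0).IsHermitian := by
  rw [Matrix.isHermitian_diagonal_iff]
  intro i
  split_ifs <;> simp

variable {n : Type*} [Fintype n] [DecidableEq n]

theorem traceSpectralProjection_eq_sum {A : Matrix n n ℂ} (hA : A.IsHermitian) (I : Set ℝ) :
    traceSpectralProjection I A = ∑ i, I.indicator (fun _ => (1 : ℝ)) (hA.eigenvalues i) := by
  rw [traceSpectralProjection, hA.cfc_eq, Matrix.IsHermitian.cfc, Unitary.conjStarAlgAut_apply,
    Matrix.trace_mul_comm, ← mul_assoc, Unitary.coe_star_mul_self, one_mul, Matrix.trace_diagonal,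
    Complex.re_sum]
  rfl

theorem exists_two_eigenvalues {A : Matrix n n ℂ} (hA : A.IsHermitian) {I : Set ℝ}
    (h : 2 ≤ traceSpectralProjection I A) :
    ∃ i j, i ≠ j ∧ hA.eigenvalues₀ i ∈ I ∧ hA.eigenvalues₀ j ∈ I := by
  classical
  rw [traceSpectralProjection_eq_sum hA] at h
  have h1 : 1 < (Finset.univ.filter fun i => hA.eigenvalues i ∈ I).card := by
    have h2 : ∑ i, I.indicator (fun _ => (1 : ℝ)) (hA.eigenvalues i) =
        (Finset.univ.filter fun i => hA.eigenvalues i ∈ I).card := by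
      simp only [Set.indicator_apply, Finset.sum_boole]
    rw [h2] at h
    exact_mod_cast h
  obtain ⟨i, hi, j, hj, hij⟩ := Finset.one_lt_card.1 h1
  exact ⟨_, _, fun h => hij ((Fintype.equivOfCardEq (Fintype.card_fin _)).symm.injective h),
    (Finset.mem_filter.1 hi).2, (Finset.mem_filter.1 hj).2⟩

theorem quadForm_toEuclideanLin (A : Matrix n n ℂ) (v : EuclideanSpace ℂ n) :
    quadForm (Matrix.toEuclideanLin A) v =
      ∑ i, ((starRingEnd ℂ) (v i) * ∑ j, A i j * v j).re := by
  rw [quadForm, PiLp.inner_apply, Complex.re_sum]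
  refine Finset.sum_congr rfl fun i _ => ?_
  rw [RCLike.inner_apply, mul_comm]
  rfl

theorem quadForm_diagonal_indicator (p : n → Prop) [DecidablePred p] (v : EuclideanSpace ℂ n) :
    quadForm (Matrix.toEuclideanLin (Matrix.diagonal fun i => if p i then (1 : ℂ) else 0)) v =
      ∑ i, if p i then ‖v i‖ ^ 2 else 0 := by
  rw [quadForm_toEuclideanLin]
  refine Finset.sum_congr rfl fun i _ => ?_
  simp only [Matrix.diagonal_apply, ite_mul, zero_mul, Finset.sum_ite_eq, Finset.mem_univ, if_true]
  split_ifs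
  · rw [one_mul, mul_comm, Complex.mul_conj, Complex.normSq_eq_norm_sq, Complex.ofReal_re]
  · simp

theorem norm_diagonal_indicator_le (p : n → Prop) [DecidablePred p] (v : EuclideanSpace ℂ n) :
    ‖Matrix.toEuclideanLin (Matrix.diagonal fun i => if p i then (1 : ℂ) else 0) v‖ ≤ ‖v‖ := by
  rw [EuclideanSpace.norm_eq, EuclideanSpace.norm_eq]
  refine Real.sqrt_le_sqrt (Finset.sum_le_sum fun i _ => ?_)
  simp only [Matrix.toLpLin_apply, Matrix.mulVec_diagonal]
  split_ifs <;> simp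

theorem finrank_range_diagonal_indicator_le (p : n → Prop) [DecidablePred p] {R : ℕ}
    (hR : (Finset.univ.filter p).card ≤ R) :
    Module.finrank ℂ (LinearMap.range
      (Matrix.toEuclideanLin (Matrix.diagonal fun i => if p i then (1 : ℂ) else 0))) ≤ R := by
  rw [Matrix.toEuclideanLin_eq_toLin_orthonormal, ← Matrix.rank_eq_finrank_range_toLin _
    (EuclideanSpace.basisFun n ℂ).toBasis (EuclideanSpace.basisFun n ℂ).toBasis,
    Matrix.rank_diagonal]
  refine le_trans (le_of_eq ?_) hR
  rw [Fintype.card_subtype]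
  congr 1
  ext i
  simp

end Matrices

/-! ### The random Schrödinger operators as a covering family -/

section BlockFamily

variable {d r L : ℕ} {c : Site d}

theorem isHermitian_localLaplacian (L : ℕ) (c : Site d) : (localLaplacian L c).IsHermitian := by
  refine Matrix.IsHermitian.ext fun n k => ?_
  have h1 : ∑ i, |n.1 i - k.1 i| = ∑ i, |k.1 i - n.1 i| :=
    Finset.sum_congr rfl fun i _ => abs_sub_comm _ _
  simp only [localLaplacian, latticeLaplacian, Matrix.submatrix_apply, h1, eq_comm (a := k.1)]
  split_ifs <;> simp

/-- The indicator function of a block, as a multiplication operator on the cube. -/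
noncomputable def blockIndicator (L : ℕ) (c : Site d) (k : BlockSite d r) :
    Matrix (cube L c) (cube L c) ℂ :=
  Matrix.diagonal fun n => if n.1 ∈ cube r k.1 then 1 else 0

theorem sum_ite_mem_block {α : Type*} [AddCommMonoid α] (hr : 1 ≤ r) (hc : ∀ i, (r : ℤ) ∣ c i)
    {n : Site d} (hn : n ∈ cube L c) (g : BlockSite d r → α) :
    (∑ k ∈ boxIndex r L c, if n ∈ cube r k.1 then g k else 0) = g (blockVertex r n) := by
  simp only [← blockVertex_eq_iff hr]
  rw [Finset.sum_ite_eq, if_pos (blockVertex_mem_boxIndex hr hc hn)]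

theorem localPotential_eq_sum (ω : BlockSite d r → ℝ) : localPotential r L c ω =
    ∑ k : boxIndex r L c, (ω k : ℂ) • blockIndicator L c k.1 := by
  rw [Finset.sum_coe_sort (boxIndex r L c) fun k => (ω k : ℂ) • blockIndicator L c k]
  ext n k
  rw [Matrix.sum_apply]
  simp only [localPotential, blockIndicator, Matrix.smul_apply, Matrix.diagonal_apply]
  split_ifs with h
  · push_cast
    refine Finset.sum_congr rfl fun k _ => ?_
    split_ifs <;> simp
  · simp

theorem sum_blockIndicator (hr : 1 ≤ r) (hc : ∀ i, (r : ℤ) ∣ c i) :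
    ∑ k : boxIndex r L c, blockIndicator L c k.1 = 1 := by
  rw [Finset.sum_coe_sort (boxIndex r L c) fun k => blockIndicator L c k]
  ext n k
  rw [Matrix.sum_apply]
  simp only [blockIndicator, Matrix.diagonal_apply, Matrix.one_apply]
  split_ifs with h
  · exact sum_ite_mem_block hr hc n.2 fun _ => (1 : ℂ)
  · simp

/-- The random operators on a cube, as a family of operators on Euclidean space. -/
noncomputable def blockFamily (L : ℕ) (hr : 1 ≤ r) (hc : ∀ i, (r : ℤ) ∣ c i) :
    CoveringFamily (EuclideanSpace ℂ (cube L c)) (boxIndex r L c) where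
  T₀ := Matrix.toEuclideanLin (localLaplacian L c)
  K k := Matrix.toEuclideanLin (blockIndicator L c k.1)
  symm₀ := Matrix.isSymmetric_toEuclideanLin_iff.2 (isHermitian_localLaplacian L c)
  symm k := Matrix.isSymmetric_toEuclideanLin_iff.2 (isHermitian_diagonal_indicator _)
  nonneg k v := by
    rw [blockIndicator, quadForm_diagonal_indicator]
    exact Finset.sum_nonneg fun i _ => by split_ifs <;> positivity
  contr k v := norm_diagonal_indicator_le _ v
  sum_eq_one := by
    rw [← map_sum, sum_blockIndicator hr hc]
    exact Matrix.toLpLin_one 2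

theorem blockFamily_op (hr : 1 ≤ r) (hc : ∀ i, (r : ℤ) ∣ c i) (ω : BlockSite d r → ℝ) :
    (blockFamily L hr hc).op (fun k => ω k.1) =
      Matrix.toEuclideanLin (localHamiltonian r L c ω) := by
  rw [localHamiltonian, localPotential_eq_sum, map_add, map_sum]
  simp only [map_smul]
  rfl

theorem isHermitian_localHamiltonian (hr : 1 ≤ r) (hc : ∀ i, (r : ℤ) ∣ c i)
    (ω : BlockSite d r → ℝ) : (localHamiltonian r L c ω).IsHermitian := by
  rw [← Matrix.isSymmetric_toEuclideanLin_iff, ← blockFamily_op hr hc]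
  exact CoveringFamily.op_isSymmetric _ _

theorem eigenvalues_congr {E : Type*} [NormedAddCommGroup E] [InnerProductSpace ℂ E]
    [FiniteDimensional ℂ E] {m : ℕ} {S T : E →ₗ[ℂ] E} (h : S = T) (hS : S.IsSymmetric)
    (hT : T.IsSymmetric) (hn : Module.finrank ℂ E = m) : hS.eigenvalues hn = hT.eigenvalues hn := by
  subst h; rfl

theorem blockFamily_level (hr : 1 ≤ r) (hc : ∀ i, (r : ℤ) ∣ c i) (ω : BlockSite d r → ℝ)
    (hH : (localHamiltonian r L c ω).IsHermitian) :
    (blockFamily L hr hc).level finrank_euclideanSpace (fun k => ω k.1) = hH.eigenvalues₀ :=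
  eigenvalues_congr (blockFamily_op hr hc ω) _ _ _

theorem card_cube (s : ℕ) (n : Site d) : (cube s n).card = s ^ d := by
  simp [cube, Fintype.card_piFinset]

theorem blockFamily_rank_le (hr : 1 ≤ r) (hc : ∀ i, (r : ℤ) ∣ c i) (k : boxIndex r L c) :
    Module.finrank ℂ (LinearMap.range ((blockFamily L hr hc).K k)) ≤ r ^ d := by
  refine finrank_range_diagonal_indicator_le _ ?_
  rw [← card_cube r k.1.1]
  refine Finset.card_le_card_of_injOn Subtype.val (fun n hn => ?_) Subtype.val_injective.injOn
  exact (Finset.mem_filter.1 hn).2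

theorem card_boxIndex_le : Fintype.card (boxIndex r L c) ≤ L ^ d := by
  rw [Fintype.card_coe, ← card_cube L c]
  exact Finset.card_le_card_of_injOn Subtype.val (fun k hk => mem_boxIndex.1 hk)
    Subtype.val_injective.injOn

/-- Extension by zero. -/
noncomputable def extendZero (v : EuclideanSpace ℂ (cube L c)) (n : Site d) : ℂ :=
  if h : n ∈ cube L c then v ⟨n, h⟩ else 0

theorem extendZero_val (v : EuclideanSpace ℂ (cube L c)) (n : cube L c) :
    extendZero v n.1 = v n := by
  rw [extendZero, dif_pos n.2]

theorem norm_sq_eq_sum_cube (v : EuclideanSpace ℂ (cube L c)) :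
    ‖v‖ ^ 2 = ∑ n ∈ cube L c, ‖extendZero v n‖ ^ 2 := by
  rw [EuclideanSpace.norm_sq_eq, ← Finset.sum_coe_sort (cube L c)
    fun n => ‖extendZero v n‖ ^ 2]
  simp only [extendZero_val]

theorem quadForm_localLaplacian (v : EuclideanSpace ℂ (cube L c)) :
    quadForm (Matrix.toEuclideanLin (localLaplacian L c)) v = 2 * d * ‖v‖ ^ 2 -
      ∑ n ∈ cube L c, ∑ k ∈ cube L c, (if ∑ i, |k i - n i| = 1 then
        ((starRingEnd ℂ) (extendZero v n) * extendZero v k).re else 0) := by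
  rw [quadForm_toEuclideanLin, EuclideanSpace.norm_sq_eq, Finset.mul_sum,
    ← Finset.sum_coe_sort (cube L c) fun n => ∑ k ∈ cube L c, (if ∑ i, |k i - n i| = 1 then
      ((starRingEnd ℂ) (extendZero v n) * extendZero v k).re else 0), ← Finset.sum_sub_distrib]
  refine Finset.sum_congr rfl fun n _ => ?_
  rw [← Finset.sum_coe_sort (cube L c) fun k => (if ∑ i, |k i - n.1 i| = 1 then
    ((starRingEnd ℂ) (extendZero v n.1) * extendZero v k).re else 0)]
  simp only [extendZero_val]
  have h1 : ∀ k : cube L c, localLaplacian L c n k * v k =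
      (if n = k then 2 * (d : ℂ) * v k else 0) - if ∑ i, |k.1 i - n.1 i| = 1 then v k else 0 := by
    intro k
    simp only [localLaplacian, latticeLaplacian, Matrix.submatrix_apply, Subtype.ext_iff]
    by_cases h : n.1 = k.1
    · rw [if_pos h, if_pos h, h]; simp
    · rw [if_neg h, if_neg h]; split_ifs <;> simp
  simp only [h1, Finset.sum_sub_distrib, Finset.sum_ite_eq, Finset.mem_univ, if_true, mul_sub,
    Complex.sub_re]
  congr 1
  · rw [mul_left_comm, mul_comm _ (v n), Complex.mul_conj, Complex.normSq_eq_norm_sq]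
    norm_cast
  · rw [Finset.mul_sum, Complex.re_sum]
    refine Finset.sum_congr rfl fun k _ => ?_
    split_ifs <;> simp

theorem sum_cube_ite_block (hr : 1 ≤ r) (hrL : r ∣ L) (hc : ∀ i, (r : ℤ) ∣ c i)
    {α : Type*} [AddCommMonoid α] {k : BlockSite d r} (hk : k ∈ boxIndex r L c) (g : Site d → α) :
    (∑ n : cube L c, if n.1 ∈ cube r k.1 then g n.1 else 0) = ∑ n ∈ cube r k.1, g n := by
  rw [Finset.sum_coe_sort (cube L c) fun n => if n ∈ cube r k.1 then g n else 0,
    ← Finset.sum_filter]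
  refine Finset.sum_congr ?_ fun _ _ => rfl
  ext n
  rw [Finset.mem_filter]
  exact ⟨fun h => h.2, fun h => ⟨mem_cube_of_mem_block hr hrL hc hk h, h⟩⟩

theorem quadForm_blockFamily_K (hr : 1 ≤ r) (hrL : r ∣ L) (hc : ∀ i, (r : ℤ) ∣ c i)
    (k : boxIndex r L c) (v : EuclideanSpace ℂ (cube L c)) :
    quadForm ((blockFamily L hr hc).K k) v = ∑ n ∈ cube r k.1.1, ‖extendZero v n‖ ^ 2 := by
  rw [← sum_cube_ite_block hr hrL hc k.2]
  simp only [extendZero_val]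
  exact quadForm_diagonal_indicator (fun n : cube L c => n.1 ∈ cube r k.1.1) v

/-- The Laplacian, or its reflection for `σ = -1`, is bounded from below by its ground state
energy plus the distance to one-dimensional spaces on the blocks. -/
theorem exists_blockState (hr : 1 ≤ r) (hL : 1 ≤ L) (hrL : r ∣ L)
    (hc : ∀ i, (r : ℤ) ∣ c i) {σ : ℝ} {e : ℤ → ℝ} (he : ∀ x, e x ^ 2 = 1)
    (heσ : ∀ x y, |y - x| = 1 → e x * e y = σ) :
    ∃ φ : boxIndex r L c → EuclideanSpace ℂ (cube L c),
      (∀ k v, ‖(inner ℂ (φ k) v : ℂ)‖ ^ 2 ≤ quadForm ((blockFamily L hr hc).K k) v) ∧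
      ∀ v, d * (2 - 2 * Real.cos (Real.pi / (L + 1))) * ‖v‖ ^ 2 + 2 * gammaInfty r *
        ∑ k, (quadForm ((blockFamily L hr hc).K k) v - ‖(inner ℂ (φ k) v : ℂ)‖ ^ 2) ≤
        2 * d * ‖v‖ ^ 2 - σ * (2 * d * ‖v‖ ^ 2 - quadForm (blockFamily L hr hc).T₀ v) := by
  obtain ⟨φ, hφ, hbound⟩ := exists_cube_bound hr hL hrL hc he heσ
  set Φ : boxIndex r L c → EuclideanSpace ℂ (cube L c) := fun k =>
    WithLp.toLp 2 fun n => if n.1 ∈ cube r k.1.1 then (φ n.1 : ℂ) else 0 with hΦ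
  have hinner : ∀ k v, (inner ℂ (Φ k) v : ℂ) = ∑ n ∈ cube r k.1.1, (φ n : ℂ) * extendZero v n := by
    intro k v
    rw [← sum_cube_ite_block hr hrL hc k.2, PiLp.inner_apply]
    refine Finset.sum_congr rfl fun n _ => ?_
    rw [RCLike.inner_apply, extendZero_val]
    simp only [hΦ]
    split_ifs
    · rw [mul_comm]; simp
    · simp
  refine ⟨Φ, fun k v => ?_, fun v => ?_⟩
  · rw [hinner, quadForm_blockFamily_K hr hrL hc]
    calc ‖∑ n ∈ cube r k.1.1, (φ n : ℂ) * extendZero v n‖ ^ 2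
        ≤ (∑ n ∈ cube r k.1.1, |φ n| * ‖extendZero v n‖) ^ 2 := by
          gcongr
          refine (norm_sum_le _ _).trans (le_of_eq (Finset.sum_congr rfl fun n _ => ?_))
          rw [norm_mul, Complex.norm_real, Real.norm_eq_abs]
      _ ≤ (∑ n ∈ cube r k.1.1, |φ n| ^ 2) * ∑ n ∈ cube r k.1.1, ‖extendZero v n‖ ^ 2 :=
          Finset.sum_mul_sq_le_sq_mul_sq _ _ _
      _ = _ := by simp only [sq_abs, hφ k.1 k.2, one_mul]
  · have h1 := hbound (extendZero v)
    have h2 : quadForm (blockFamily L hr hc).T₀ v = _ := quadForm_localLaplacian v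
    rw [h2, sub_sub_cancel]
    simp only [hinner, quadForm_blockFamily_K hr hrL hc]
    rw [Finset.sum_coe_sort (boxIndex r L c) fun k => (∑ n ∈ cube r k.1, ‖extendZero v n‖ ^ 2 -
      ‖∑ n ∈ cube r k.1, (φ n : ℂ) * extendZero v n‖ ^ 2), norm_sq_eq_sum_cube]
    exact h1

end BlockFamily

/-! ### Separation at the band edges -/

section BandEdge

variable {d r L : ℕ} {c : Site d}

theorem gammaInfty_le_two (r : ℕ) : gammaInfty r ≤ 2 := by
  rw [gammaInfty]; linarith [Real.neg_one_le_cos (Real.pi / r)]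

/-- An interval inside the band edge set lies at one of the two band edges. -/
theorem subset_band_edge (hd : 1 ≤ d) {I : Set ℝ} (hI : I.OrdConnected)
    (hIs : I ⊆ bandEdgeSet d r) {x y : ℝ} (hx : x ∈ I) (hy : y ∈ I) :
    (x ≤ gammaInfty r ∧ y ≤ gammaInfty r) ∨
      (4 * d + 1 - gammaInfty r ≤ x ∧ 4 * d + 1 - gammaInfty r ≤ y) := by
  have hd' : (1 : ℝ) ≤ d := by exact_mod_cast hd
  have hγ := gammaInfty_le_two r
  -- Since γ ≤ 2 and d ≥ 1, the point 5/2 lies strictly between the two components.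
  have hno : (5 / 2 : ℝ) ∉ I := by
    intro h
    rcases hIs h with h1 | h1
    · linarith [h1.2]
    · linarith [h1.1]
  have hcross : ∀ x ∈ I, ∀ y ∈ I, x ≤ gammaInfty r → 4 * d + 1 - gammaInfty r ≤ y → False :=
    fun x hx y hy h1 h2 => hno (hI.out hx hy ⟨by linarith, by linarith⟩)
  rcases hIs hx with h1 | h1 <;> rcases hIs hy with h2 | h2
  · exact Or.inl ⟨h1.2, h2.2⟩
  · exact (hcross x hx y hy h1.2 h2.1).elim
  · exact (hcross y hy x hx h2.2 h1.1).elim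
  · exact Or.inr ⟨h1.1, h2.1⟩

theorem CoveringFamily.quadForm_op_eigvec {E ι : Type*} [NormedAddCommGroup E]
    [InnerProductSpace ℂ E] [Fintype ι] [FiniteDimensional ℂ E] (F : CoveringFamily E ι) {m : ℕ}
    (hn : Module.finrank ℂ E = m) (ω : ι → ℝ) (j : Fin m) :
    quadForm (F.op ω) (F.eigvec hn ω j) = F.level hn ω j := by
  rw [quadForm, eigvec, LinearMap.IsSymmetric.apply_eigenvectorBasis, inner_smul_right,
    inner_self_eq_norm_sq_to_K, OrthonormalBasis.norm_eq_one]
  simp [level]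

/-- For two levels near a band edge, some block separates unit vectors in the span of the
eigenvectors. -/
theorem blockFamily_exists_gap (hd : 1 ≤ d) (hr : 1 ≤ r) (hL : 1 ≤ L) (hrL : r ∣ L)
    (hc : ∀ i, (r : ℤ) ∣ c i) {I : Set ℝ} (hI : I.OrdConnected) (hIs : I ⊆ bandEdgeSet d r)
    {κ : ℝ} (hκ : 0 < κ) (hκL : κ * (2 * gammaInfty r) * Fintype.card (boxIndex r L c) <
      4 * (d * (2 - 2 * Real.cos (Real.pi / (L + 1)))))
    {m : ℕ} (hn : Module.finrank ℂ (EuclideanSpace ℂ (cube L c)) = m)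
    {ω : boxIndex r L c → ℝ} (hω : ∀ k, ω k ∈ Set.Icc (0 : ℝ) 1) {i j : Fin m} (hij : i ≠ j)
    (hi : (blockFamily L hr hc).level hn ω i ∈ I) (hj : (blockFamily L hr hc).level hn ω j ∈ I) :
    ∃ k, ∃ ψ ∈ Submodule.span ℂ {(blockFamily L hr hc).eigvec hn ω i,
        (blockFamily L hr hc).eigvec hn ω j},
      ∃ ψ' ∈ Submodule.span ℂ {(blockFamily L hr hc).eigvec hn ω i,
        (blockFamily L hr hc).eigvec hn ω j}, ‖ψ‖ = 1 ∧ ‖ψ'‖ = 1 ∧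
      κ ≤ quadForm ((blockFamily L hr hc).K k) ψ - quadForm ((blockFamily L hr hc).K k) ψ' := by
  set F := blockFamily L hr hc with hF
  have hnorm : ∀ j, ‖F.eigvec hn ω j‖ = 1 := fun j => OrthonormalBasis.norm_eq_one _ j
  have hop := fun j => F.quadForm_op_eigvec hn ω j
  simp only [F.quadForm_op] at hop
  have hV0 : ∀ v, 0 ≤ ∑ k, ω k * quadForm (F.K k) v := fun v =>
    Finset.sum_nonneg fun k _ => mul_nonneg (hω k).1 (F.nonneg k v)
  have hV1 : ∀ v, ∑ k, ω k * quadForm (F.K k) v ≤ ‖v‖ ^ 2 := fun v => by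
    rw [← F.sum_quadForm]
    exact Finset.sum_le_sum fun k _ => mul_le_of_le_one_left (F.nonneg k v) (hω k).2
  have horth : (inner ℂ (F.eigvec hn ω i) (F.eigvec hn ω j) : ℂ) = 0 :=
    (F.eigvec hn ω).orthonormal.2 hij
  have hΓ : 0 ≤ 2 * gammaInfty r := mul_nonneg zero_le_two (gammaInfty_nonneg r)
  rcases subset_band_edge hd hI hIs hi hj with ⟨h1, h2⟩ | ⟨h1, h2⟩
  -- Lower edge: the potential is nonnegative, so each state has kinetic energy at most γ.
  · obtain ⟨φ, hφ, hbound⟩ := exists_blockState (c := c) hr hL hrL hc (σ := 1) (e := fun _ => 1)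
      (fun _ => by norm_num) (fun _ _ _ => by norm_num)
    refine exists_rate_gap F.symm F.nonneg F.sum_quadForm hφ hΓ hbound (hnorm i) (hnorm j) horth ?_
      hκ hκL
    have hi' := hop i
    have hj' := hop j
    have h3 := hV0 (F.eigvec hn ω i)
    have h4 := hV0 (F.eigvec hn ω j)
    rw [← hF]
    linarith
  -- Upper edge: the staggered sign exchanges H₀ for 4d - H₀. The potential is at most 1, so each
  -- state has energy at most γ with respect to 4d - H₀.
  · obtain ⟨φ, hφ, hbound⟩ := exists_blockState (c := c) hr hL hrL hc (σ := -1)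
      (e := fun x => if Even x then 1 else -1) (fun x => by split_ifs <;> norm_num)
      (fun x y hxy => by
        have h : Even y ↔ ¬ Even x := by
          rcases (abs_eq zero_le_one).1 hxy with h | h
          · rw [show y = x + 1 by omega, Int.even_add_one]
          · rw [show x = y + 1 by omega, Int.even_add_one, not_not]
        by_cases hx : Even x
        · rw [if_pos hx, if_neg (by tauto)]; norm_num
        · rw [if_neg hx, if_pos (by tauto)]; norm_num)
    refine exists_rate_gap F.symm F.nonneg F.sum_quadForm hφ hΓ hbound (hnorm i) (hnorm j) horth ?_
      hκ hκL
    have hi' := hop i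
    have hj' := hop j
    have h3 := hV1 (F.eigvec hn ω i)
    have h4 := hV1 (F.eigvec hn ω j)
    rw [← hF]
    rw [hnorm] at h3 h4 ⊢
    rw [hnorm]
    linarith

/-- The threshold for the separation of unit vectors. -/
theorem gap_threshold (hd : 1 ≤ d) (hL : 1 ≤ L) :
    1 / (2 * (L : ℝ) ^ (d + 2)) * (2 * gammaInfty r) * Fintype.card (boxIndex r L c) <
      4 * (d * (2 - 2 * Real.cos (Real.pi / (L + 1)))) := by
  have hL' : (1 : ℝ) ≤ L := by exact_mod_cast hL
  have hd' : (1 : ℝ) ≤ d := by exact_mod_cast hd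
  have hN : (Fintype.card (boxIndex r L c) : ℝ) ≤ (L : ℝ) ^ d := by
    exact_mod_cast card_boxIndex_le
  have hγ := gammaInfty_le_two r
  have hγ0 := gammaInfty_nonneg r
  -- This uses cos x ≤ 1 - 2x²/π² for |x| ≤ π, and L + 1 ≤ 2L.
  have hcos : 1 / (L : ℝ) ^ 2 ≤ 2 - 2 * Real.cos (Real.pi / (L + 1)) := by
    have h1 := Real.cos_le_one_sub_mul_cos_sq (x := Real.pi / (L + 1)) (by
      rw [abs_of_nonneg (by positivity)]
      exact div_le_self Real.pi_pos.le (by linarith))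
    have h2 : 2 / Real.pi ^ 2 * (Real.pi / (L + 1)) ^ 2 = 2 / ((L : ℝ) + 1) ^ 2 := by
      field_simp
    have h3 : 1 / (L : ℝ) ^ 2 ≤ 4 / ((L : ℝ) + 1) ^ 2 := by
      rw [div_le_div_iff₀ (by positivity) (by positivity)]
      nlinarith
    rw [h2] at h1
    have h4 : (4 : ℝ) / ((L : ℝ) + 1) ^ 2 = 2 * (2 / ((L : ℝ) + 1) ^ 2) := by ring
    linarith
  have hL2 : 0 < 1 / (L : ℝ) ^ 2 := by positivity
  calc 1 / (2 * (L : ℝ) ^ (d + 2)) * (2 * gammaInfty r) * Fintype.card (boxIndex r L c)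
      ≤ 1 / (2 * (L : ℝ) ^ (d + 2)) * (2 * 2) * (L : ℝ) ^ d := by gcongr
    _ = 2 * (1 / (L : ℝ) ^ 2) := by field_simp; ring
    _ < 4 * (1 * (1 / (L : ℝ) ^ 2)) := by linarith
    _ ≤ 4 * (d * (2 - 2 * Real.cos (Real.pi / (L + 1)))) := by gcongr

end BandEdge

/-! ### Choice of the energy scales -/

section Scales

/-- The length scales `δ ^ (1 - q / (2 R))`. -/
noncomputable def scale (R : ℕ) (δ : ℝ) (q : ℕ) : ℝ := δ ^ (1 - (min q R : ℕ) / (2 * R : ℝ))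

variable {R : ℕ} {δ : ℝ}

theorem scale_zero (R : ℕ) (δ : ℝ) : scale R δ 0 = δ := by simp [scale]

theorem scale_pos (hδ : 0 < δ) (q : ℕ) : 0 < scale R δ q := Real.rpow_pos_of_pos hδ _

theorem scale_mono (hδ : 0 < δ) (hδ1 : δ ≤ 1) : Monotone (scale R δ) := by
  intro q q' h
  refine Real.rpow_le_rpow_of_exponent_ge hδ hδ1 ?_
  gcongr

theorem scale_le (hR : 1 ≤ R) (hδ : 0 < δ) (hδ1 : δ ≤ 1) (q : ℕ) :
    scale R δ q ≤ δ ^ (1 / (2 * R : ℝ)) := by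
  have hR' : (1 : ℝ) ≤ R := by exact_mod_cast hR
  refine Real.rpow_le_rpow_of_exponent_ge hδ hδ1 ?_
  have h1 : ((min q R : ℕ) : ℝ) ≤ R := by exact_mod_cast min_le_right q R
  rw [le_sub_iff_add_le, ← add_div, div_le_one (by positivity)]
  linarith

/-- Geometric scales: every isolated-cluster case gains the same power of δ, while the last scale is
still δ^(1/2). -/
theorem scale_ratio (hδ : 0 < δ) {q : ℕ} (hq : q < R) :
    scale R δ q / scale R δ (q + 1) = δ ^ (1 / (2 * R : ℝ)) := by
  rw [scale, scale, ← Real.rpow_sub hδ, min_eq_left hq.le, min_eq_left hq]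
  congr 1
  push_cast
  ring

/-- The product is (2/t + 1) τ₀ with τ₀ = 10 ε_q / κ and t = κ ε_(q+1) / 8. The ratio term gives 160
/ κ² and the remaining τ₀ at most 10 / κ², hence 170. -/
theorem scale_condition (hR : 1 ≤ R) (hδ : 0 < δ) (hδ1 : δ ≤ 1) {κ : ℝ} (hκ : 0 < κ)
    (hκ1 : κ ≤ 1) {q : ℕ} (hq : q < R) :
    (2 / (κ * scale R δ (q + 1) / 8) + 1) * (5 * (2 * scale R δ q) / κ) ≤
      170 / κ ^ 2 * δ ^ (1 / (2 * R : ℝ)) := by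
  have h0 := scale_pos (R := R) hδ (q + 1)
  have h1 : (2 / (κ * scale R δ (q + 1) / 8) + 1) * (5 * (2 * scale R δ q) / κ) =
      160 / κ ^ 2 * (scale R δ q / scale R δ (q + 1)) + 10 / κ * scale R δ q := by
    field_simp
    ring
  rw [h1, scale_ratio hδ hq]
  have h2 : 10 / κ ≤ 10 / κ ^ 2 := by
    gcongr
    nlinarith
  have h3 := scale_le hR hδ hδ1 q
  have h4 : 10 / κ * scale R δ q ≤ 10 / κ ^ 2 * δ ^ (1 / (2 * R : ℝ)) := by
    have := scale_pos (R := R) hδ q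
    gcongr
  calc _ ≤ 160 / κ ^ 2 * δ ^ (1 / (2 * R : ℝ)) + 10 / κ ^ 2 * δ ^ (1 / (2 * R : ℝ)) := by gcongr
    _ = _ := by ring

/-- Powers of `L` are absorbed by a power of `δ`, with a logarithmic gain to spare. -/
theorem pow_mul_rpow_le {A : ℝ} {θ : ℝ} (hθ : 0 < θ) {p : ℝ} :
    ∃ C : ℝ, 0 < C ∧ ∀ L δ : ℝ, Real.exp (max 1 (2 * A / θ)) ≤ L → 0 < δ →
      δ ≤ Real.exp (-(Real.log L) ^ 5) → L ^ A * δ ^ θ ≤ C * |Real.log δ| ^ (-p) := by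
  -- With y = -log δ, half of δ^θ = exp(-θ y) absorbs L^A, since y ≥ (log L)²; the other half
  -- absorbs y^p through the exponential series, which gives the constant.
  set n := ⌈p⌉₊
  refine ⟨(n.factorial : ℝ) / (θ / 2) ^ n, by positivity, fun L δ hL hδ hδL => ?_⟩
  have hL0 : 0 < L := (Real.exp_pos _).trans_le hL
  have hlog : max 1 (2 * A / θ) ≤ Real.log L := (Real.le_log_iff_exp_le hL0).2 hL
  set l := Real.log L
  have hl1 : 1 ≤ l := (le_max_left _ _).trans hlog
  have hlA : 2 * A / θ ≤ l := (le_max_right _ _).trans hlog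
  have hy : l ^ 5 ≤ -Real.log δ := by
    have := (Real.log_le_iff_le_exp hδ).2 hδL
    linarith
  have hl5 : l * l ≤ l ^ 5 := by
    rw [← sq]; exact pow_le_pow_right₀ hl1 (by norm_num)
  have hy1 : 1 ≤ -Real.log δ := by nlinarith
  have habs : |Real.log δ| = -Real.log δ := abs_of_nonpos (by linarith)
  rw [habs]
  set y := -Real.log δ with hydef
  have hy0 : 0 < y := by linarith
  have hLA : L ^ A = Real.exp (l * A) := Real.rpow_def_of_pos hL0 A
  have hδθ : δ ^ θ = Real.exp (-(θ * y)) := by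
    rw [Real.rpow_def_of_pos hδ, hydef]; congr 1; ring
  have hAl : l * A ≤ θ / 2 * y := by
    rw [div_le_iff₀ hθ] at hlA
    have : l * (2 * A) ≤ l * (l * θ) := by gcongr
    nlinarith
  rw [hLA, hδθ, ← Real.exp_add]
  have hexp : y ^ p ≤ (n.factorial : ℝ) / (θ / 2) ^ n * Real.exp (θ / 2 * y) := by
    have h1 : y ^ p ≤ y ^ n := by
      rw [← Real.rpow_natCast]
      exact Real.rpow_le_rpow_of_exponent_le hy1 (Nat.le_ceil p)
    have h2 := Real.pow_div_factorial_le_exp (x := θ / 2 * y) (by positivity) n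
    rw [div_le_iff₀ (by positivity), mul_pow] at h2
    rw [div_mul_eq_mul_div, le_div_iff₀ (by positivity)]
    calc y ^ p * (θ / 2) ^ n ≤ y ^ n * (θ / 2) ^ n := by gcongr
      _ ≤ _ := by linarith
  rw [Real.rpow_neg hy0.le, ← div_eq_mul_inv, le_div_iff₀ (Real.rpow_pos_of_pos hy0 p)]
  calc Real.exp (l * A + -(θ * y)) * y ^ p
      ≤ Real.exp (-(θ / 2 * y)) * ((n.factorial : ℝ) / (θ / 2) ^ n * Real.exp (θ / 2 * y)) := by
        gcongr
        linarith
    _ = _ := by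
        rw [mul_left_comm, ← Real.exp_add]; simp

end Scales

/-! ### Joint law of the couplings -/

section Law

variable {Ω : Type*} [MeasurableSpace Ω] {μ : Measure Ω} {ρ : ℝ → ℝ}

theorem IsIIDWithDensity.map_eq_pi {ι κ : Type*} [Fintype κ] [IsProbabilityMeasure μ]
    {ω : ι → Ω → ℝ} (hω : IsIIDWithDensity μ ω ρ) {g : κ → ι} (hg : g.Injective) :
    μ.map (fun x k => ω (g k) x) =
      Measure.pi fun _ : κ => volume.withDensity fun x => ENNReal.ofReal (ρ x) := by
  have h := (iIndepFun_iff_map_fun_eq_pi_map fun k => (hω.measurable (g k)).aemeasurable).1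
    (hω.indep.precomp hg)
  rw [h]
  simp only [hω.law]

theorem IsIIDWithDensity.ae_mem_Icc {ι : Type*} {ω : ι → Ω → ℝ} (hρ : IsAdmissibleDensity ρ)
    (hω : IsIIDWithDensity μ ω ρ) (k : ι) : ∀ᵐ x ∂μ, ω k x ∈ Set.Icc (0 : ℝ) 1 := by
  have hms : MeasurableSet (Set.Icc (0 : ℝ) 1)ᶜ := measurableSet_Icc.compl
  have h : μ.map (ω k) (Set.Icc (0 : ℝ) 1)ᶜ = 0 := by
    rw [hω.law, withDensity_apply _ hms]
    rw [setLIntegral_congr_fun hms (g := fun _ => 0) fun x hx => by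
      simp only [hρ.eq_zero x hx, ENNReal.ofReal_zero]]
    simp
  rw [Measure.map_apply (hω.measurable k) hms] at h
  exact h

end Law

/-! ### The probability estimate -/

section Probability

variable {d r : ℕ} {Ω : Type*} [MeasurableSpace Ω] {μ : Measure Ω} [IsProbabilityMeasure μ]

/-- The probability of two eigenvalues in a short interval at the band edges. -/
theorem measure_two_eigenvalues_le (hd : 1 ≤ d) (hr : 1 ≤ r) {ρ : ℝ → ℝ}
    (hρ : IsAdmissibleDensity ρ) {ω : BlockSite d r → Ω → ℝ} (hω : IsIIDWithDensity μ ω ρ) :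
    ∃ B : ℝ, 0 < B ∧ ∀ (L : ℕ) (c : BlockSite d r) (I : Set ℝ) (δ : ℝ), r ∣ L → 1 ≤ L →
      I.OrdConnected → I ⊆ bandEdgeSet d r → 0 < δ → volume I = ENNReal.ofReal δ → δ ≤ 1 →
      μ {x | 2 ≤ traceSpectralProjection I (localHamiltonian r L c.1 fun k => ω k x)} ≤
        ENNReal.ofReal (B * ((L : ℝ) ^ (7 * d + 4) * δ ^ (1 / (2 * (r ^ d : ℕ) : ℝ)) * δ)) := by
  classical
  set ν : Measure ℝ := volume.withDensity fun x => ENNReal.ofReal (ρ x) with hν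
  have hlaw : ∀ k, μ.map (ω k) = ν := hω.law
  have hνp : IsProbabilityMeasure ν := by
    rw [← hlaw ⟨0, fun _ => dvd_zero _⟩]
    exact Measure.isProbabilityMeasure_map (hω.measurable _).aemeasurable
  obtain ⟨B, D, hB, hD, hdom⟩ := hρ.exists_dominating hνp.measure_univ
  set R := r ^ d with hR
  have hR1 : 1 ≤ R := Nat.one_le_pow _ _ hr
  -- Since 1 / κ² = 4 L^(2d+4), the factor 170 / κ² contributes 680 L^(2d+4); the counting factor
  -- m³N² is at most L^(5d), which makes the exponent 7d + 4.
  refine ⟨680 * (R + 1) * B * D, by positivity, fun L c I δ hrL hL hI hIs hδ hIδ hδ1 => ?_⟩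
  have hL' : (1 : ℝ) ≤ L := by exact_mod_cast hL
  have hcmem : c ∈ boxIndex r L c.1 := by
    rw [mem_boxIndex, mem_cube]
    intro i
    have : (1 : ℤ) ≤ L := by exact_mod_cast hL
    constructor <;> omega
  have : Nonempty (boxIndex r L c.1) := ⟨⟨c, hcmem⟩⟩
  obtain ⟨ν', hν', hν1, hνB, hν2, hνD, hνν'⟩ := hdom (Fintype.card (boxIndex r L c.1))
    Fintype.card_pos
  set F := blockFamily L hr c.2 with hF
  have hn : Module.finrank ℂ (EuclideanSpace ℂ (cube L c.1)) = Fintype.card (cube L c.1) :=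
    finrank_euclideanSpace
  set κ : ℝ := 1 / (2 * (L : ℝ) ^ (d + 2)) with hκdef
  have hLd : 1 ≤ (L : ℝ) ^ (d + 2) := one_le_pow₀ hL'
  have hκ : 0 < κ := by positivity
  have hκ1 : κ ≤ 1 := by
    rw [hκdef, div_le_one (by positivity)]; linarith
  set η : ℝ := 170 / κ ^ 2 * δ ^ (1 / (2 * R : ℝ)) with hη
  have hδθ : 0 < δ ^ (1 / (2 * R : ℝ)) := Real.rpow_pos_of_pos hδ _
  have hηR : 2 * scale R δ R ≤ η := by
    have h1 := scale_le hR1 hδ hδ1 R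
    have h2 : 2 ≤ 170 / κ ^ 2 := by
      rw [le_div_iff₀ (by positivity)]
      nlinarith
    calc 2 * scale R δ R ≤ 2 * δ ^ (1 / (2 * R : ℝ)) := by gcongr
      _ ≤ η := by rw [hη]; gcongr
  set G : Set (boxIndex r L c.1 → ℝ) := {ω | ∀ k, ω k ∈ Set.Icc (0 : ℝ) 1} with hG
  have hpi := F.pi_two_levels_le hn (blockFamily_rank_le hr c.2) (ν := ν) hB hν1 hνB hν2 hνD
    hνν' hI (scale_mono (R := R) hδ hδ1) (scale_pos hδ 0) (by rw [scale_zero, hIδ]) hκ hκ1 hηR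
    (fun q hq => scale_condition hR1 hδ hδ1 hκ hκ1 hq) (G := G)
    fun ω hω i j hij hi hj => blockFamily_exists_gap hd hr hL hrL c.2 hI hIs hκ
      (gap_threshold hd hL) hn hω hij hi hj
  have hX : μ.map (fun x (k : boxIndex r L c.1) => ω k x) = Measure.pi fun _ => ν :=
    hω.map_eq_pi Subtype.val_injective
  have hXm : AEMeasurable (fun x (k : boxIndex r L c.1) => ω k x) μ :=
    (measurable_pi_lambda _ fun k : boxIndex r L c.1 => hω.measurable k.1).aemeasurable
  rw [← hX] at hpi
  -- For any set, measurable or not, the preimage has at most the measure that the image law assigns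
  -- to the set; so measurability of the eigenvalue event plays no role.
  refine le_trans ?_ ((Measure.le_map_apply hXm _).trans (hpi.trans
    (ENNReal.ofReal_le_ofReal ?_)))
  · refine measure_mono_ae ?_
    filter_upwards [ae_all_iff.2 fun k : boxIndex r L c.1 => hω.ae_mem_Icc hρ k.1] with x hx h
    refine ⟨hx, ?_⟩
    have hH := isHermitian_localHamiltonian (L := L) hr c.2 fun k => ω k x
    obtain ⟨i, j, hij, hi, hj⟩ := exists_two_eigenvalues hH h
    rw [← blockFamily_level hr c.2] at hi hj
    exact ⟨i, j, hij, hi, hj⟩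
  · have hm : (Fintype.card (cube L c.1) : ℝ) = (L : ℝ) ^ d := by
      rw [Fintype.card_coe, card_cube]; push_cast; rfl
    have hN : (Fintype.card (boxIndex r L c.1) : ℝ) ≤ (L : ℝ) ^ d := by
      exact_mod_cast card_boxIndex_le
    have hη' : η = 680 * (L : ℝ) ^ (2 * d + 4) * δ ^ (1 / (2 * R : ℝ)) := by
      rw [hη, hκdef]
      field_simp
      ring
    rw [hm, scale_zero]
    calc ((L : ℝ) ^ d) ^ 3 * (Fintype.card (boxIndex r L c.1) : ℝ) ^ 2 * (R + 1) * (B * η * D) * δ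
        ≤ ((L : ℝ) ^ d) ^ 3 * ((L : ℝ) ^ d) ^ 2 * (R + 1) * (B * η * D) * δ := by
          have : 0 ≤ η := by positivity
          gcongr
      _ = _ := by rw [hη']; ring

end Probability

end HigherRankAnderson

theorem theorem5p1 (d r : ℕ) (hd : 1 ≤ d) (hr : 1 ≤ r)
    (ρ : ℝ → ℝ) (hρ : HigherRankAnderson.IsAdmissibleDensity ρ)
    {Ω : Type*} [MeasurableSpace Ω] (μ : Measure Ω) [IsProbabilityMeasure μ]
    (ω : HigherRankAnderson.BlockSite d r → Ω → ℝ)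
    (hω : HigherRankAnderson.IsIIDWithDensity μ ω ρ)
    (p : ℝ) (hp : 0 < p) :
    ∃ C : ℝ, 0 < C ∧ ∃ Lsp : ℝ, 0 < Lsp ∧
      ∀ (L : ℕ) (c : HigherRankAnderson.BlockSite d r) (I : Set ℝ) (δ : ℝ),
        r ∣ L → Lsp ≤ (L : ℝ) →
        I.OrdConnected → I ⊆ HigherRankAnderson.bandEdgeSet d r →
        0 < δ → volume I = ENNReal.ofReal δ → δ ≤ Real.exp (-(Real.log L) ^ 5) →
        μ.real {x | 2 ≤ HigherRankAnderson.traceSpectralProjection I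
            (HigherRankAnderson.localHamiltonian r L c.1 fun k => ω k x)}
          ≤ C * (L : ℝ) ^ (4 * d) * δ * |Real.log δ| ^ (-p) := by
  obtain ⟨B, hB, hbound⟩ := HigherRankAnderson.measure_two_eigenvalues_le hd hr hρ hω
  have hθ : (0 : ℝ) < 1 / (2 * (r ^ d : ℕ) : ℝ) := by positivity
  obtain ⟨C, hC, habs⟩ :=
    HigherRankAnderson.pow_mul_rpow_le (A := (7 * d + 4 : ℕ)) hθ (p := p)
  -- The threshold on `L` is the one under which half of δ^(1/(2R)) absorbs L^(7d+4).
  refine ⟨B * C, mul_pos hB hC, Real.exp (max 1 (2 * (7 * d + 4 : ℕ) /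
    (1 / (2 * (r ^ d : ℕ) : ℝ)))), Real.exp_pos _, fun L c I δ hrL hL hI hIs hδ hIδ hδL => ?_⟩
  have hL1 : (1 : ℝ) ≤ L := by
    refine le_trans (Real.one_le_exp ?_) hL
    exact le_trans zero_le_one (le_max_left _ _)
  have hδ1 : δ ≤ 1 := hδL.trans (Real.exp_le_one_iff.2 (by
    have := Real.log_nonneg hL1
    have : 0 ≤ Real.log L ^ 5 := by positivity
    linarith))
  have h1 := hbound L c I δ hrL (by exact_mod_cast hL1) hI hIs hδ hIδ hδ1
  have h2 := habs L δ hL hδ hδL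
  rw [Real.rpow_natCast] at h2
  have h3 : 0 ≤ |Real.log δ| ^ (-p) := Real.rpow_nonneg (abs_nonneg _) _
  refine (ENNReal.toReal_le_of_le_ofReal (by positivity) h1).trans ?_
  calc B * ((L : ℝ) ^ (7 * d + 4) * δ ^ (1 / (2 * (r ^ d : ℕ) : ℝ)) * δ)
      ≤ B * (C * |Real.log δ| ^ (-p) * δ) := by gcongr
    _ = B * C * 1 * δ * |Real.log δ| ^ (-p) := by ring
    -- The estimate already holds without the factor L^(4d), which is inserted only here.
    _ ≤ B * C * (L : ℝ) ^ (4 * d) * δ * |Real.log δ| ^ (-p) := by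
        gcongr
        exact one_le_pow₀ hL1
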